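/- An additively separable hedonic game is given by a finite set $V$ of $n\ge 1$ agents and integers $w_{uv}$ (the valuation of $u$ for $v$), $u\neq v$; its underlying graph has an edge $\{u,v\}$ whenever $w_{uv}\ne 0$ or $w_{vu}\neq 0$. For a partition $\mathcal P$ of $V$ (into coalitions), the utility of $u$ is $\sum_{v\in C_u\setminus\{u\}} w_{uv}$, where $C_u\in\mathcal P$ is the coalition containing $u$. \textsc{Max Egalitarian} asks for a partition that maximizes the minimum utility of an agent. Let $W=\max_{u\in V}\sum_{v\ne u}|w_{uv}|$. There is an algorithm that, given such a game together with a tree decomposition of its underlying graph with $N$ nodes and of width $\mathrm{tw}$ (the maximum size of a bag minus one), outputs a maximum egalitarian partition in time $(\mathrm{tw}\cdot W)^{O(\mathrm{tw})}\,(n+N)$; in particular, in time $(\mathrm{tw}\cdot W)^{O(\mathrm{tw})}\,n$ if the tree decomposition has $N=O(n)$ nodes. More precisely, there are a program and a constant $c$ such that the program needs at most $T=c\cdot\max(2,\mathrm{tw}\cdot W)^{c\cdot \mathrm{tw}}\,(n+N)$ steps on a random access machine whose words hold the integers of absolute value at most $T$ and whose unit-cost operations are addition, subtraction, multiplication, division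 with remainder, comparison, and access to memory; the input is the list of the arcs $(u,v)$ with $w_{uv}\neq0$ and their weights, followed by the nodes of the tree, rooted and listed with parents first, each with its parent and its bag. Consequently, for valuations with $W$ bounded by a fixed polynomial in $n$, the same program runs in time $(n+N)^{O(\max(1,\mathrm{tw}))}$, which is $n^{O(\mathrm{tw})}$ for $n\ge 2$, $\mathrm{tw}\ge 1$ and $N$ polynomially bounded in $n$. -/

import Mathlib

/-! ## Additively separable hedonic games -/

/-- An additively separable hedonic game with integer valuations on the agent set `V`: `w u v` is
the valuation of `u` for `v`. The arcs of the underlying directed weighted graph are the pairs with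
`w u v ≠ 0` (arcs of weight `0` are regarded as absent, and there are no loops). -/
structure ASHG (V : Type) where
  w : V → V → ℤ
  w_self : ∀ u, w u u = 0

namespace ASHG

variable {V : Type}

/-- The undirected graph underlying the game. -/
def graph (G : ASHG V) : SimpleGraph V where
  Adj u v := G.w u v ≠ 0 ∨ G.w v u ≠ 0
  symm := ⟨fun _ _ h => h.symm⟩
  loopless := ⟨fun u h => by simp [G.w_self u] at h⟩

variable [Fintype V] [DecidableEq V]

/-- The utility of `u` under the partition `P`: the sum of `w u v` over the members `v` of the
coalition of `u`. (Non-neighbours and `u` itself contribute `0`.) -/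
def utility (G : ASHG V) (P : Finpartition (Finset.univ : Finset V)) (u : V) : ℤ :=
  ∑ v ∈ P.part u, G.w u v

/-- The egalitarian welfare of a partition: the minimum utility of an agent. -/
def minUtility [Nonempty V] (G : ASHG V) (P : Finpartition (Finset.univ : Finset V)) : ℤ :=
  Finset.univ.inf' Finset.univ_nonempty (G.utility P)

/-- `P` is a maximum egalitarian partition: it maximizes the minimum utility. -/
def IsMaxEgalitarian [Nonempty V] (G : ASHG V) (P : Finpartition (Finset.univ : Finset V)) :
    Prop :=
  ∀ Q : Finpartition (Finset.univ : Finset V), G.minUtility Q ≤ G.minUtility P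

/-- `W = max_u ∑_v |w u v|`. -/
def maxTotal (G : ASHG V) : ℕ :=
  Finset.univ.sup fun u => ∑ v, (G.w u v).natAbs

end ASHG

/-! ## Tree decompositions -/

/-- A tree decomposition of the graph `G`, with the nodes of the tree taken from `ι`. -/
structure TreeDecomposition {V : Type} [DecidableEq V] (G : SimpleGraph V) (ι : Type) where
  tree : SimpleGraph ι
  isTree : tree.IsTree
  bag : ι → Finset V
  vertex_mem : ∀ v, ∃ i, v ∈ bag i
  edge_mem : ∀ u v, G.Adj u v → ∃ i, u ∈ bag i ∧ v ∈ bag i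
  inter_subset : ∀ (i j k : ι) (p : tree.Walk i k), p.IsPath → j ∈ p.support →
    bag i ∩ bag k ⊆ bag j

/-- The width: the maximum size of a bag minus one. -/
def TreeDecomposition.width {V : Type} [DecidableEq V] {G : SimpleGraph V} {ι : Type} [Fintype ι]
    (D : TreeDecomposition G ι) : ℕ :=
  (Finset.univ.sup fun i => (D.bag i).card) - 1

/-! ## The machine model: structured programs for a word RAM

The machine has registers `0, 1, 2, …` and memory banks `0, 1, 2, …`, each bank an array of cells
addressed by natural numbers. A program is a finite term, so it names finitely many registers and
banks; cells are otherwise reached by computed addresses. Words hold the integers of absolute value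
at most `B`; a computation in which some value exceeds `B` has no run. Each evaluation of a node of
an expression, each assignment, each store and each test of a guard costs one step. -/

namespace RAM

/-- The arithmetic and comparison instructions. -/
inductive Op where
  | add | sub | mul | div | mod | lt | eq

/-- Comparisons return `1` or `0`; a quotient by `0` is `0` and a remainder modulo `0` is the
dividend. -/
def Op.apply : Op → ℤ → ℤ → ℤ
  | .add, a, b => a + b
  | .sub, a, b => a - b
  | .mul, a, b => a * b
  | .div, a, b => a / b
  | .mod, a, b => a % b
  | .lt, a, b => if a < b then 1 else 0
  | .eq, a, b => if a = b then 1 else 0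

/-- Expressions: integer literals, register contents, the contents of the cell of a fixed bank at
a computed address, and operations. -/
inductive Expr where
  | lit (z : ℤ)
  | reg (x : ℕ)
  | load (a : ℕ) (e : Expr)
  | bin (o : Op) (e₁ e₂ : Expr)

/-- The contents of the registers and of the memory banks. -/
structure State where
  reg : ℕ → ℤ
  mem : ℕ → ℕ → ℤ

/-- The value of an expression. -/
def Expr.eval (s : State) : Expr → ℤ
  | .lit z => z
  | .reg x => s.reg x
  | .load a e => s.mem a (e.eval s).toNat
  | .bin o e₁ e₂ => o.apply (e₁.eval s) (e₂.eval s)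

/-- The evaluation is legal: every value that occurs fits into a word, and every address is
nonnegative. -/
def Expr.Fits (B : ℕ) (s : State) : Expr → Prop
  | .lit z => |z| ≤ B
  | .reg x => |s.reg x| ≤ B
  | .load a e => e.Fits B s ∧ 0 ≤ e.eval s ∧ |(Expr.load a e).eval s| ≤ B
  | .bin o e₁ e₂ => e₁.Fits B s ∧ e₂.Fits B s ∧ |(Expr.bin o e₁ e₂).eval s| ≤ B

/-- The number of steps of an evaluation. -/
def Expr.cost : Expr → ℕ
  | .lit _ => 1
  | .reg _ => 1
  | .load _ e => e.cost + 1
  | .bin _ e₁ e₂ => e₁.cost + e₂.cost + 1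

/-- Programs. -/
inductive Prog where
  | skip
  | assign (x : ℕ) (e : Expr)
  | store (a : ℕ) (addr e : Expr)
  | seq (p q : Prog)
  | ite (g : Expr) (p q : Prog)
  | loop (g : Expr) (p : Prog)

/-- `s` after register `x` has received `z`. -/
def State.setReg (s : State) (x : ℕ) (z : ℤ) : State :=
  { s with reg := Function.update s.reg x z }

/-- `s` after cell `i` of bank `a` has received `z`. -/
def State.setMem (s : State) (a i : ℕ) (z : ℤ) : State :=
  { s with mem := Function.update s.mem a (Function.update (s.mem a) i z) }

/-- `Run B p s t s'`: on words of absolute value at most `B`, the program `p` started in state `s`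
halts after exactly `t` steps in state `s'`. Guards hold when their value is nonzero. -/
inductive Run (B : ℕ) : Prog → State → ℕ → State → Prop
  | skip (s : State) : Run B .skip s 1 s
  | assign {x : ℕ} {e : Expr} {s : State} (he : e.Fits B s) :
      Run B (.assign x e) s (e.cost + 1) (s.setReg x (e.eval s))
  | store {a : ℕ} {addr e : Expr} {s : State} (ha : addr.Fits B s) (h0 : 0 ≤ addr.eval s)
      (he : e.Fits B s) :
      Run B (.store a addr e) s (addr.cost + e.cost + 1)
        (s.setMem a (addr.eval s).toNat (e.eval s))
  | seq {p q : Prog} {s s' s'' : State} {t t' : ℕ} (hp : Run B p s t s') (hq : Run B q s' t' s'') :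
      Run B (.seq p q) s (t + t') s''
  | iteTrue {g : Expr} {p q : Prog} {s s' : State} {t : ℕ} (hg : g.Fits B s) (h : g.eval s ≠ 0)
      (hp : Run B p s t s') : Run B (.ite g p q) s (g.cost + 1 + t) s'
  | iteFalse {g : Expr} {p q : Prog} {s s' : State} {t : ℕ} (hg : g.Fits B s) (h : g.eval s = 0)
      (hq : Run B q s t s') : Run B (.ite g p q) s (g.cost + 1 + t) s'
  | loopTrue {g : Expr} {p : Prog} {s s' s'' : State} {t t' : ℕ} (hg : g.Fits B s)
      (h : g.eval s ≠ 0) (hp : Run B p s t s') (hl : Run B (.loop g p) s' t' s'') :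
      Run B (.loop g p) s (g.cost + 1 + t + t') s''
  | loopFalse {g : Expr} {p : Prog} {s : State} (hg : g.Fits B s) (h : g.eval s = 0) :
      Run B (.loop g p) s (g.cost + 1) s

/-- The initial state: the input list in bank `0`, everything else `0`. -/
def init (inp : List ℤ) : State where
  reg := fun _ => 0
  mem := fun a i => if a = 0 then inp.getD i 0 else 0

end RAM

/-! ## Max Egalitarian as a computational problem -/

/-- The list `inp` of integers encodes the game `G` together with the tree decomposition `D`:
first the numbers of agents, arcs and tree nodes; then, in any order, each arc `(u, v)` as the
triple `u, v, w u v`; then the tree nodes, in an order in which the parent of each node (for some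
choice of the root) precedes it, each as the position of its parent (the root: its own position
`0`), the size of its bag, and the members of its bag in any order. -/
def Encodes {n N : ℕ} (G : ASHG (Fin n)) (D : TreeDecomposition G.graph (Fin N))
    (inp : List ℤ) : Prop :=
  ∃ (arcs : List (Fin n × Fin n)) (node : Fin N ≃ Fin N) (parent : Fin N → Fin N)
    (bag : Fin N → List (Fin n)),
    arcs.Nodup ∧ (∀ u v, (u, v) ∈ arcs ↔ G.w u v ≠ 0) ∧
    (∀ k, k.val = 0 → parent k = k) ∧
    (∀ k, k.val ≠ 0 → parent k < k ∧ D.tree.Adj (node (parent k)) (node k)) ∧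
    (∀ k, (bag k).Nodup ∧ ∀ v, v ∈ bag k ↔ v ∈ D.bag (node k)) ∧
    inp = [(n : ℤ), (arcs.length : ℤ), (N : ℤ)]
      ++ arcs.flatMap (fun a => [(a.1.val : ℤ), (a.2.val : ℤ), G.w a.1 a.2])
      ++ (List.finRange N).flatMap (fun k =>
          ((parent k).val : ℤ) :: ((bag k).length : ℤ) :: (bag k).map (fun v => (v.val : ℤ)))

/-- Started on `inp`, the program `prog` halts within `T` steps, with words that hold the integers
of absolute value at most `T`, and leaves a maximum egalitarian partition of `G` in bank `1`: two
agents are in the same coalition iff the cells with their numbers hold the same label. -/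
def SolvesMaxEgalitarian {n : ℕ} [NeZero n] (prog : RAM.Prog) (G : ASHG (Fin n))
    (inp : List ℤ) (T : ℕ) : Prop :=
  ∃ (t : ℕ) (s : RAM.State) (P : Finpartition (Finset.univ : Finset (Fin n))),
    RAM.Run T prog (RAM.init inp) t s ∧ t ≤ T ∧ G.IsMaxEgalitarian P ∧
    ∀ u v : Fin n, s.mem 1 u.val = s.mem 1 v.val ↔ P.part u = P.part v

/-! The algorithm is a dynamic program over the rooted tree decomposition. It is run once for each
candidate value `b` of the minimum utility. Both its correctness and its cost are verified on the
machine itself.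

Few labels suffice. An agent's utility depends only on which of its neighbours share its coalition,
and neighbours share a bag. Any labelling of coalitions can be recoloured down the tree with `q`
colours, where `q` is the maximum size of a bag, so that each bag is split as before
(`exists_coloring_lt_q`). A colour class may unite several coalitions, but no utility changes
(`exists_util_eq`). With an arc present, `q` is the width plus one.

Utilities are made local. Each arc is charged to the first node whose bag contains both ends. That
is the only bag containing both ends such that one of them is missing from the bag of the parent
(`pos_eq_zero_or_iff`, `sum_charge`). The nodes are handled last to first, hence children before
parents. Each node adds its charges to the accumulated utilities of its agents and hands the results
to its parent. At the first node of an agent its whole utility has arrived (`acc_add_eq_total`), and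
there it is compared with `b`. Accumulated utilities stay between `-W` and `W` (`abs_acc_gain_le`),
so a colour and a utility fit into one digit in base `R = q * (2 * W + 1)`, and a local state is one
of `K = R ^ q` codes. Merging a child adds multiples of `q` to digits of the parent's code, which
preserves colours. The `Mergeable` condition excludes carries and borrows (`exists_merged_eq`). An
extra node `N` with empty bag above the root removes the special case of the root: success means
that `zeroCode` is attainable there at the end.

A colouring with all utilities at least `b` yields a successful run (`feas_of_util`). Conversely, a
consistent family of merges yields such a colouring, whose colours are read off at the first nodes
(`exists_coloring`). The program records for each attained code one pair of codes producing it and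
follows these choices down from the root. The thresholds run from `W` down to at worst `-W`, so the
first success is optimal.

One round costs on the order of `N * K ^ 2 * q ^ 2`, and there are at most `2 * W + 1` rounds. With
`X = max 2 (tw * W)` and `Y = X ^ tw` one has `q ≤ Y ^ 2`, `W ≤ Y` and `K ≤ Y ^ 10`, which gives `Y
^ 25` times `n + N`. Games without arcs are treated apart: every partition is optimal for them.

Programs are verified with weakest preconditions that track the time, with loop invariants
(`wp_loop`, `wp_forLoop`), and with `Frame` for what stays untouched. Registers 0 to 8 hold `N`,
`m`, `q`, `W`, `R`, `K`, `zeroCode`, `K * K` and `(N + 1) * K`. Register 9 holds the threshold, and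
the later ones are scratch. Bank 0 holds the input, 1 the labels, 2 the addresses of the nodes, 3
the partial sums for `W`, 4 the powers of `R`, 5 the positions, 6 the first nodes, 7 the charges, 8
the attainable codes, 9 the choices and 10 the codes recovered by the final trace. -/

namespace RAM

/-! ## Weakest preconditions -/

namespace Expr

instance : Add Expr := ⟨.bin .add⟩
instance : Sub Expr := ⟨.bin .sub⟩
instance : Mul Expr := ⟨.bin .mul⟩
instance : Div Expr := ⟨.bin .div⟩
instance : Mod Expr := ⟨.bin .mod⟩

/-- The comparison `a < b`. -/
def lt (a b : Expr) : Expr := .bin .lt a b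

/-- The comparison `a = b`. -/
def eq (a b : Expr) : Expr := .bin .eq a b

variable {B : ℕ} {s : State} {a b : Expr}

@[simp] theorem eval_lit (z : ℤ) : (lit z).eval s = z := rfl
@[simp] theorem eval_reg (x : ℕ) : (reg x).eval s = s.reg x := rfl
@[simp] theorem eval_load (k : ℕ) : (load k a).eval s = s.mem k (a.eval s).toNat := rfl
@[simp] theorem eval_add : (a + b).eval s = a.eval s + b.eval s := rfl
@[simp] theorem eval_sub : (a - b).eval s = a.eval s - b.eval s := rfl
@[simp] theorem eval_mul : (a * b).eval s = a.eval s * b.eval s := rfl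
@[simp] theorem eval_div : (a / b).eval s = a.eval s / b.eval s := rfl
@[simp] theorem eval_mod : (a % b).eval s = a.eval s % b.eval s := rfl
@[simp] theorem eval_lt : (lt a b).eval s = if a.eval s < b.eval s then 1 else 0 := rfl
@[simp] theorem eval_eq : (eq a b).eval s = if a.eval s = b.eval s then 1 else 0 := rfl

@[simp] theorem fits_lit (z : ℤ) : (lit z).Fits B s ↔ |z| ≤ B := Iff.rfl
@[simp] theorem fits_reg (x : ℕ) : (reg x).Fits B s ↔ |s.reg x| ≤ B := Iff.rfl
@[simp] theorem fits_load (k : ℕ) : (load k a).Fits B s ↔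
    a.Fits B s ∧ 0 ≤ a.eval s ∧ |s.mem k (a.eval s).toNat| ≤ B := Iff.rfl
@[simp] theorem fits_add : (a + b).Fits B s ↔ a.Fits B s ∧ b.Fits B s ∧ |a.eval s + b.eval s| ≤ B :=
  Iff.rfl
@[simp] theorem fits_sub : (a - b).Fits B s ↔ a.Fits B s ∧ b.Fits B s ∧ |a.eval s - b.eval s| ≤ B :=
  Iff.rfl
@[simp] theorem fits_mul : (a * b).Fits B s ↔ a.Fits B s ∧ b.Fits B s ∧ |a.eval s * b.eval s| ≤ B :=
  Iff.rfl
@[simp] theorem fits_div : (a / b).Fits B s ↔ a.Fits B s ∧ b.Fits B s ∧ |a.eval s / b.eval s| ≤ B :=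
  Iff.rfl
@[simp] theorem fits_mod : (a % b).Fits B s ↔ a.Fits B s ∧ b.Fits B s ∧ |a.eval s % b.eval s| ≤ B :=
  Iff.rfl
@[simp] theorem fits_lt : (lt a b).Fits B s ↔ a.Fits B s ∧ b.Fits B s ∧
    (a.eval s < b.eval s → 1 ≤ B) := by
  change _ ∧ _ ∧ |if a.eval s < b.eval s then (1 : ℤ) else 0| ≤ B ↔ _
  split_ifs with h <;> simp [h]
@[simp] theorem fits_eq : (eq a b).Fits B s ↔ a.Fits B s ∧ b.Fits B s ∧
    (a.eval s = b.eval s → 1 ≤ B) := by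
  change _ ∧ _ ∧ |if a.eval s = b.eval s then (1 : ℤ) else 0| ≤ B ↔ _
  split_ifs with h <;> simp [h]

@[simp] theorem cost_lit (z : ℤ) : (lit z).cost = 1 := rfl
@[simp] theorem cost_reg (x : ℕ) : (reg x).cost = 1 := rfl
@[simp] theorem cost_load (k : ℕ) : (load k a).cost = a.cost + 1 := rfl
@[simp] theorem cost_add : (a + b).cost = a.cost + b.cost + 1 := rfl
@[simp] theorem cost_sub : (a - b).cost = a.cost + b.cost + 1 := rfl
@[simp] theorem cost_mul : (a * b).cost = a.cost + b.cost + 1 := rfl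
@[simp] theorem cost_div : (a / b).cost = a.cost + b.cost + 1 := rfl
@[simp] theorem cost_mod : (a % b).cost = a.cost + b.cost + 1 := rfl
@[simp] theorem cost_lt : (lt a b).cost = a.cost + b.cost + 1 := rfl
@[simp] theorem cost_eq : (eq a b).cost = a.cost + b.cost + 1 := rfl

end Expr

@[simp] theorem State.reg_setReg (s : State) (x y : ℕ) (z : ℤ) :
    (s.setReg x z).reg y = if y = x then z else s.reg y := by
  simp [State.setReg, Function.update_apply]

@[simp] theorem State.mem_setReg (s : State) (x : ℕ) (z : ℤ) : (s.setReg x z).mem = s.mem := rfl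

@[simp] theorem State.reg_setMem (s : State) (a i : ℕ) (z : ℤ) : (s.setMem a i z).reg = s.reg := rfl

@[simp] theorem State.mem_setMem (s : State) (a b i : ℕ) (z : ℤ) :
    (s.setMem a i z).mem b = if b = a then Function.update (s.mem a) i z else s.mem b := by
  simp [State.setMem, Function.update_apply]

/-- The program `p`, started in `s` on words of absolute value at most `B`, halts, and its running
time and final state satisfy `Q`. -/
def wp (B : ℕ) (p : Prog) (s : State) (Q : ℕ → State → Prop) : Prop :=
  ∃ t s', Run B p s t s' ∧ Q t s'

section

variable {B : ℕ} {s : State} {Q Q' : ℕ → State → Prop} {p q : Prog}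

theorem wp_mono (h : wp B p s Q) (hQ : ∀ t s', Q t s' → Q' t s') : wp B p s Q' := by
  obtain ⟨t, s', hr, hq⟩ := h
  exact ⟨t, s', hr, hQ _ _ hq⟩

@[simp] theorem wp_skip : wp B .skip s Q ↔ Q 1 s := by
  constructor
  · rintro ⟨t, s', hr, hq⟩
    cases hr
    exact hq
  · exact fun h => ⟨_, _, .skip s, h⟩

@[simp] theorem wp_assign {x : ℕ} {e : Expr} :
    wp B (.assign x e) s Q ↔ e.Fits B s ∧ Q (e.cost + 1) (s.setReg x (e.eval s)) := by
  constructor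
  · rintro ⟨t, s', hr, hq⟩
    cases hr with | assign he => exact ⟨he, hq⟩
  · exact fun h => ⟨_, _, .assign h.1, h.2⟩

@[simp] theorem wp_store {a : ℕ} {d e : Expr} :
    wp B (.store a d e) s Q ↔ d.Fits B s ∧ 0 ≤ d.eval s ∧ e.Fits B s ∧
      Q (d.cost + e.cost + 1) (s.setMem a (d.eval s).toNat (e.eval s)) := by
  constructor
  · rintro ⟨t, s', hr, hq⟩
    cases hr with | store hd h0 he => exact ⟨hd, h0, he, hq⟩
  · exact fun h => ⟨_, _, .store h.1 h.2.1 h.2.2.1, h.2.2.2⟩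

@[simp] theorem wp_seq :
    wp B (.seq p q) s Q ↔ wp B p s fun t s' => wp B q s' fun t' s'' => Q (t + t') s'' := by
  constructor
  · rintro ⟨t, s', hr, hQ⟩
    cases hr with | seq hp hq => exact ⟨_, _, hp, _, _, hq, hQ⟩
  · rintro ⟨t, s', hp, t', s'', hq, hQ⟩
    exact ⟨_, _, .seq hp hq, hQ⟩

@[simp] theorem wp_ite {g : Expr} :
    wp B (.ite g p q) s Q ↔ g.Fits B s ∧
      (g.eval s ≠ 0 → wp B p s fun t => Q (g.cost + 1 + t)) ∧
      (g.eval s = 0 → wp B q s fun t => Q (g.cost + 1 + t)) := by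
  constructor
  · rintro ⟨t, s', hr, hQ⟩
    cases hr with
    | iteTrue hg h hp => exact ⟨hg, fun _ => ⟨_, _, hp, hQ⟩, fun h' => absurd h' h⟩
    | iteFalse hg h hq => exact ⟨hg, fun h' => absurd h h', fun _ => ⟨_, _, hq, hQ⟩⟩
  · rintro ⟨hg, h1, h2⟩
    by_cases h : g.eval s = 0
    · obtain ⟨t, s', hr, hQ⟩ := h2 h
      exact ⟨_, _, .iteFalse hg h hr, hQ⟩
    · obtain ⟨t, s', hr, hQ⟩ := h1 h
      exact ⟨_, _, .iteTrue hg h hr, hQ⟩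

/-- The rule for `while` loops that halt after at most `M` rounds of at most `tb` steps each. -/
theorem wp_loop {g : Expr} (I : ℕ → State → Prop) (M tb : ℕ) (h0 : I 0 s)
    (hfit : ∀ i s, I i s → g.Fits B s) (hend : ∀ s, I M s → g.eval s = 0)
    (step : ∀ i < M, ∀ s, I i s → g.eval s ≠ 0 → wp B p s fun t s' => t ≤ tb ∧ I (i + 1) s')
    (post : ∀ t i s', t ≤ M * (tb + g.cost + 1) + (g.cost + 1) → I i s' → g.eval s' = 0 → Q t s') :
    wp B (.loop g p) s Q := by
  -- Induction on the number `d` of rounds that are still allowed, from an arbitrary state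
  -- satisfying the invariant.
  have key : ∀ d i, i + d = M → ∀ s, I i s → wp B (.loop g p) s fun t s' =>
      t ≤ d * (tb + g.cost + 1) + (g.cost + 1) ∧ ∃ k, I k s' ∧ g.eval s' = 0 := by
    intro d
    induction d with
    | zero =>
      intro i hi s hs
      have hiM : i = M := by omega
      subst hiM
      exact ⟨_, _, .loopFalse (hfit _ _ hs) (hend _ hs), by omega, i, hs, hend _ hs⟩
    | succ d ih =>
      intro i hi s hs
      by_cases hg : g.eval s = 0
      · exact ⟨_, _, .loopFalse (hfit _ _ hs) hg, by nlinarith, i, hs, hg⟩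
      · obtain ⟨t, s', hr, ht, hs'⟩ := step i (by omega) s hs hg
        obtain ⟨t', s'', hr', ht', h⟩ := ih (i + 1) (by omega) s' hs'
        exact ⟨_, _, .loopTrue (hfit _ _ hs) hg hr hr', by nlinarith, h⟩
  obtain ⟨t, s', hr, ht, k, hk, hg⟩ := key M 0 (by omega) s h0
  exact ⟨t, s', hr, post t k s' ht hk hg⟩

/-- `for x = 0, …, y - 1 do p`, where the bound is in register `y`. -/
def Prog.forLoop (x y : ℕ) (p : Prog) : Prog :=
  .seq (.assign x (.lit 0)) (.loop (.lt (.reg x) (.reg y))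
    (.seq p (.assign x (.reg x + .lit 1))))

/-- The rule for `for` loops of `M` rounds of at most `tb` steps each. -/
theorem wp_forLoop {x y : ℕ} (I : ℕ → State → Prop) (M tb : ℕ) (hB : 1 ≤ B) (hM : M ≤ B)
    (h0 : I 0 (s.setReg x 0))
    (hI : ∀ i s, I i s → s.reg x = i ∧ s.reg y = M)
    (step : ∀ i < M, ∀ s, I i s → wp B p s fun t s' =>
      t ≤ tb ∧ s'.reg x = i ∧ I (i + 1) (s'.setReg x ((i : ℤ) + 1)))
    (post : ∀ t s', t ≤ M * (tb + 8) + 6 → I M s' → Q t s') :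
    wp B (Prog.forLoop x y p) s Q := by
  rw [Prog.forLoop, wp_seq, wp_assign]
  refine ⟨by simp [Expr.fits_lit], ?_⟩
  refine wp_loop (fun i s => i ≤ M ∧ I i s) M (tb + 4) ⟨Nat.zero_le _, h0⟩ ?_ ?_ ?_ ?_
  · rintro i s ⟨hi, hs⟩
    obtain ⟨hx, hy⟩ := hI i s hs
    rw [Expr.fits_lt]
    refine ⟨?_, ?_, fun _ => hB⟩
    · rw [Expr.fits_reg, hx, Nat.abs_cast]; exact_mod_cast hi.trans hM
    · rw [Expr.fits_reg, hy, Nat.abs_cast]; exact_mod_cast hM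
  · rintro s ⟨-, hs⟩
    obtain ⟨hx, hy⟩ := hI M s hs
    simp [Expr.eval_lt, Expr.eval_reg, hx, hy]
  · rintro i hi s ⟨-, hs⟩ -
    rw [wp_seq]
    refine wp_mono (step i hi s hs) ?_
    rintro t s' ⟨ht, hx, hs'⟩
    rw [wp_assign]
    refine ⟨⟨?_, ?_, ?_⟩, ?_, hi, ?_⟩
    · rw [Expr.fits_reg, hx, Nat.abs_cast]; exact_mod_cast (hi.trans_le hM).le
    · rw [Expr.fits_lit]; simpa using hB
    · change |s'.reg x + 1| ≤ (B : ℤ)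
      rw [hx]
      have : (i : ℤ) + 1 ≤ B := by exact_mod_cast hi.trans_le hM
      rw [abs_of_nonneg (by positivity)]
      exact this
    · simp only [Expr.cost_add, Expr.cost_reg, Expr.cost_lit]; omega
    · simpa only [Expr.eval_add, Expr.eval_reg, Expr.eval_lit, hx] using hs'
  · rintro t i s' ht ⟨hi, hs'⟩ hg
    obtain ⟨hx, hy⟩ := hI i s' hs'
    have hiM : i = M := by
      simp only [Expr.eval_lt, Expr.eval_reg, hx, hy] at hg
      by_contra hne
      rw [if_pos (by exact_mod_cast lt_of_le_of_ne hi hne)] at hg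
      exact one_ne_zero hg
    subst hiM
    refine post _ _ ?_ hs'
    simp only [Expr.cost_lt, Expr.cost_reg, Expr.cost_lit] at ht ⊢
    nlinarith

-- From here on a specification is meant to be taken apart by the rules above and not by unfolding.
attribute [irreducible] wp

/-- `s'` differs from `s` at most in the registers from `c` on and in the banks listed in `A`. -/
structure Frame (c : ℕ) (A : List ℕ) (s s' : State) : Prop where
  reg : ∀ x < c, s'.reg x = s.reg x
  mem : ∀ a, a ∉ A → s'.mem a = s.mem a

@[simp] theorem Frame.refl (c : ℕ) (A : List ℕ) (s : State) : Frame c A s s :=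
  ⟨fun _ _ => rfl, fun _ _ => rfl⟩

theorem Frame.trans {c : ℕ} {A : List ℕ} {s s' s'' : State} (h : Frame c A s s')
    (h' : Frame c A s' s'') : Frame c A s s'' :=
  ⟨fun x hx => (h'.reg x hx).trans (h.reg x hx), fun a ha => (h'.mem a ha).trans (h.mem a ha)⟩

theorem Frame.mono {c c' : ℕ} {A A' : List ℕ} {s s' : State} (h : Frame c' A' s s')
    (hc : c ≤ c') (hA : A' ⊆ A) : Frame c A s s' :=
  ⟨fun x hx => h.reg x (hx.trans_le hc), fun a ha => h.mem a fun h' => ha (hA h')⟩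

@[simp] theorem frame_setReg {c x : ℕ} {A : List ℕ} {s s' : State} {z : ℤ} (hx : c ≤ x) :
    Frame c A s (s'.setReg x z) ↔ Frame c A s s' := by
  have h : ∀ y < c, (s'.setReg x z).reg y = s'.reg y := fun y hy => by
    rw [State.reg_setReg, if_neg (by omega)]
  exact ⟨fun h' => ⟨fun y hy => (h y hy).symm.trans (h'.reg y hy), h'.mem⟩,
    fun h' => ⟨fun y hy => (h y hy).trans (h'.reg y hy), h'.mem⟩⟩

@[simp] theorem frame_setMem {c a i : ℕ} {A : List ℕ} {s s' : State} {z : ℤ} (ha : a ∈ A) :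
    Frame c A s (s'.setMem a i z) ↔ Frame c A s s' := by
  have h : ∀ b, b ∉ A → (s'.setMem a i z).mem b = s'.mem b := fun b hb => by
    rw [State.mem_setMem, if_neg (fun h' : b = a => hb (h' ▸ ha))]
  exact ⟨fun h' => ⟨h'.reg, fun b hb => (h b hb).symm.trans (h'.mem b hb)⟩,
    fun h' => ⟨h'.reg, fun b hb => (h b hb).trans (h'.mem b hb)⟩⟩

/-- The functions `f` and `g` agree on the arguments below `M`. -/
def EqUpto (M : ℕ) (f g : ℕ → ℤ) : Prop := ∀ i < M, f i = g i

@[simp] theorem eqUpto_zero (f g : ℕ → ℤ) : EqUpto 0 f g := fun _ h => absurd h (by omega)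

theorem EqUpto.update {M : ℕ} {f g : ℕ → ℤ} {z : ℤ} (h : EqUpto M f g) (hz : z = g M) :
    EqUpto (M + 1) (Function.update f M z) g := by
  intro i hi
  rw [Function.update_apply]
  split_ifs with hiM
  · rw [hz, hiM]
  · exact h i (by omega)

end

end RAM

open Finset

/-! ## Digits -/

/-- The `i`-th digit of `s` in base `R`. -/
def digit (R s i : ℕ) : ℕ := s / R ^ i % R

theorem sum_digit_mul_pow (R q s : ℕ) (hs : s < R ^ q) :
    ∑ i ∈ range q, digit R s i * R ^ i = s := by
  -- Without the bound on `s` the first `q` digits represent `s % R ^ q`; this form admits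
  -- induction.
  have key : ∀ q, ∑ i ∈ range q, digit R s i * R ^ i = s % R ^ q := by
    intro q
    induction q with
    | zero => simp [Nat.mod_one]
    | succ q ih => rw [sum_range_succ, ih, pow_succ, Nat.mod_mul, digit, mul_comm]
  rw [key, Nat.mod_eq_of_lt hs]

theorem sum_mul_pow_lt (R q : ℕ) (f : ℕ → ℕ) (hf : ∀ i < q, f i < R) :
    ∑ i ∈ range q, f i * R ^ i < R ^ q := by
  induction q with
  | zero => simp
  | succ q ih =>
    rw [sum_range_succ, pow_succ]
    have h1 := ih fun i hi => hf i (by omega)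
    have h2 := Nat.mul_le_mul_right (R ^ q) (Nat.succ_le_of_lt (hf q (by omega)))
    rw [Nat.succ_mul, mul_comm R] at h2
    omega

/-- The terms below `k` sum to less than `R ^ k` and vanish in the division; the terms above are
multiples of `R ^ (k + 1)` and vanish modulo `R`. -/
theorem digit_sum_mul_pow (R q : ℕ) (f : ℕ → ℕ) (hf : ∀ i < q, f i < R) (k : ℕ) (hk : k < q) :
    digit R (∑ i ∈ range q, f i * R ^ i) k = f k := by
  have hR : 0 < R := (Nat.zero_le _).trans_lt (hf k hk)
  induction q with
  | zero => omega
  | succ q ih =>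
    have hlt := sum_mul_pow_lt R q f fun i hi => hf i (by omega)
    rw [sum_range_succ, digit]
    rcases Nat.lt_succ_iff_lt_or_eq.mp hk with h | rfl
    · rw [← ih (fun i hi => hf i (by omega)) h, digit]
      obtain ⟨e, rfl⟩ := Nat.exists_eq_add_of_lt h
      have : f (k + e + 1) * R ^ (k + e + 1) = R ^ k * (R * (f (k + e + 1) * R ^ e)) := by ring
      rw [this, Nat.add_mul_div_left _ _ (pow_pos hR k), Nat.add_mul_mod_self_left]
    · rw [Nat.add_mul_div_right _ _ (pow_pos hR k), Nat.div_eq_of_lt hlt, zero_add,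
        Nat.mod_eq_of_lt (hf k hk)]

theorem digit_lt {R : ℕ} (hR : 0 < R) (s i : ℕ) : digit R s i < R := Nat.mod_lt _ hR

/-! ## Games with rooted tree decompositions -/

/-- A game on the agents `0, …, n - 1` with the arcs `(src a, dst a)`, `a < m`, and a rooted tree
decomposition with the nodes `0, …, N - 1`, where `par` gives the parents and the bag of `j`
consists of the agents `vtx j i`, `i < sz j`. -/
structure TreeGame where
  n : ℕ
  N : ℕ
  m : ℕ
  src : ℕ → ℕ
  dst : ℕ → ℕ
  w : ℕ → ℕ → ℤ
  par : ℕ → ℕ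
  sz : ℕ → ℕ
  vtx : ℕ → ℕ → ℕ
  src_lt : ∀ a < m, src a < n
  dst_lt : ∀ a < m, dst a < n
  w_ne_zero : ∀ u v, w u v ≠ 0 ↔ ∃ a < m, src a = u ∧ dst a = v
  arc_inj : ∀ a < m, ∀ a' < m, src a = src a' → dst a = dst a' → a = a'
  sz_eq_zero : ∀ j, N ≤ j → sz j = 0
  par_lt : ∀ j < N, 0 < j → par j < j
  vtx_lt : ∀ j < N, ∀ i < sz j, vtx j i < n
  vtx_inj : ∀ j < N, ∀ i < sz j, ∀ i' < sz j, vtx j i = vtx j i' → i = i'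
  exists_mem : ∀ u < n, ∃ j < N, ∃ i < sz j, vtx j i = u
  exists_mem_mem : ∀ u v, w u v ≠ 0 →
    ∃ j < N, (∃ i < sz j, vtx j i = u) ∧ ∃ i < sz j, vtx j i = v
  mem_par : ∀ u j k, k < j → j < N → (∃ i < sz k, vtx k i = u) → (∃ i < sz j, vtx j i = u) →
    ∃ i < sz (par j), vtx (par j) i = u

namespace TreeGame

variable (T : TreeGame)

/-- The agent `u` lies in the bag of `j`. -/
def Mem (u j : ℕ) : Prop := ∃ i < T.sz j, T.vtx j i = u

/-- The parent of `j`, where the root has the additional node `N` with empty bag as its parent. -/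
def up (j : ℕ) : ℕ := if j = 0 then T.N else T.par j

open Classical in
/-- One plus the position of the `i`-th agent of the bag of `j` in the bag of the parent of `j`,
or `0` if it does not occur there. -/
noncomputable def pos (j i : ℕ) : ℕ :=
  if h : T.Mem (T.vtx j i) (T.up j) then Nat.find h + 1 else 0

/-- The first node whose bag contains `u`. -/
noncomputable def top (u : ℕ) : ℕ := sInf {j | T.Mem u j}

variable {T} {j k i d u v : ℕ}

theorem Mem.lt (h : T.Mem u j) : j < T.N := by
  by_contra hj
  obtain ⟨i, hi, -⟩ := h
  rw [T.sz_eq_zero j (by omega)] at hi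
  omega

theorem up_lt_or_eq (hj : j < T.N) : T.up j < j ∨ T.up j = T.N := by
  rw [up]
  split_ifs with h
  · exact .inr rfl
  · exact .inl (T.par_lt j hj (by omega))

theorem up_ne (hj : j < T.N) : T.up j ≠ j := by
  rcases up_lt_or_eq hj with h | h <;> omega

theorem up_le (hj : j < T.N) : T.up j ≤ T.N := by
  rcases up_lt_or_eq hj with h | h <;> omega

theorem pos_eq_zero : T.pos j i = 0 ↔ ¬ T.Mem (T.vtx j i) (T.up j) := by
  rw [pos]
  split_ifs with h <;> simp [h]

theorem vtx_of_pos (h : T.pos j i = k + 1) :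
    k < T.sz (T.up j) ∧ T.vtx (T.up j) k = T.vtx j i := by
  classical
  rw [pos] at h
  split_ifs at h with hm
  have := Nat.find_spec hm
  rw [Nat.succ_injective h] at this
  exact this

theorem pos_eq_succ (hk : k < T.sz (T.up j)) (h : T.vtx (T.up j) k = T.vtx j i) :
    T.pos j i = k + 1 := by
  have hm : T.Mem (T.vtx j i) (T.up j) := ⟨k, hk, h⟩
  obtain ⟨k', hk'⟩ := Nat.exists_eq_succ_of_ne_zero fun h0 => pos_eq_zero.mp h0 hm
  obtain ⟨h1, h2⟩ := vtx_of_pos hk'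
  rw [hk', T.vtx_inj _ hm.lt _ h1 _ hk (h2.trans h.symm)]

theorem pos_inj {i' : ℕ} (hj : j < T.N) (hi : i < T.sz j) (hi' : i' < T.sz j)
    (h : T.pos j i = k + 1) (h' : T.pos j i' = k + 1) : i = i' :=
  T.vtx_inj j hj i hi i' hi' ((vtx_of_pos h).2.symm.trans (vtx_of_pos h').2)

theorem mem_top (h : T.Mem u j) : T.Mem u (T.top u) :=
  Nat.sInf_mem (s := {j | T.Mem u j}) ⟨j, h⟩

theorem top_le (h : T.Mem u j) : T.top u ≤ j := Nat.sInf_le h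

theorem top_lt (hu : u < T.n) : T.top u < T.N := by
  obtain ⟨j, -, h⟩ := T.exists_mem u hu
  exact (mem_top h).lt

/-- If the first node of the agent came before `j`, then `mem_par` would place the agent in the bag
of the parent. Conversely, the parent of a node other than the root precedes it, and the extra node
above the root has an empty bag. -/
theorem pos_eq_zero_iff (hi : i < T.sz j) : T.pos j i = 0 ↔ T.top (T.vtx j i) = j := by
  have hm : T.Mem (T.vtx j i) j := ⟨i, hi, rfl⟩
  rw [pos_eq_zero]
  constructor
  · intro h
    by_contra hne
    have hlt := lt_of_le_of_ne (top_le hm) hne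
    have := T.mem_par _ j _ hlt hm.lt (mem_top hm) hm
    rw [up, if_neg (by omega)] at h
    exact h this
  · intro h hm'
    have h1 := top_le hm'
    have h2 := hm'.lt
    rcases up_lt_or_eq hm.lt with h3 | h3 <;> omega

/-- Consider the least node containing both agents. If it came after both first nodes, `mem_par`
would put both agents into the bag of its parent, an even earlier node. -/
theorem mem_max_top (h : T.w u v ≠ 0) :
    T.Mem u (max (T.top u) (T.top v)) ∧ T.Mem v (max (T.top u) (T.top v)) := by
  classical
  have hex : ∃ j, T.Mem u j ∧ T.Mem v j := by
    obtain ⟨j, -, h⟩ := T.exists_mem_mem u v h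
    exact ⟨j, h⟩
  obtain ⟨hu, hv⟩ := Nat.find_spec hex
  have h1 := top_le hu
  have h2 := top_le hv
  rcases eq_or_lt_of_le (max_le h1 h2) with h3 | h3
  · rw [h3]; exact ⟨hu, hv⟩
  · rw [max_lt_iff] at h3
    exact absurd ⟨T.mem_par u _ _ h3.1 hu.lt (mem_top hu) hu,
      T.mem_par v _ _ h3.2 hv.lt (mem_top hv) hv⟩
      (Nat.find_min hex (T.par_lt _ hu.lt (by omega)))

/-- This turns the locally testable condition in `charge` into a description of one particular node,
so an arc cannot be charged twice. -/
theorem pos_eq_zero_or_iff {i' : ℕ} (hi : i < T.sz j) (hi' : i' < T.sz j) :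
    (T.pos j i = 0 ∨ T.pos j i' = 0) ↔
      max (T.top (T.vtx j i)) (T.top (T.vtx j i')) = j := by
  rw [pos_eq_zero_iff hi, pos_eq_zero_iff hi']
  have h1 : T.top (T.vtx j i) ≤ j := top_le ⟨i, hi, rfl⟩
  have h2 : T.top (T.vtx j i') ≤ j := top_le ⟨i', hi', rfl⟩
  omega

theorem w_eq_zero_of_le (hv : T.n ≤ v) : T.w u v = 0 := by
  by_contra h
  obtain ⟨a, ha, -, rfl⟩ := (T.w_ne_zero u v).mp h
  exact absurd (T.dst_lt a ha) (by omega)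

/-! ### Charging the arcs to the nodes -/

variable (T) in
/-- The weight that node `j` is charged for the arc from its `i`-th to its `i'`-th agent. -/
noncomputable def charge (ω : ℕ → ℕ → ℤ) (j i i' : ℕ) : ℤ :=
  if T.pos j i = 0 ∨ T.pos j i' = 0 then ω (T.vtx j i) (T.vtx j i') else 0

/-- Every arc is charged exactly once. -/
theorem sum_charge (ω : ℕ → ℕ → ℤ) (hω : ∀ u v, ω u v ≠ 0 → T.w u v ≠ 0) (g : ℕ → ℤ) (u : ℕ) :
    ∑ k ∈ range T.N, ∑ i ∈ range (T.sz k), (if T.vtx k i = u then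
      ∑ i' ∈ range (T.sz k), g (T.vtx k i') * T.charge ω k i i' else 0) =
    ∑ v ∈ range T.n, g v * ω u v := by
  -- For fixed `u` and `v` at most one triple contributes: the node is the later of the two first
  -- nodes, and the indices are the places of `u` and `v` in its bag.
  have h1 : ∀ v ∈ range T.n, g v * ω u v = ∑ k ∈ range T.N, ∑ i ∈ range (T.sz k),
      ∑ i' ∈ range (T.sz k), if T.vtx k i = u ∧ T.vtx k i' = v then
        g v * T.charge ω k i i' else 0 := by
    intro v _
    by_cases hw : ω u v = 0
    · rw [hw, mul_zero]
      symm
      refine sum_eq_zero fun k _ => sum_eq_zero fun i _ => sum_eq_zero fun i' _ => ?_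
      split_ifs with h
      · rw [charge, h.1, h.2, hw]; simp
      · rfl
    obtain ⟨hu, hv⟩ := mem_max_top (hω u v hw)
    have hlt := hu.lt
    set c := max (T.top u) (T.top v) with hc
    obtain ⟨a, ha, hau⟩ := hu
    obtain ⟨b, hb, hbv⟩ := hv
    rw [sum_eq_single_of_mem c (mem_range.mpr hlt), sum_eq_single_of_mem a (mem_range.mpr ha),
      sum_eq_single_of_mem b (mem_range.mpr hb), if_pos ⟨hau, hbv⟩, charge, if_pos, hau, hbv]
    · rw [pos_eq_zero_or_iff ha hb, hau, hbv]
    · intro i' hi' hne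
      refine if_neg fun h => hne ?_
      exact T.vtx_inj c hlt _ (mem_range.mp hi') _ hb (h.2.trans hbv.symm)
    · intro i hi hne
      refine sum_eq_zero fun i' _ => if_neg fun h => hne ?_
      exact T.vtx_inj c hlt _ (mem_range.mp hi) _ ha (h.1.trans hau.symm)
    · intro k _ hne
      refine sum_eq_zero fun i hi => sum_eq_zero fun i' hi' => ?_
      split_ifs with h
      · rw [charge, if_neg, mul_zero]
        rw [pos_eq_zero_or_iff (mem_range.mp hi) (mem_range.mp hi'), h.1, h.2]
        exact hne.symm
      · rfl
  rw [sum_congr rfl h1, sum_comm]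
  refine sum_congr rfl fun k hk => ?_
  rw [sum_comm]
  refine sum_congr rfl fun i _ => ?_
  rw [sum_comm]
  split_ifs with h
  · refine sum_congr rfl fun i' hi' => ?_
    rw [sum_eq_single_of_mem _
      (mem_range.mpr (T.vtx_lt k (mem_range.mp hk) i' (mem_range.mp hi'))), if_pos ⟨h, rfl⟩]
    exact fun v _ hv => if_neg fun h' => hv h'.2.symm
  · exact (sum_eq_zero fun i' _ => sum_eq_zero fun v _ => if_neg fun h' => h h'.1).symm

/-! ### Accumulating local amounts along the tree -/

variable (T) in
/-- Every node holds an amount for every agent of its bag. In step `d` the node `N - 1 - d` adds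
its local amounts `l` to its holdings and passes the sums on to its parent. -/
noncomputable def acc (l : ℕ → ℕ → ℤ) : ℕ → ℕ → ℕ → ℤ
  | 0, _, _ => 0
  | d + 1, k, i => acc l d k i + if k = T.up (T.N - 1 - d) then
      ∑ i' ∈ range (T.sz (T.N - 1 - d)), (if T.pos (T.N - 1 - d) i' = i + 1 then
        acc l d (T.N - 1 - d) i' + l (T.N - 1 - d) i' else 0) else 0

theorem sum_pos_eq {f : ℕ → ℤ} (hj : j < T.N) (hi : i < T.sz j) (h : T.pos j i = k + 1) :
    ∑ i' ∈ range (T.sz j), (if T.pos j i' = k + 1 then f i' else 0) = f i := by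
  rw [sum_eq_single_of_mem i (mem_range.mpr hi), if_pos h]
  intro i' hi' hne
  exact if_neg fun h' => hne (pos_inj hj (mem_range.mp hi') hi h' h)

theorem acc_of_sz_le (l : ℕ → ℕ → ℤ) (hi : T.sz k ≤ i) : T.acc l d k i = 0 := by
  induction d with
  | zero => rfl
  | succ d ih =>
    rw [acc, ih, zero_add]
    split_ifs with hk
    · refine sum_eq_zero fun i' _ => if_neg fun h => ?_
      have := (vtx_of_pos h).1
      rw [← hk] at this
      omega
    · rfl

/-- A conservation law: as long as the first node of `u` is untouched, handing an amount of `u` to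
the parent loses nothing, because `u` lies in the parent's bag as well. What the remaining nodes
hold for `u` is what the processed nodes have contributed. -/
theorem sum_acc (l : ℕ → ℕ → ℤ) (u : ℕ) : ∀ d, T.top u + d < T.N →
    ∑ k ∈ range (T.N - d), ∑ i ∈ range (T.sz k), (if T.vtx k i = u then T.acc l d k i else 0) =
    ∑ k ∈ Ico (T.N - d) T.N, ∑ i ∈ range (T.sz k), if T.vtx k i = u then l k i else 0 := by
  intro d
  induction d with
  | zero => intro _; simp [acc]
  | succ d ih =>
    intro hd
    have ih := ih (by omega)
    obtain ⟨j, hj⟩ : ∃ j, j = T.N - 1 - d := ⟨_, rfl⟩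
    have e1 : T.N - d = j + 1 := by omega
    have e2 : T.N - (d + 1) = j := by omega
    have hjN : j < T.N := by omega
    rw [e1, sum_range_succ] at ih
    rw [e2, sum_eq_sum_Ico_succ_bot hjN, ← ih]
    have hup : T.up j < j := by
      rw [up, if_neg (by omega)]
      exact T.par_lt j hjN (by omega)
    have hsplit : ∀ k ∈ range j, ∑ i ∈ range (T.sz k),
        (if T.vtx k i = u then T.acc l (d + 1) k i else 0) =
        ∑ i ∈ range (T.sz k), (if T.vtx k i = u then T.acc l d k i else 0) +
        if k = T.up j then ∑ i ∈ range (T.sz k), (if T.vtx k i = u then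
          ∑ i' ∈ range (T.sz j), (if T.pos j i' = i + 1 then T.acc l d j i' + l j i' else 0)
          else 0) else 0 := by
      intro k _
      split_ifs with hk
      · rw [← sum_add_distrib]
        refine sum_congr rfl fun i _ => ?_
        rw [acc, ← hj, if_pos hk]
        split_ifs <;> simp
      · rw [add_zero]
        refine sum_congr rfl fun i _ => ?_
        rw [acc, ← hj, if_neg hk, add_zero]
    rw [sum_congr rfl hsplit, sum_add_distrib, sum_ite_eq', if_pos (mem_range.mpr hup)]
    -- Since `j` comes after the first node of `u`, the place of `u` in the bag of `j` has exactly
    -- one counterpart in the bag of the parent.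
    have hmove : ∑ i ∈ range (T.sz (T.up j)), (if T.vtx (T.up j) i = u then
          ∑ i' ∈ range (T.sz j), (if T.pos j i' = i + 1 then T.acc l d j i' + l j i' else 0)
          else 0) =
        ∑ i ∈ range (T.sz j), (if T.vtx j i = u then T.acc l d j i + l j i else 0) := by
      have hcomm : ∀ i ∈ range (T.sz (T.up j)), (if T.vtx (T.up j) i = u then
          ∑ i' ∈ range (T.sz j), (if T.pos j i' = i + 1 then T.acc l d j i' + l j i' else 0)
          else 0) = ∑ i' ∈ range (T.sz j), (if T.vtx (T.up j) i = u then
            (if T.pos j i' = i + 1 then T.acc l d j i' + l j i' else 0) else 0) := by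
        intro i _
        split_ifs <;> simp
      rw [sum_congr rfl hcomm, sum_comm]
      refine sum_congr rfl fun i' hi' => ?_
      rw [mem_range] at hi'
      split_ifs with hu
      · have h0 : T.pos j i' ≠ 0 := by
          rw [Ne, pos_eq_zero_iff hi', hu]
          omega
        obtain ⟨k, hk⟩ := Nat.exists_eq_succ_of_ne_zero h0
        obtain ⟨h1, h2⟩ := vtx_of_pos hk
        rw [sum_eq_single_of_mem k (mem_range.mpr h1), if_pos (h2.trans hu), if_pos hk]
        intro i _ hne
        have hne' : T.pos j i' ≠ i + 1 := by omega
        rw [if_neg hne', ite_self]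
      · refine sum_eq_zero fun i _ => ?_
        split_ifs with h1 h2
        · exact absurd ((vtx_of_pos h2).2.symm.trans h1) hu
        · rfl
        · rfl
    have hlast : ∑ i ∈ range (T.sz j), (if T.vtx j i = u then T.acc l d j i + l j i else 0) =
        ∑ i ∈ range (T.sz j), (if T.vtx j i = u then T.acc l d j i else 0) +
        ∑ i ∈ range (T.sz j), (if T.vtx j i = u then l j i else 0) := by
      rw [← sum_add_distrib]
      refine sum_congr rfl fun i _ => ?_
      split_ifs <;> simp
    rw [hmove, hlast]
    ring

/-- At the first node of an agent all of its local amounts have been collected. -/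
theorem acc_add_eq_total (l : ℕ → ℕ → ℤ) (hi : i < T.sz j) (h : T.pos j i = 0) :
    T.acc l (T.N - 1 - j) j i + l j i = ∑ k ∈ range T.N, ∑ i' ∈ range (T.sz k),
      if T.vtx k i' = T.vtx j i then l k i' else 0 := by
  have hm : T.Mem (T.vtx j i) j := ⟨i, hi, rfl⟩
  have hj := hm.lt
  have htop := (pos_eq_zero_iff hi).mp h
  have h0 : ∀ f : ℕ → ℕ → ℤ, ∀ k ∈ range j, ∑ i' ∈ range (T.sz k),
      (if T.vtx k i' = T.vtx j i then f k i' else 0) = 0 := by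
    intro f k hk
    refine sum_eq_zero fun i' hi' => if_neg fun h' => ?_
    have : T.top (T.vtx j i) ≤ k := top_le ⟨i', mem_range.mp hi', h'⟩
    have := mem_range.mp hk
    omega
  have h1 : ∀ f : ℕ → ℕ → ℤ, ∑ i' ∈ range (T.sz j),
      (if T.vtx j i' = T.vtx j i then f j i' else 0) = f j i := by
    intro f
    rw [sum_eq_single_of_mem i (mem_range.mpr hi), if_pos rfl]
    exact fun i' hi' hne => if_neg fun h' => hne (T.vtx_inj j hj _ (mem_range.mp hi') _ hi h')
  have h2 := sum_acc (T := T) l (T.vtx j i) (T.N - 1 - j) (by omega)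
  have e1 : T.N - (T.N - 1 - j) = j + 1 := by omega
  rw [e1, sum_range_succ, sum_eq_zero (h0 _), h1, zero_add] at h2
  have h3 : ∑ k ∈ range T.N, ∑ i' ∈ range (T.sz k),
      (if T.vtx k i' = T.vtx j i then l k i' else 0) =
      ∑ k ∈ range (j + 1), ∑ i' ∈ range (T.sz k),
        (if T.vtx k i' = T.vtx j i then l k i' else 0) +
      ∑ k ∈ Ico (j + 1) T.N, ∑ i' ∈ range (T.sz k),
        (if T.vtx k i' = T.vtx j i then l k i' else 0) :=
    (sum_range_add_sum_Ico _ (by omega)).symm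
  rw [h3, sum_range_succ, sum_eq_zero (h0 _), h1, zero_add, h2]
  ring

theorem abs_acc_le {l l' : ℕ → ℕ → ℤ} (hl : ∀ j i, |l j i| ≤ l' j i) (d k i : ℕ) :
    |T.acc l d k i| ≤ T.acc l' d k i := by
  induction d generalizing k i with
  | zero => simp [acc]
  | succ d ih =>
    rw [acc, acc]
    refine (abs_add_le _ _).trans (add_le_add (ih k i) ?_)
    split_ifs
    · refine (abs_sum_le_sum_abs _ _).trans (sum_le_sum fun i' _ => ?_)
      split_ifs
      · exact (abs_add_le _ _).trans (add_le_add (ih _ _) (hl _ _))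
      · simp
    · simp

theorem acc_le_total {l : ℕ → ℕ → ℤ} (hl : ∀ j i, 0 ≤ l j i) (hk : k + d < T.N)
    (hi : i < T.sz k) : T.acc l d k i ≤ ∑ k' ∈ range T.N, ∑ i' ∈ range (T.sz k'),
      if T.vtx k' i' = T.vtx k i then l k' i' else 0 := by
  have h0 : ∀ d k i, 0 ≤ T.acc l d k i := fun d k i =>
    (abs_nonneg _).trans (abs_acc_le (fun j i => (abs_of_nonneg (hl j i)).le) d k i)
  have htop : T.top (T.vtx k i) ≤ k := top_le ⟨i, hi, rfl⟩
  have h1 := sum_acc (T := T) l (T.vtx k i) d (by omega)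
  calc T.acc l d k i = if T.vtx k i = T.vtx k i then T.acc l d k i else 0 := by simp
    _ ≤ ∑ i' ∈ range (T.sz k), if T.vtx k i' = T.vtx k i then T.acc l d k i' else 0 :=
      single_le_sum (f := fun i' => if T.vtx k i' = T.vtx k i then T.acc l d k i' else 0)
        (fun i' _ => by split_ifs <;> simp [h0]) (mem_range.mpr hi)
    _ ≤ ∑ k' ∈ range (T.N - d), ∑ i' ∈ range (T.sz k'),
          if T.vtx k' i' = T.vtx k i then T.acc l d k' i' else 0 :=
      single_le_sum (f := fun k' => ∑ i' ∈ range (T.sz k'),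
          if T.vtx k' i' = T.vtx k i then T.acc l d k' i' else 0)
        (fun k' _ => sum_nonneg fun i' _ => by split_ifs <;> simp [h0])
        (mem_range.mpr (by omega))
    _ = _ := h1
    _ ≤ _ := by
      refine sum_le_sum_of_subset_of_nonneg ?_ ?_
      · intro x hx
        rw [mem_Ico] at hx
        exact mem_range.mpr hx.2
      · exact fun k' _ _ => sum_nonneg fun i' _ => by split_ifs <;> simp [hl]

end TreeGame

namespace TreeGame

variable (T : TreeGame)

/-! ### The dynamic program -/

/-- The maximum size of a bag. -/
def q : ℕ := (range T.N).sup T.sz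

/-- The maximum total absolute valuation of an agent. -/
def W : ℕ := (range T.n).sup fun u => ∑ v ∈ range T.n, (T.w u v).natAbs

/-- The number of pairs of a colour and an accumulated utility. -/
def R : ℕ := T.q * (2 * T.W + 1)

/-- The number of codes of local states. Digit `i` of a code is `c + q * (a + W)` for the colour
`c` and the accumulated utility `a` of the `i`-th agent of the bag. -/
def K : ℕ := T.R ^ T.q

/-- The code in which all colours and all accumulated utilities are `0`. -/
def zeroCode : ℕ := ∑ i ∈ range T.q, T.q * T.W * T.R ^ i

/-- The colour of the `i`-th agent in the local state `s`. -/
def col (s i : ℕ) : ℕ := digit T.R s i % T.q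

/-- The utility of the `i`-th agent accumulated in the local state `s` of `j`, including the arcs
charged to `j`. -/
noncomputable def tot (j s i : ℕ) : ℤ :=
  (digit T.R s i / T.q : ℕ) - T.W +
    ∑ i' ∈ range (T.sz j), if T.col s i' = T.col s i then T.charge T.w j i i' else 0

/-- The local state `s` of `j` can be merged into the local state `r` of the parent, and all agents
that occur in no further bag have utility at least `b`. -/
def Mergeable (b : ℤ) (j r s : ℕ) : Prop :=
  ∀ i < T.sz j, if T.pos j i = 0 then b ≤ T.tot j s i else
    T.col r (T.pos j i - 1) = T.col s i ∧
      (digit T.R r (T.pos j i - 1) + T.q * T.tot j s i) / (T.R : ℤ) = 0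

/-- The code that results from merging the local state `s` of `j` into the local state `r` of the
parent. -/
noncomputable def merged (j r s : ℕ) : ℤ :=
  r + ∑ i ∈ range (T.sz j), if T.pos j i = 0 then 0 else
    T.q * T.tot j s i * T.R ^ (T.pos j i - 1)

/-- Merging `s` into `r` is possible and results in `r'`. -/
def Step (b : ℤ) (j r s r' : ℕ) : Prop :=
  r < T.K ∧ s < T.K ∧ T.Mergeable b j r s ∧ (r' : ℤ) = T.merged j r s

/-- The local state `s` of `k` is attainable after `d` steps. -/
def Feas (b : ℤ) : ℕ → ℕ → ℕ → Prop
  | 0, _, s => s < T.K ∧ ∀ i < T.q, digit T.R s i / T.q = T.W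
  | d + 1, k, s => if k = T.up (T.N - 1 - d) then
      ∃ r s', Feas b d k r ∧ Feas b d (T.N - 1 - d) s' ∧ T.Step b (T.N - 1 - d) r s' s
      else Feas b d k s

/-- The utility of the `i`-th agent of `j` from the arcs charged to `j`, under the colouring
`χ`. -/
noncomputable def gain (χ : ℕ → ℕ) (j i : ℕ) : ℤ :=
  ∑ i' ∈ range (T.sz j), if χ (T.vtx j i') = χ (T.vtx j i) then T.charge T.w j i i' else 0

/-- The utility of `u` if the coalitions are the colour classes of `χ`. -/
def util (χ : ℕ → ℕ) (u : ℕ) : ℤ := ∑ v ∈ range T.n, if χ v = χ u then T.w u v else 0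

variable {T} {j k i d u v : ℕ} {b : ℤ} {χ : ℕ → ℕ}

theorem sz_le_q (j : ℕ) : T.sz j ≤ T.q := by
  rcases lt_or_ge j T.N with h | h
  · exact le_sup (f := T.sz) (mem_range.mpr h)
  · rw [T.sz_eq_zero j h]; exact Nat.zero_le _

theorem sum_natAbs_le_W (u : ℕ) : ∑ v ∈ range T.n, (T.w u v).natAbs ≤ T.W := by
  rcases lt_or_ge u T.n with h | h
  · exact le_sup (f := fun u => ∑ v ∈ range T.n, (T.w u v).natAbs) (mem_range.mpr h)
  · rw [sum_eq_zero]
    · exact Nat.zero_le _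
    · intro v _
      by_contra hne
      obtain ⟨a, ha, rfl, -⟩ := (T.w_ne_zero u v).mp (by simpa using hne)
      exact absurd (T.src_lt a ha) (by omega)

theorem sum_abs_le_W (u : ℕ) : ∑ v ∈ range T.n, |T.w u v| ≤ T.W := by
  have := sum_natAbs_le_W (T := T) u
  calc ∑ v ∈ range T.n, |T.w u v| = ((∑ v ∈ range T.n, (T.w u v).natAbs : ℕ) : ℤ) := by
        push_cast; rfl
    _ ≤ T.W := by exact_mod_cast this

theorem abs_util_le (χ : ℕ → ℕ) (u : ℕ) : |T.util χ u| ≤ T.W := by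
  refine (abs_sum_le_sum_abs _ _).trans (le_trans (sum_le_sum fun v _ => ?_) (sum_abs_le_W u))
  split_ifs <;> simp

theorem abs_w_le (u v : ℕ) : |T.w u v| ≤ T.W := by
  rcases lt_or_ge v T.n with h | h
  · exact (single_le_sum (f := fun v => |T.w u v|) (fun _ _ => abs_nonneg _)
      (mem_range.mpr h)).trans (sum_abs_le_W u)
  · rw [w_eq_zero_of_le h]; simp

theorem sum_gain (χ : ℕ → ℕ) (u : ℕ) : ∑ k ∈ range T.N, ∑ i ∈ range (T.sz k),
    (if T.vtx k i = u then T.gain χ k i else 0) = T.util χ u := by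
  have h := sum_charge T.w (fun _ _ h => h) (fun v => if χ v = χ u then 1 else 0) u
  have h1 : T.util χ u = ∑ v ∈ range T.n, (if χ v = χ u then 1 else 0) * T.w u v :=
    sum_congr rfl fun v _ => by split_ifs <;> simp
  rw [h1, ← h]
  refine sum_congr rfl fun k _ => sum_congr rfl fun i _ => ?_
  split_ifs with hu
  · refine sum_congr rfl fun i' _ => ?_
    rw [hu]
    split_ifs <;> simp
  · rfl

/-- This is why `2 * W + 1` values suffice in a digit, even for intermediate sums: a holding is
dominated by the one that collects all absolute valuations of the agent, whatever the colours. Slots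
beyond the bag hold `0`. -/
theorem abs_acc_gain_le (χ : ℕ → ℕ) (hk : k + d < T.N ∨ T.sz k ≤ i) :
    |T.acc (T.gain χ) d k i| ≤ T.W := by
  rcases lt_or_ge i (T.sz k) with hi | hi
  · have hk := hk.resolve_right (by omega)
    have hl : ∀ j i, |T.gain χ j i| ≤ ∑ i' ∈ range (T.sz j),
        1 * T.charge (fun u v => |T.w u v|) j i i' := by
      intro j i
      refine (abs_sum_le_sum_abs _ _).trans (sum_le_sum fun i' _ => ?_)
      rw [charge, charge]
      split_ifs <;> simp
    refine (abs_acc_le hl d k i).trans ((acc_le_total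
      (fun j i => (abs_nonneg _).trans (hl j i)) hk hi).trans ?_)
    rw [sum_charge (fun u v => |T.w u v|) (fun u v h => by simpa using h) (fun _ => 1)]
    simpa using sum_abs_le_W _
  · rw [acc_of_sz_le _ hi]
    simp

/-- Grouping the agents of `j` by the digit of the parent that receives their amount turns the sum
in `merged` into a digit expansion. -/
theorem sum_pos_mul (j : ℕ) (f : ℕ → ℤ) (c : ℤ) :
    ∑ i ∈ range (T.sz j), (if T.pos j i = 0 then 0 else f i * c ^ (T.pos j i - 1)) =
    ∑ k ∈ range T.q, (∑ i ∈ range (T.sz j), if T.pos j i = k + 1 then f i else 0) * c ^ k := by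
  simp only [sum_mul]
  rw [sum_comm]
  refine sum_congr rfl fun i _ => ?_
  rcases Nat.eq_zero_or_eq_succ_pred (T.pos j i) with h | h
  · rw [if_pos h, sum_eq_zero]
    intro k _
    rw [if_neg (by omega), zero_mul]
  · obtain ⟨p, hp⟩ : ∃ p, p = (T.pos j i).pred := ⟨_, rfl⟩
    rw [← hp] at h
    have hlt := (vtx_of_pos h).1.trans_le (sz_le_q _)
    rw [h, if_neg (by omega), sum_eq_single_of_mem p (mem_range.mpr hlt)]
    · simp
    · intro k _ hne
      rw [if_neg (by omega), zero_mul]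

theorem col_lt (hq : 0 < T.q) (s i : ℕ) : T.col s i < T.q := Nat.mod_lt _ hq

theorem R_pos (hq : 0 < T.q) : 0 < T.R := Nat.mul_pos hq (by omega)

/-- Merging adds `q` times the passed utility to each digit. -/
theorem exists_merged_eq (hj : j < T.N) (hq : 0 < T.q) {r s : ℕ} (hr : r < T.K)
    (h : T.Mergeable b j r s) :
    ∃ r' < T.K, (r' : ℤ) = T.merged j r s ∧ ∀ k < T.q, (digit T.R r' k : ℤ) = digit T.R r k +
      T.q * ∑ i ∈ range (T.sz j), if T.pos j i = k + 1 then T.tot j s i else 0 := by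
  have hR := R_pos hq
  -- A quotient `0` by `R` says that the new digit lies in `[0, R)`, so no carry or borrow occurs.
  -- Digits that receive nothing stay as they are.
  have hf : ∀ k < T.q, ∃ f : ℕ, f < T.R ∧ (f : ℤ) = digit T.R r k +
      T.q * ∑ i ∈ range (T.sz j), if T.pos j i = k + 1 then T.tot j s i else 0 := by
    intro k _
    by_cases hex : ∃ i < T.sz j, T.pos j i = k + 1
    · obtain ⟨i, hi, hp⟩ := hex
      rw [sum_pos_eq hj hi hp]
      have h1 := h i hi
      rw [if_neg (by omega), hp, Nat.add_sub_cancel] at h1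
      have h2 := h1.2
      have hR' : (0 : ℤ) < T.R := by exact_mod_cast hR
      have h3 := Int.emod_nonneg (digit T.R r k + T.q * T.tot j s i) hR'.ne'
      have h4 := Int.emod_lt_of_pos (digit T.R r k + T.q * T.tot j s i) hR'
      have h5 := Int.emod_add_mul_ediv (digit T.R r k + T.q * T.tot j s i) T.R
      rw [h2, mul_zero, add_zero] at h5
      rw [h5] at h3 h4
      lift (digit T.R r k + T.q * T.tot j s i : ℤ) to ℕ using h3 with f hf
      exact ⟨f, by exact_mod_cast h4, rfl⟩
    · refine ⟨digit T.R r k, digit_lt hR _ _, ?_⟩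
      rw [sum_eq_zero, mul_zero, add_zero]
      exact fun i hi => if_neg fun h' => hex ⟨i, mem_range.mp hi, h'⟩
  choose! f hf1 hf2 using hf
  refine ⟨∑ k ∈ range T.q, f k * T.R ^ k, sum_mul_pow_lt _ _ _ hf1, ?_, ?_⟩
  · rw [merged, sum_pos_mul, ← sum_digit_mul_pow T.R T.q r hr]
    push_cast
    rw [← sum_add_distrib]
    refine sum_congr rfl fun k hk => ?_
    rw [hf2 k (mem_range.mp hk), mul_sum]
    simp only [mul_ite, mul_zero]
    ring
  · intro k hk
    rw [digit_sum_mul_pow _ _ _ hf1 k hk, hf2 k hk]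

theorem Step.lt {r s r' : ℕ} (hj : j < T.N) (hq : 0 < T.q) (h : T.Step b j r s r') :
    r' < T.K := by
  obtain ⟨h1, h2, h3, h4⟩ := h
  obtain ⟨r'', h5, h6, -⟩ := exists_merged_eq hj hq h1 h3
  have : r' = r'' := by exact_mod_cast h4.trans h6.symm
  omega

theorem Step.digit_eq {r s r' : ℕ} (hj : j < T.N) (hq : 0 < T.q) (h : T.Step b j r s r')
    (hk : k < T.q) : (digit T.R r' k : ℤ) = digit T.R r k +
      T.q * ∑ i ∈ range (T.sz j), if T.pos j i = k + 1 then T.tot j s i else 0 := by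
  obtain ⟨h1, h2, h3, h4⟩ := h
  obtain ⟨r'', h5, h6, h7⟩ := exists_merged_eq hj hq h1 h3
  have : r' = r'' := by exact_mod_cast h4.trans h6.symm
  rw [this]
  exact h7 k hk

/-- The colour is the digit modulo `q`, and merging changes digits by multiples of `q`. -/
theorem Step.col_eq {r s r' : ℕ} (hj : j < T.N) (hq : 0 < T.q) (h : T.Step b j r s r')
    (hk : k < T.q) : T.col r' k = T.col r k := by
  have h1 := h.digit_eq hj hq hk
  have : ((digit T.R r' k : ℤ)) % T.q = (digit T.R r k : ℤ) % T.q := by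
    rw [h1, Int.add_mul_emod_self_left]
  exact_mod_cast this

theorem Feas.lt (hq : 0 < T.q) {s : ℕ} (hd : d ≤ T.N) (h : T.Feas b d k s) : s < T.K := by
  induction d generalizing k s with
  | zero => exact h.1
  | succ d ih =>
    rw [Feas] at h
    split_ifs at h with hk
    · obtain ⟨r, s', -, -, h⟩ := h
      exact h.lt (by omega) hq
    · exact ih (by omega) h

theorem tot_eq (h : ∀ i < T.sz j, T.col d i = χ (T.vtx j i)) (hi : i < T.sz j) {a : ℤ}
    (ha : (digit T.R d i / T.q : ℕ) - (T.W : ℤ) = a) : T.tot j d i = a + T.gain χ j i := by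
  rw [tot, ha, gain]
  congr 1
  refine sum_congr rfl fun i' hi' => ?_
  rw [h i hi, h i' (mem_range.mp hi')]

theorem acc_gain_add_eq_util (χ : ℕ → ℕ) (hi : i < T.sz j) (h : T.pos j i = 0) :
    T.acc (T.gain χ) (T.N - 1 - j) j i + T.gain χ j i = T.util χ (T.vtx j i) := by
  rw [acc_add_eq_total _ hi h, sum_gain]

variable (T) in
/-- The code of the local state of `k` after `d` steps under the colouring `χ`. -/
noncomputable def code (χ : ℕ → ℕ) (d k : ℕ) : ℕ := ∑ i ∈ range T.q,
  ((if i < T.sz k then χ (T.vtx k i) else 0) +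
    T.q * (T.acc (T.gain χ) d k i + T.W).toNat) * T.R ^ i

section

variable (hχ : ∀ u < T.n, χ u < T.q)

include hχ in
theorem local_col_lt (hq : 0 < T.q) (k i : ℕ) :
    (if i < T.sz k then χ (T.vtx k i) else 0) < T.q := by
  split_ifs with hi
  · exact hχ _ (T.vtx_lt k (Mem.lt ⟨i, hi, rfl⟩) i hi)
  · exact hq

include hχ in
-- The condition on `k` says that `k` has not been merged away after `d` steps or is the extra node.
-- Then the shifted utility lies in `[0, 2 * W]`.
theorem local_digit_lt (hq : 0 < T.q) (hk : k + d < T.N ∨ k = T.N) (i : ℕ) :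
    (if i < T.sz k then χ (T.vtx k i) else 0) +
      T.q * (T.acc (T.gain χ) d k i + T.W).toNat < T.R := by
  have h1 := local_col_lt hχ hq k i
  have h2 : |T.acc (T.gain χ) d k i| ≤ T.W := by
    refine abs_acc_gain_le χ (hk.imp id fun h => ?_)
    rw [T.sz_eq_zero k h.ge]
    exact Nat.zero_le _
  have h3 : (T.acc (T.gain χ) d k i + T.W).toNat ≤ 2 * T.W := by
    have := abs_le.mp h2
    omega
  have h4 := Nat.mul_le_mul_left T.q h3
  rw [R, Nat.mul_add, mul_one]
  omega

include hχ in
theorem digit_code (hq : 0 < T.q) (hk : k + d < T.N ∨ k = T.N) (hi : i < T.q) :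
    digit T.R (T.code χ d k) i = (if i < T.sz k then χ (T.vtx k i) else 0) +
      T.q * (T.acc (T.gain χ) d k i + T.W).toNat :=
  digit_sum_mul_pow _ _ _ (fun i _ => local_digit_lt hχ hq hk i) i hi

include hχ in
theorem code_lt (hq : 0 < T.q) (hk : k + d < T.N ∨ k = T.N) : T.code χ d k < T.K :=
  sum_mul_pow_lt _ _ _ (fun i _ => local_digit_lt hχ hq hk i)

include hχ in
theorem col_code (hq : 0 < T.q) (hk : k + d < T.N ∨ k = T.N) (hi : i < T.sz k) :
    T.col (T.code χ d k) i = χ (T.vtx k i) := by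
  have h := local_col_lt hχ hq k i
  rw [if_pos hi] at h
  rw [col, digit_code hχ hq hk (hi.trans_le (sz_le_q _)), Nat.add_mul_mod_self_left, if_pos hi,
    Nat.mod_eq_of_lt h]

include hχ in
theorem digit_code_div (hq : 0 < T.q) (hk : k + d < T.N ∨ k = T.N) (hi : i < T.q) :
    digit T.R (T.code χ d k) i / T.q = (T.acc (T.gain χ) d k i + T.W).toNat := by
  rw [digit_code hχ hq hk hi, Nat.add_mul_div_left _ _ hq,
    Nat.div_eq_of_lt (local_col_lt hχ hq k i), zero_add]

theorem toNat_acc (hk : k + d < T.N ∨ k = T.N) (i : ℕ) :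
    ((T.acc (T.gain χ) d k i + T.W).toNat : ℤ) = T.acc (T.gain χ) d k i + T.W := by
  have h2 : |T.acc (T.gain χ) d k i| ≤ T.W := by
    refine abs_acc_gain_le χ (hk.imp id fun h => ?_)
    rw [T.sz_eq_zero k h.ge]
    exact Nat.zero_le _
  have := abs_le.mp h2
  omega

include hχ in
-- The codes that `χ` induces follow the recursion of `acc`. Colours of parent and child agree
-- because both are values of `χ` at the same agent. The threshold is tested where the accumulated
-- amount is the full utility.
theorem step_code (hq : 0 < T.q) (hb : ∀ u < T.n, b ≤ T.util χ u) (hd : d < T.N) :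
    T.Step b (T.N - 1 - d) (T.code χ d (T.up (T.N - 1 - d))) (T.code χ d (T.N - 1 - d))
      (T.code χ (d + 1) (T.up (T.N - 1 - d))) := by
  obtain ⟨j, hj⟩ : ∃ j, j = T.N - 1 - d := ⟨_, rfl⟩
  have hjN : j < T.N := by omega
  have hjd : d = T.N - 1 - j := by omega
  have hp : T.up j + d < T.N ∨ T.up j = T.N := by
    rcases up_lt_or_eq hjN with h | h
    · left; omega
    · exact .inr h
  have hp' : T.up j + (d + 1) < T.N ∨ T.up j = T.N := by
    rcases up_lt_or_eq hjN with h | h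
    · left; omega
    · exact .inr h
  have hj' : j + d < T.N ∨ j = T.N := by left; omega
  rw [← hj]
  have htot : ∀ i < T.sz j, T.tot j (T.code χ d j) i =
      T.acc (T.gain χ) d j i + T.gain χ j i := by
    intro i hi
    refine tot_eq (fun i hi => col_code hχ hq hj' hi) hi ?_
    rw [digit_code_div hχ hq hj' (hi.trans_le (sz_le_q _)), toNat_acc hj']
    ring
  have hacc : ∀ k, T.acc (T.gain χ) (d + 1) (T.up j) k = T.acc (T.gain χ) d (T.up j) k +
      ∑ i ∈ range (T.sz j), if T.pos j i = k + 1 then T.tot j (T.code χ d j) i else 0 := by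
    intro k
    rw [acc, ← hj, if_pos rfl]
    congr 1
    refine sum_congr rfl fun i hi => ?_
    rw [htot i (mem_range.mp hi)]
  refine ⟨code_lt hχ hq hp, code_lt hχ hq hj', ?_, ?_⟩
  · intro i hi
    split_ifs with h0
    · rw [htot i hi, hjd, acc_gain_add_eq_util χ hi h0]
      exact hb _ (T.vtx_lt j hjN i hi)
    · obtain ⟨k, hk⟩ := Nat.exists_eq_succ_of_ne_zero h0
      obtain ⟨hk1, hk2⟩ := vtx_of_pos hk
      have hkq := hk1.trans_le (sz_le_q _)
      rw [hk, Nat.succ_sub_one]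
      refine ⟨by rw [col_code hχ hq hp hk1, col_code hχ hq hj' hi, hk2], ?_⟩
      have h1 := hacc k
      rw [sum_pos_eq hjN hi hk] at h1
      have h2 := local_digit_lt (d := d + 1) hχ hq hp' k
      have h3 : ((digit T.R (T.code χ d (T.up j)) k : ℕ) : ℤ) +
          T.q * T.tot j (T.code χ d j) i = (((if k < T.sz (T.up j) then χ (T.vtx (T.up j) k)
            else 0) + T.q * (T.acc (T.gain χ) (d + 1) (T.up j) k + T.W).toNat : ℕ) : ℤ) := by
        rw [digit_code hχ hq hp hkq, Nat.cast_add, Nat.cast_add, Nat.cast_mul, Nat.cast_mul,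
          toNat_acc hp, toNat_acc hp', h1]
        ring
      rw [h3]
      exact_mod_cast Nat.div_eq_of_lt h2
  · rw [merged, sum_pos_mul, code, code, Nat.cast_sum, Nat.cast_sum, ← sum_add_distrib]
    refine sum_congr rfl fun k _ => ?_
    rw [Nat.cast_mul, Nat.cast_mul, Nat.cast_add, Nat.cast_add, Nat.cast_mul, Nat.cast_mul,
      toNat_acc hp, toNat_acc hp', hacc, Nat.cast_pow]
    have : ∑ i ∈ range (T.sz j), (if T.pos j i = k + 1 then
          T.q * T.tot j (T.code χ d j) i else 0) =
        T.q * ∑ i ∈ range (T.sz j), if T.pos j i = k + 1 then T.tot j (T.code χ d j) i else 0 := by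
      rw [mul_sum]
      simp only [mul_ite, mul_zero]
    rw [this]
    ring

include hχ in
theorem feas_code (hq : 0 < T.q) (hb : ∀ u < T.n, b ≤ T.util χ u) :
    ∀ d ≤ T.N, ∀ k, (k + d < T.N ∨ k = T.N) → T.Feas b d k (T.code χ d k) := by
  intro d
  induction d with
  | zero =>
    intro _ k hk
    refine ⟨code_lt hχ hq hk, fun i hi => ?_⟩
    rw [digit_code_div hχ hq hk hi]
    simp [acc]
  | succ d ih =>
    intro hd k hk
    have hj : T.N - 1 - d < T.N := by omega
    rw [Feas]
    split_ifs with hp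
    · subst hp
      refine ⟨_, _, ih (by omega) _ ?_, ih (by omega) _ (.inl (by omega)),
        step_code hχ hq hb hd⟩
      rcases up_lt_or_eq hj with h | h
      · left; omega
      · exact .inr h
    · have : T.code χ (d + 1) k = T.code χ d k := by
        rw [code, code]
        refine sum_congr rfl fun i _ => ?_
        rw [acc, if_neg hp, add_zero]
      rw [this]
      exact ih (by omega) k (hk.imp (by omega) id)

include hχ in
/-- If the colour classes of `χ` give all agents utility at least `b`, then the dynamic program
succeeds. -/
theorem feas_of_util (hq : 0 < T.q) (hb : ∀ u < T.n, b ≤ T.util χ u) :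
    T.Feas b T.N T.N T.zeroCode := by
  have h := feas_code hχ hq hb T.N le_rfl T.N (.inr rfl)
  have : T.code χ T.N T.N = T.zeroCode := by
    rw [code, zeroCode]
    refine sum_congr rfl fun i _ => ?_
    have h0 := T.sz_eq_zero T.N le_rfl
    rw [acc_of_sz_le _ (by rw [h0]; exact Nat.zero_le _), if_neg (by omega)]
    simp
  rwa [this] at h

end

/-- A family of local states that is consistent with the merging steps comes from a colouring whose
classes give all agents utility at least `b`. Here `c j k` is the state of `k` before `j` and the
preceding nodes are merged. -/
theorem exists_coloring (hq : 0 < T.q) (c : ℕ → ℕ → ℕ)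
    (hstep : ∀ j < T.N, T.Step b j (c (j + 1) (T.up j)) (c (j + 1) j) (c j (T.up j)))
    (hother : ∀ j < T.N, ∀ k < j, k ≠ T.up j → c (j + 1) k = c j k)
    (hinit : ∀ k < T.N, T.Feas b 0 k (c T.N k)) :
    ∃ χ : ℕ → ℕ, (∀ u < T.n, b ≤ T.util χ u) ∧
      ∀ j < T.N, ∀ i < T.sz j, T.col (c (j + 1) j) i = χ (T.vtx j i) := by
  classical
  -- An agent has position `0` at its first node only, so its colour can be read off there
  -- unambiguously.
  obtain ⟨χ, hχ⟩ : ∃ χ : ℕ → ℕ, ∀ j < T.N, ∀ i < T.sz j, T.pos j i = 0 →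
      T.col (c (j + 1) j) i = χ (T.vtx j i) := by
    have h : ∀ u, ∃ x, ∀ j < T.N, ∀ i < T.sz j, T.pos j i = 0 → T.vtx j i = u →
        T.col (c (j + 1) j) i = x := by
      intro u
      by_cases hu : ∃ j < T.N, ∃ i < T.sz j, T.pos j i = 0 ∧ T.vtx j i = u
      · obtain ⟨j, hj, i, hi, h0, rfl⟩ := hu
        refine ⟨T.col (c (j + 1) j) i, fun j' _ i' hi' h0' he => ?_⟩
        rw [pos_eq_zero_iff hi'] at h0'
        rw [pos_eq_zero_iff hi, ← he, h0'] at h0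
        subst h0
        rw [T.vtx_inj _ hj _ hi' _ hi he]
      · exact ⟨0, fun j hj i hi h0 he => (hu ⟨j, hj, i, hi, h0, he⟩).elim⟩
    choose χ hχ using h
    exact ⟨χ, fun j hj i hi h0 => hχ (T.vtx j i) j hj i hi h0 rfl⟩
  -- Agreement with `χ` spreads from the root: merging keeps the parent's colours, and `Mergeable`
  -- forces the child to agree with them on common agents.
  have hcol : ∀ j ≤ T.N, ∀ k < j, ∀ i < T.sz k, T.col (c j k) i = χ (T.vtx k i) := by
    intro j
    induction j with
    | zero => intro _ k hk; omega
    | succ j ih =>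
      intro hj k hk i hi
      have ih := ih (by omega)
      have hst := hstep j (by omega)
      have hup : ∀ i < T.sz (T.up j), T.col (c (j + 1) (T.up j)) i = χ (T.vtx (T.up j) i) := by
        intro i hi
        rw [← hst.col_eq (by omega) hq (hi.trans_le (sz_le_q _))]
        refine ih _ ?_ i hi
        have := Mem.lt (T := T) ⟨i, hi, rfl⟩
        rcases up_lt_or_eq (T := T) (j := j) (by omega) with h | h <;> omega
      rcases Nat.lt_succ_iff_lt_or_eq.mp hk with h | rfl
      · by_cases hp : k = T.up j
        · subst hp; exact hup i hi
        · rw [hother j (by omega) k h hp]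
          exact ih k h i hi
      · by_cases h0 : T.pos k i = 0
        · exact hχ k (by omega) i hi h0
        · obtain ⟨k', hk'⟩ := Nat.exists_eq_succ_of_ne_zero h0
          obtain ⟨h1, h2⟩ := vtx_of_pos hk'
          have h3 := hst.2.2.1 i hi
          rw [if_neg h0, hk', Nat.succ_sub_one] at h3
          rw [← h3.1, hup _ h1, h2]
  have hcol' : ∀ j < T.N, ∀ i < T.sz j, T.col (c (j + 1) j) i = χ (T.vtx j i) :=
    fun j hj i hi => hcol (j + 1) hj j (by omega) i hi
  have hacc : ∀ d ≤ T.N, ∀ k, k + d < T.N → ∀ i < T.sz k,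
      ((digit T.R (c (T.N - d) k) i / T.q : ℕ) : ℤ) - T.W = T.acc (T.gain χ) d k i := by
    intro d
    induction d with
    | zero =>
      intro _ k hk i hi
      rw [Nat.sub_zero, (hinit k hk).2 i (hi.trans_le (sz_le_q _))]
      simp [acc]
    | succ d ih =>
      intro hd k hk i hi
      have ih := ih (by omega)
      obtain ⟨j, hj⟩ : ∃ j, j = T.N - 1 - d := ⟨_, rfl⟩
      have hjN : j < T.N := by omega
      have e1 : T.N - d = j + 1 := by omega
      have e2 : T.N - (d + 1) = j := by omega
      rw [e1] at ih
      rw [e2, acc, ← hj]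
      by_cases hp : k = T.up j
      · have hst := hstep j hjN
        rw [if_pos hp]
        subst hp
        have h1 := hst.digit_eq hjN hq (hi.trans_le (sz_le_q _))
        have hsum : ∑ i' ∈ range (T.sz j), (if T.pos j i' = i + 1 then
              T.tot j (c (j + 1) j) i' else 0) = ∑ i' ∈ range (T.sz j),
            (if T.pos j i' = i + 1 then T.acc (T.gain χ) d j i' + T.gain χ j i' else 0) := by
          refine sum_congr rfl fun i' hi' => ?_
          rw [mem_range] at hi'
          rw [tot_eq (hcol' j hjN) hi' (ih j (by omega) i' hi')]
        -- Dividing a digit by `q` drops the colour and turns the added multiple of `q` into the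
        -- utility passed on.
        rw [← hsum, ← ih _ (by omega) i hi, Int.natCast_div, h1,
          Int.add_mul_ediv_left _ _ (by omega), Int.natCast_div]
        ring
      · rw [if_neg hp, add_zero, ← ih k (by omega) i hi, hother j hjN k (by omega) hp]
  refine ⟨χ, fun u hu => ?_, hcol'⟩
  obtain ⟨j', -, hm⟩ := T.exists_mem u hu
  obtain ⟨i, hi, hiu⟩ := mem_top (T := T) hm
  obtain ⟨j, hj⟩ : ∃ j, j = T.top u := ⟨_, rfl⟩
  rw [← hj] at hi hiu
  have hjN : j < T.N := Mem.lt ⟨i, hi, rfl⟩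
  have h0 : T.pos j i = 0 := by rw [pos_eq_zero_iff hi, hiu, hj]
  have h1 := (hstep j hjN).2.2.1 i hi
  have h2 := hacc (T.N - 1 - j) (by omega) j (by omega) i hi
  have e : T.N - (T.N - 1 - j) = j + 1 := by omega
  rw [e] at h2
  rwa [if_pos h0, tot_eq (hcol' j hjN) hi h2, acc_gain_add_eq_util χ hi h0, hiu] at h1

end TreeGame

/-! ### Layout of the input and required word size -/

namespace TreeGame

variable (T : TreeGame)

/-- The address at which the description of the node `j` starts. -/
def off (j : ℕ) : ℕ := 3 + 3 * T.m + ∑ k ∈ range j, (T.sz k + 2)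

/-- The list of cells `I` describes `T`. -/
structure IsInput (I : ℕ → ℤ) : Prop where
  arcs : I 1 = T.m
  nodes : I 2 = T.N
  src : ∀ a < T.m, I (3 + 3 * a) = T.src a
  dst : ∀ a < T.m, I (4 + 3 * a) = T.dst a
  wt : ∀ a < T.m, I (5 + 3 * a) = T.w (T.src a) (T.dst a)
  par : ∀ j < T.N, I (T.off j) = T.par j
  sz : ∀ j < T.N, I (T.off j + 1) = T.sz j
  vtx : ∀ j < T.N, ∀ i < T.sz j, I (T.off j + 2 + i) = T.vtx j i
  par_zero : T.par 0 = 0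

/-- Words of absolute value at most `B` suffice for the dynamic program. -/
structure Fits (B : ℕ) : Prop where
  off : T.off T.N ≤ B
  n : T.n ≤ B
  q : 1 ≤ T.q
  W : 1 ≤ T.W
  tab : (T.N + 1) * T.K ≤ B
  mat : T.N * T.q * T.q ≤ B
  sq : T.K * T.K + 1 ≤ B
  merge : T.K + T.q * (T.q * ((T.q + 1) * T.W) * T.K) ≤ B

variable {T}

theorem off_succ (j : ℕ) : T.off (j + 1) = T.off j + (T.sz j + 2) := by
  rw [off, off, sum_range_succ]; ring

theorem off_mono : Monotone T.off :=
  monotone_nat_of_le_succ fun j => by rw [off_succ]; omega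

theorem off_add_sz_lt {j : ℕ} (hj : j < T.N) : T.off j + T.sz j + 2 ≤ T.off T.N := by
  have := off_mono (T := T) (Nat.succ_le_of_lt hj)
  rw [Nat.succ_eq_add_one, off_succ] at this
  omega

theorem m_le_off (j : ℕ) : 3 + 3 * T.m + 2 * j ≤ T.off j := by
  rw [off]
  gcongr
  rw [sum_add_distrib]
  simp [mul_comm]

/-- The part of `W` that comes from the first `t` arcs and the agent `u`. -/
def absSum (T : TreeGame) (t u : ℕ) : ℕ :=
  ∑ a ∈ range t, if T.src a = u then (T.w (T.src a) (T.dst a)).natAbs else 0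

theorem absSum_m (u : ℕ) : T.absSum T.m u = ∑ v ∈ range T.n, (T.w u v).natAbs := by
  have h : ∀ v ∈ range T.n, (T.w u v).natAbs = ∑ a ∈ range T.m,
      if T.src a = u ∧ T.dst a = v then (T.w (T.src a) (T.dst a)).natAbs else 0 := by
    intro v _
    by_cases hw : T.w u v = 0
    · rw [hw, sum_eq_zero]
      · rfl
      · intro a _
        split_ifs with h
        · rw [h.1, h.2, hw]; rfl
        · rfl
    · obtain ⟨a, ha, rfl, rfl⟩ := (T.w_ne_zero u v).mp hw
      rw [sum_eq_single_of_mem a (mem_range.mpr ha), if_pos ⟨rfl, rfl⟩]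
      intro a' ha' hne
      exact if_neg fun h => hne (T.arc_inj a' (mem_range.mp ha') a ha h.1 h.2)
  rw [sum_congr rfl h, sum_comm, absSum]
  refine sum_congr rfl fun a ha => ?_
  rw [sum_eq_single_of_mem _ (mem_range.mpr (T.dst_lt a (mem_range.mp ha)))]
  · simp
  · intro v _ hne
    exact if_neg fun h => hne h.2.symm

theorem absSum_succ (t u : ℕ) : T.absSum (t + 1) u = T.absSum t u +
    if T.src t = u then (T.w (T.src t) (T.dst t)).natAbs else 0 := sum_range_succ _ _

theorem absSum_le_W {t : ℕ} (ht : t ≤ T.m) (u : ℕ) : T.absSum t u ≤ T.W := by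
  have h : T.absSum t u ≤ T.absSum T.m u := by
    refine sum_le_sum_of_subset fun a ha => ?_
    rw [mem_range] at ha ⊢
    omega
  exact h.trans ((absSum_m u).le.trans (sum_natAbs_le_W u))

theorem W_eq_sup_absSum : T.W = (range T.n).sup (T.absSum T.m) :=
  (sup_congr rfl fun u _ => absSum_m u).symm

/-- Sums only grow, and the new arc changes only that of its source, so a running maximum needs a
single comparison per arc. -/
theorem sup_absSum_succ {t : ℕ} (ht : t < T.m) : (range T.n).sup (T.absSum (t + 1)) =
    max ((range T.n).sup (T.absSum t)) (T.absSum (t + 1) (T.src t)) := by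
  have hs := mem_range.mpr (T.src_lt t ht)
  refine le_antisymm (Finset.sup_le fun u hu => ?_) (max_le (Finset.sup_le fun u hu => ?_) ?_)
  · rw [le_max_iff]
    by_cases h : T.src t = u
    · right; rw [h]
    · left
      rw [absSum_succ, if_neg h, add_zero]
      exact le_sup hu
  · refine le_trans ?_ (le_sup (f := T.absSum (t + 1)) hu)
    rw [absSum_succ]
    exact Nat.le_add_right _ _
  · exact le_sup (f := T.absSum (t + 1)) hs

theorem K_pos (hq : 0 < T.q) : 0 < T.K := pow_pos (R_pos hq) _

theorem pow_le_K (hq : 0 < T.q) {i : ℕ} (hi : i ≤ T.q) : T.R ^ i ≤ T.K :=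
  Nat.pow_le_pow_right (R_pos hq) hi

theorem R_le_K (hq : 0 < T.q) : T.R ≤ T.K := by
  simpa using pow_le_K (i := 1) hq hq

theorem q_mul_W_lt_R (hq : 0 < T.q) : T.q * T.W < T.R := by
  rw [R]
  exact Nat.mul_lt_mul_of_pos_left (by omega) hq

theorem zeroCode_lt (hq : 0 < T.q) : T.zeroCode < T.K :=
  sum_mul_pow_lt _ _ _ fun _ _ => q_mul_W_lt_R hq

namespace Fits

variable {B : ℕ} (hB : T.Fits B)

include hB

theorem K_le : T.K ≤ B := by
  have := hB.merge
  omega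

theorem N_lt : T.N + 1 ≤ B :=
  (Nat.le_mul_of_pos_right _ (K_pos hB.q)).trans hB.tab

theorem R_le : T.R ≤ B := (R_le_K hB.q).trans hB.K_le

theorem two_W_le : 2 * T.W + 1 ≤ B :=
  (Nat.le_mul_of_pos_left _ hB.q).trans hB.R_le

theorem q_le : T.q ≤ B := (Nat.le_mul_of_pos_right _ (by omega)).trans hB.R_le

theorem three_le : 3 + 3 * T.m + 2 * T.N ≤ B := (m_le_off _).trans hB.off

end Fits

end TreeGame

/-! ### Preprocessing: node addresses, `W`, and the powers of `R` -/

namespace RAM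

open RAM.Expr RAM.Prog

infixr:60 " ;; " => Prog.seq

/-- Find the addresses of the nodes and the maximum size of a bag. -/
def progNodes : Prog :=
  assign 2 (lit 0) ;; assign 10 (lit 3 + lit 3 * reg 1) ;;
  forLoop 11 0 (
    store 2 (reg 11) (reg 10) ;;
    assign 12 (load 0 (reg 10 + lit 1)) ;;
    ite (lt (reg 2) (reg 12)) (assign 2 (reg 12)) skip ;;
    assign 10 (reg 10 + (reg 12 + lit 2)))

open TreeGame


theorem wp_progNodes {T : TreeGame} {B : ℕ} (hB : T.Fits B) {s : State} (hI : T.IsInput (s.mem 0))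
    (h0 : s.reg 0 = T.N) (h1 : s.reg 1 = T.m) :
    wp B progNodes s fun t s' => t ≤ 40 * T.N + 20 ∧ Frame 2 [2] s s' ∧ s'.reg 2 = T.q ∧
      EqUpto T.N (s'.mem 2) (fun j => T.off j) := by
  have hoN := hB.off
  have hm := m_le_off (T := T) T.N
  simp only [progNodes, wp_seq, wp_assign]
  simp [h1, abs_le]
  refine ⟨by omega, ?_⟩
  refine wp_forLoop (fun i s' => Frame 2 [2] s s' ∧ s'.reg 11 = i ∧ s'.reg 10 = T.off i ∧
    s'.reg 2 = ((range i).sup T.sz : ℕ) ∧ EqUpto i (s'.mem 2) (fun j => T.off j)) T.N 30 (by omega) (by omega)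
    ?_ ?_ ?_ ?_
  · simp [off]
  · rintro i s' ⟨hF, hi, -⟩
    exact ⟨hi, by rw [hF.reg 0 (by omega), h0]⟩
  · rintro i hi s' ⟨hF, h11, h10, h2, hm2⟩
    have hoi := off_add_sz_lt hi
    have h02 := hF.mem 0 (by simp)
    have hsz := hI.sz i hi
    have hsup : (range (i + 1)).sup T.sz = max ((range i).sup T.sz) (T.sz i) := by
      rw [range_add_one, sup_insert, sup_comm]
    have hle : (range i).sup T.sz ≤ B := by
      refine Finset.sup_le fun j hj => ?_
      have := off_add_sz_lt ((mem_range.mp hj).trans hi)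
      omega
    have hupd := hm2.update (z := T.off i) rfl
    generalize (range i).sup T.sz = M at *
    simp [h11, h10, h2, h02, abs_le, hF, hsz, off_succ, hsup, hupd]
    omega
  · rintro t s' ht ⟨hF, -, -, h2, hm2⟩
    exact ⟨by omega, hF, h2, hm2⟩

/-- Find the maximum total absolute valuation of an agent. -/
def progArcs : Prog :=
  assign 3 (lit 0) ;;
  forLoop 10 1 (
    assign 11 (load 0 (lit 3 + lit 3 * reg 10)) ;;
    assign 12 (load 0 (lit 5 + lit 3 * reg 10)) ;;
    ite (lt (reg 12) (lit 0)) (assign 12 (lit 0 - reg 12)) skip ;;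
    assign 12 (load 3 (reg 11) + reg 12) ;;
    store 3 (reg 11) (reg 12) ;;
    ite (lt (reg 3) (reg 12)) (assign 3 (reg 12)) skip)

theorem wp_progArcs {T : TreeGame} {B : ℕ} (hB : T.Fits B) {s : State} (hI : T.IsInput (s.mem 0))
    (h1 : s.reg 1 = T.m) (h3 : s.mem 3 = fun _ => 0) :
    wp B progArcs s fun t s' => t ≤ 60 * T.m + 20 ∧ Frame 3 [3] s s' ∧ s'.reg 3 = T.W := by
  have hm := hB.three_le
  have hW := hB.two_W_le
  have hnB := hB.n
  simp only [progArcs, wp_seq, wp_assign]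
  simp
  refine wp_forLoop (fun i s' => i ≤ T.m ∧ Frame 3 [3] s s' ∧ s'.reg 10 = i ∧
    s'.reg 3 = ((range T.n).sup (T.absSum i) : ℕ) ∧ EqUpto T.n (s'.mem 3) (fun u => T.absSum i u))
    T.m 50 (by omega) (by omega) ?_ ?_ ?_ ?_
  · have : (range T.n).sup (T.absSum 0) = 0 := by
      rw [← Nat.le_zero]
      exact Finset.sup_le fun u _ => by simp [absSum]
    simp [absSum, h3, EqUpto, this]
  · rintro i s' ⟨-, hF, hi, -⟩
    exact ⟨hi, by rw [hF.reg 1 (by omega), h1]⟩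
  · rintro i hi s' ⟨-, hF, h10, h3, hm3⟩
    have h02 := hF.mem 0 (by simp)
    have hsrc := hI.src i hi
    have hwt := hI.wt i hi
    have hlt := T.src_lt i hi
    have hS := hm3 _ hlt
    have hup := sup_absSum_succ hi
    have hle : (range T.n).sup (T.absSum i) ≤ T.W :=
      Finset.sup_le fun u _ => absSum_le_W hi.le u
    have hle1 := absSum_le_W (T := T) hi.le (T.src i)
    have hle2 := absSum_le_W (T := T) hi (T.src i)
    have hx : (T.absSum (i + 1) (T.src i) : ℤ) = T.absSum i (T.src i) +
        |T.w (T.src i) (T.dst i)| := by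
      rw [absSum_succ, if_pos rfl]; simp
    have hupd : EqUpto T.n (Function.update (s'.mem 3) (T.src i) (T.absSum (i + 1) (T.src i)))
        (fun u => T.absSum (i + 1) u) := by
      intro u hu
      rw [Function.update_apply]
      split_ifs with h
      · rw [h]
      · simp only [hm3 u hu, absSum_succ, if_neg (Ne.symm h), add_zero]
    have hw := abs_w_le (T := T) (T.src i) (T.dst i)
    have e1 : (3 + 3 * (i : ℤ)).toNat = 3 + 3 * i := by omega
    have e2 : (5 + 3 * (i : ℤ)).toNat = 5 + 3 * i := by omega
    generalize T.w (T.src i) (T.dst i) = z at *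
    generalize (range T.n).sup (T.absSum i) = M at *
    rcases lt_or_ge z 0 with hz | hz
    · rw [abs_of_neg hz] at hx hw
      have hx' : (T.absSum i (T.src i) : ℤ) + -z = T.absSum (i + 1) (T.src i) := hx.symm
      simp [h10, h3, h02, abs_le, hF, hsrc, hwt, e1, e2, hS, hz, hx', hupd, hup]
      omega
    · rw [abs_of_nonneg hz] at hx hw
      simp [h10, h3, h02, abs_le, hF, hsrc, hwt, e1, e2, hS, hz, hz.not_gt, ← hx, hupd, hup]
      omega
  · rintro t s' ht ⟨-, hF, -, h3, -⟩
    exact ⟨by omega, hF, by rw [h3, W_eq_sup_absSum]⟩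

/-- Compute `R`, its powers, the code `zeroCode`, and the sizes of the tables. -/
def progPow : Prog :=
  assign 4 (reg 2 * (lit 2 * reg 3 + lit 1)) ;; assign 5 (lit 1) ;; assign 6 (lit 0) ;;
  forLoop 10 2 (
    store 4 (reg 10) (reg 5) ;;
    assign 6 (reg 6 + reg 2 * reg 3 * reg 5) ;;
    assign 5 (reg 5 * reg 4)) ;;
  assign 7 (reg 5 * reg 5) ;;
  assign 8 ((reg 0 + lit 1) * reg 5)

theorem wp_progPow {T : TreeGame} {B : ℕ} (hB : T.Fits B) {s : State}
    (h0 : s.reg 0 = T.N) (h2 : s.reg 2 = T.q) (h3 : s.reg 3 = T.W) :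
    wp B progPow s fun t s' => t ≤ 40 * T.q + 60 ∧ Frame 4 [4] s s' ∧ s'.reg 4 = T.R ∧
      s'.reg 5 = T.K ∧ s'.reg 6 = T.zeroCode ∧ s'.reg 7 = (T.K * T.K : ℕ) ∧
      s'.reg 8 = ((T.N + 1) * T.K : ℕ) ∧ EqUpto T.q (s'.mem 4) (fun i => T.R ^ i) := by
  have hq := hB.q
  have hW1 := hB.W
  have hqB := hB.q_le
  have hRB := hB.R_le
  have hKB := hB.K_le
  have hW := hB.two_W_le
  have hN := hB.N_lt
  have htab := hB.tab
  have hsq := hB.sq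
  have e4 : (T.q : ℤ) * (2 * T.W + 1) = T.R := by rw [R]; push_cast; ring
  simp only [progPow, wp_seq, wp_assign]
  simp [h2, h3, abs_le, e4]
  have e5 : (T.q : ℤ) * (2 * T.W + 1) ≤ B := by rw [e4]; exact_mod_cast hRB
  refine ⟨by omega, by omega, ?_⟩
  refine wp_forLoop (fun i s' => i ≤ T.q ∧ Frame 4 [4] s s' ∧ s'.reg 10 = i ∧ s'.reg 4 = T.R ∧
    s'.reg 5 = (T.R ^ i : ℕ) ∧ s'.reg 6 = (∑ k ∈ range i, T.q * T.W * T.R ^ k : ℕ) ∧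
    EqUpto i (s'.mem 4) (fun i => (T.R ^ i : ℕ))) T.q 30 (by omega) (by omega) ?_ ?_ ?_ ?_
  · simp
  · rintro i s' ⟨-, hF, hi, -⟩
    exact ⟨hi, by rw [hF.reg 2 (by omega), h2]⟩
  · rintro i hi s' ⟨-, hF, h10, h4, h5, h6, hm4⟩
    have h2' := (hF.reg 2 (by omega)).trans h2
    have h3' := (hF.reg 3 (by omega)).trans h3
    have hp1 := (pow_le_K hq hi.le).trans hKB
    have hp2 := (pow_le_K hq hi).trans hKB
    -- A partial sum of `zeroCode` is a number with `i + 1` digits, all equal to `q * W < R`, hence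
    -- less than `R ^ (i + 1)`.
    have hsum : ∑ k ∈ range (i + 1), T.q * T.W * T.R ^ k ≤ B :=
      (sum_mul_pow_lt T.R (i + 1) (fun _ => T.q * T.W) fun _ _ => q_mul_W_lt_R hq).le.trans hp2
    rw [sum_range_succ] at hsum
    have hqW := q_mul_W_lt_R hq
    have hupd := hm4.update (z := (T.R ^ i : ℕ)) rfl
    rw [pow_succ] at hp2
    simp only [wp_seq, wp_store, wp_assign, Expr.eval_reg, Expr.eval_mul, Expr.eval_add,
      Expr.fits_reg, Expr.fits_mul, Expr.fits_add, h10, h4, h5, h6, h2', h3',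
      State.reg_setReg, State.mem_setReg, State.reg_setMem, State.mem_setMem, Int.toNat_natCast,
      sum_range_succ, pow_succ]
    norm_num
    norm_cast
    simp only [hF, hupd, and_true]
    omega
  · rintro t s' ht ⟨-, hF, -, h4, h5, h6, hm4⟩
    have h0' := (hF.reg 0 (by omega)).trans h0
    change s'.reg 5 = (T.K : ℕ) at h5
    have e : |(T.N : ℤ) + 1| = T.N + 1 := abs_of_nonneg (by positivity)
    have htab' : ((T.N : ℤ) + 1) * T.K ≤ B := by exact_mod_cast htab
    have hsq' : (T.K : ℤ) * T.K ≤ B := by exact_mod_cast (Nat.le_succ _).trans hsq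
    have h6' : s'.reg 6 = T.zeroCode := h6
    have hm4' : EqUpto T.q (s'.mem 4) fun i => (T.R : ℤ) ^ i := by simpa using hm4
    simp [h0', h4, h5, hF, h6', hm4', e, htab', hsq', -Nat.cast_add]
    omega

end RAM

/-! ### Tables of positions and of first nodes -/

namespace TreeGame

variable {T : TreeGame}

theorem mul_add_eq_iff {q j i j' i' : ℕ} (hi : i < q) (hi' : i' < q) :
    j * q + i = j' * q + i' ↔ j = j' ∧ i = i' := by
  constructor
  · intro h
    have h1 := congrArg (· / q) h
    have h2 := congrArg (· % q) h
    simp only [mul_comm _ q, Nat.mul_add_div (by omega : q > 0), Nat.div_eq_of_lt hi,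
      Nat.div_eq_of_lt hi', Nat.mul_add_mod, Nat.mod_eq_of_lt hi, Nat.mod_eq_of_lt hi'] at h1 h2
    omega
  · rintro ⟨rfl, rfl⟩; rfl

/-- The table `f` contains the positions for the nodes before `j` and the first `i` agents of
`j`. -/
def PosUpto (T : TreeGame) (f : ℕ → ℤ) (j i : ℕ) : Prop :=
  ∀ j' i', i' < T.sz j' → (j' < j ∨ j' = j ∧ i' < i) → f (j' * T.q + i') = T.pos j' i'

/-- The table `f` contains the first nodes of the agents that are first met at a node before `j` or
among the first `i` agents of `j`. -/
def TopUpto (T : TreeGame) (f : ℕ → ℤ) (j i : ℕ) : Prop :=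
  ∀ j' i', i' < T.sz j' → (j' < j ∨ j' = j ∧ i' < i) → T.pos j' i' = 0 → f (T.vtx j' i') = j'

theorem PosUpto.update {f : ℕ → ℤ} {j i : ℕ} (hi : i < T.sz j) (h : T.PosUpto f j i) :
    T.PosUpto (Function.update f (j * T.q + i) (T.pos j i)) j (i + 1) := by
  intro j' i' hi' hlt
  rw [Function.update_apply]
  split_ifs with he
  · rw [mul_add_eq_iff (hi'.trans_le (sz_le_q _)) (hi.trans_le (sz_le_q _))] at he
    rw [he.1, he.2]
  · refine h j' i' hi' ?_
    rcases hlt with h1 | ⟨rfl, h1⟩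
    · exact .inl h1
    · right
      refine ⟨rfl, lt_of_le_of_ne (by omega) fun h2 => he (by rw [h2])⟩

theorem PosUpto.next {f : ℕ → ℤ} {j : ℕ} (h : T.PosUpto f j (T.sz j)) :
    T.PosUpto f (j + 1) 0 := by
  intro j' i' hi' hlt
  refine h j' i' hi' ?_
  rcases lt_or_eq_of_le (show j' ≤ j by omega) with h1 | rfl
  · exact .inl h1
  · exact .inr ⟨rfl, hi'⟩

theorem TopUpto.update {f : ℕ → ℤ} {j i : ℕ} (hi : i < T.sz j) (h : T.TopUpto f j i)
    (h0 : T.pos j i = 0) : T.TopUpto (Function.update f (T.vtx j i) j) j (i + 1) := by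
  intro j' i' hi' hlt h0'
  rw [Function.update_apply]
  rw [pos_eq_zero_iff hi'] at h0'
  split_ifs with he
  · rw [pos_eq_zero_iff hi, ← he, h0'] at h0
    rw [h0]
  · refine h j' i' hi' ?_ ((pos_eq_zero_iff hi').mpr h0')
    rcases hlt with h1 | ⟨rfl, h1⟩
    · exact .inl h1
    · right
      refine ⟨rfl, lt_of_le_of_ne (by omega) fun h2 => he (by rw [h2])⟩

theorem TopUpto.skip {f : ℕ → ℤ} {j i : ℕ} (h : T.TopUpto f j i)
    (h0 : T.pos j i ≠ 0) : T.TopUpto f j (i + 1) := by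
  intro j' i' hi' hlt h0'
  refine h j' i' hi' ?_ h0'
  rcases hlt with h1 | ⟨rfl, h1⟩
  · exact .inl h1
  · right
    refine ⟨rfl, lt_of_le_of_ne (by omega) fun h2 => h0 (by rwa [h2] at h0')⟩

theorem TopUpto.next {f : ℕ → ℤ} {j : ℕ} (h : T.TopUpto f j (T.sz j)) :
    T.TopUpto f (j + 1) 0 := by
  intro j' i' hi' hlt
  refine h j' i' hi' ?_
  rcases lt_or_eq_of_le (show j' ≤ j by omega) with h1 | rfl
  · exact .inl h1
  · exact .inr ⟨rfl, hi'⟩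

theorem TopUpto.eq_top {f : ℕ → ℤ} (h : T.TopUpto f T.N 0) {u : ℕ} (hu : u < T.n) :
    f u = T.top u := by
  obtain ⟨j, -, hm⟩ := T.exists_mem u hu
  obtain ⟨i, hi, hiu⟩ := mem_top (T := T) hm
  have h1 := h _ i hi (.inl (top_lt hu)) (by rw [pos_eq_zero_iff hi, hiu])
  rwa [hiu] at h1

theorem pos_le (j i : ℕ) : T.pos j i ≤ T.sz (T.up j) := by
  rcases Nat.eq_zero_or_eq_succ_pred (T.pos j i) with h | h
  · rw [h]; exact Nat.zero_le _
  · have := (vtx_of_pos h).1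
    omega

theorem Fits.mat_le {B : ℕ} (hB : T.Fits B) {j i : ℕ} (hj : j < T.N) (hi : i < T.q) :
    j * T.q + i < T.N * T.q ∧ T.N * T.q ≤ B := by
  refine ⟨?_, (Nat.le_mul_of_pos_right _ hB.q).trans hB.mat⟩
  have := Nat.mul_le_mul_right T.q (Nat.succ_le_of_lt hj)
  rw [Nat.succ_mul] at this
  omega

end TreeGame

/-! ### Programs for the positions in one bag -/

namespace RAM

open RAM.Expr RAM.Prog TreeGame

theorem toNat_mul_add (a b c : ℕ) : ((a : ℤ) * b + c).toNat = a * b + c := by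
  exact_mod_cast Int.toNat_natCast _

theorem toNat_add_two_add (a b : ℕ) : ((a : ℤ) + 2 + b).toNat = a + 2 + b := by
  omega

/-- Find the agent in register `16` in the bag of the parent. -/
def progFind : Prog :=
  assign 17 (lit 0) ;;
  forLoop 18 14 (
    ite (eq (load 0 (reg 13 + lit 2 + reg 18)) (reg 16)) (assign 17 (reg 18 + lit 1)) skip)

theorem wp_progFind {T : TreeGame} {B : ℕ} (hB : T.Fits B) {s : State} {j i : ℕ}
    (hI : T.IsInput (s.mem 0)) (hj : j < T.N) (hi : i < T.sz j)
    (h13 : s.reg 13 = T.off (T.par j)) (h14 : s.reg 14 = T.sz (T.up j))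
    (h16 : s.reg 16 = T.vtx j i) :
    wp B progFind s fun t s' => t ≤ 30 * T.q + 20 ∧ Frame 17 [] s s' ∧
      s'.reg 17 = T.pos j i := by
  have hB1 := hB.three_le
  have hoN := hB.off
  have hqB := hB.q_le
  have hszq := sz_le_q (T := T) (T.up j)
  simp only [progFind, wp_seq, wp_assign]
  simp
  -- Position `p` stands for index `p - 1`, so after `i'` rounds the agent has been found exactly if
  -- `0 < p ≤ i'`. For `p = 0` both branches give `0`.
  refine wp_forLoop (fun i' s' => i' ≤ T.sz (T.up j) ∧ Frame 17 [] s s' ∧ s'.reg 18 = i' ∧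
    s'.reg 17 = (if T.pos j i ≤ i' then T.pos j i else 0 : ℕ))
    (T.sz (T.up j)) 20 (by omega) (by omega) ?_ ?_ ?_ ?_
  · simp only [State.reg_setReg, frame_setReg (show 17 ≤ 17 by omega),
      frame_setReg (show 17 ≤ 18 by omega)]
    simp
    intro h
    rw [h]
    rfl
  · rintro i s' ⟨-, hF, hi, -⟩
    exact ⟨hi, by rw [hF.reg 14 (by omega), h14]⟩
  · rintro i' hi' s' ⟨-, hF, h18, h17⟩
    have h02 := hF.mem 0 (by simp)
    have h13' := (hF.reg 13 (by omega)).trans h13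
    have h16' := (hF.reg 16 (by omega)).trans h16
    have hup : T.up j < T.N := Mem.lt ⟨i', hi', rfl⟩
    have hpar : T.up j = T.par j := by
      rw [up] at hup ⊢
      split_ifs with h
      · rw [if_pos h] at hup; omega
      · rfl
    have hv := hI.vtx _ hup i' hi'
    have hlt := T.vtx_lt _ hup i' hi'
    have hlt' := T.vtx_lt j hj i hi
    have hn := hB.n
    have ho := off_add_sz_lt hup
    rw [hpar] at hv hlt ho hi'
    have e := toNat_add_two_add (T.off (T.par j)) i'
    by_cases he : T.vtx (T.par j) i' = T.vtx j i
    · have hp := pos_eq_succ (T := T) (j := j) (i := i) (k := i') (by rw [hpar]; exact hi')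
        (by rw [hpar]; exact he)
      simp [h18, h02, h13', h16', abs_le, hF, e, hv, he, hp, hpar]
      omega
    · have hp : T.pos j i ≠ i' + 1 := fun hp => he (by rw [← (vtx_of_pos hp).2, hpar])
      have hp' : (if T.pos j i ≤ i' then T.pos j i else 0) =
          (if T.pos j i ≤ i' + 1 then T.pos j i else 0) := by
        split_ifs <;> omega
      rw [hp'] at h17
      simp [h18, h02, h13', h16', abs_le, hF, e, hv, he, hpar, -Nat.cast_ite, h17]
      omega
  · rintro t s' ht ⟨-, hF, -, h17⟩
    rw [if_pos (pos_le j i)] at h17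
    simp [hF, h17]
    omega

/-- Compute the positions of the agents of a bag in the bag of the parent. -/
def progPosRow : Prog :=
  forLoop 15 12 (
    assign 16 (load 0 (reg 11 + lit 2 + reg 15)) ;;
    progFind ;;
    store 5 (reg 10 * reg 2 + reg 15) (reg 17) ;;
    ite (reg 17) skip (store 6 (reg 16) (reg 10)))

theorem wp_progPosRow {T : TreeGame} {B : ℕ} (hB : T.Fits B) {s : State} {j : ℕ}
    (hI : T.IsInput (s.mem 0)) (hj : j < T.N) (h2 : s.reg 2 = T.q) (h10 : s.reg 10 = j)
    (h11 : s.reg 11 = T.off j) (h12 : s.reg 12 = T.sz j)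
    (h13 : s.reg 13 = T.off (T.par j)) (h14 : s.reg 14 = T.sz (T.up j))
    (h5 : T.PosUpto (s.mem 5) j 0) (h6 : T.TopUpto (s.mem 6) j 0) :
    wp B progPosRow s fun t s' => t ≤ T.q * (30 * T.q + 60) + 10 ∧ Frame 15 [5, 6] s s' ∧
      T.PosUpto (s'.mem 5) (j + 1) 0 ∧ T.TopUpto (s'.mem 6) (j + 1) 0 := by
  have hB1 := hB.three_le
  have hoN := hB.off
  have hqB := hB.q_le
  have hszq := sz_le_q (T := T) j
  refine wp_forLoop (fun i s' => i ≤ T.sz j ∧ Frame 15 [5, 6] s s' ∧ s'.reg 15 = i ∧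
    T.PosUpto (s'.mem 5) j i ∧ T.TopUpto (s'.mem 6) j i)
    (T.sz j) (30 * T.q + 50) (by omega) (by omega) ?_ ?_ ?_ ?_
  · simp [h5, h6]
  · rintro i s' ⟨-, hF, hi, -⟩
    exact ⟨hi, by rw [hF.reg 12 (by omega), h12]⟩
  · rintro i hi s' ⟨-, hF, h15, h5', h6'⟩
    have h02 := hF.mem 0 (by simp)
    have h10' := (hF.reg 10 (by omega)).trans h10
    have h11' := (hF.reg 11 (by omega)).trans h11
    have h13' := (hF.reg 13 (by omega)).trans h13
    have h14' := (hF.reg 14 (by omega)).trans h14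
    have h2' := (hF.reg 2 (by omega)).trans h2
    have hv := hI.vtx _ hj i hi
    have hlt := T.vtx_lt j hj i hi
    have hn := hB.n
    have ho := off_add_sz_lt hj
    have e := toNat_add_two_add (T.off j) i
    have hmat := hB.mat_le hj (hi.trans_le hszq)
    simp only [wp_seq, wp_assign]
    refine ⟨?_, ?_⟩
    · simp [h11', h15, e, abs_le, h02, hv]
      omega
    refine wp_mono (wp_progFind hB (j := j) (i := i) ?_ hj hi ?_ ?_ ?_) ?_
    · simpa [h02] using hI
    · simpa using h13'
    · simpa using h14'
    · simp [h11', h15, e, h02, hv]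
    rintro t s'' ⟨ht, hF', h17⟩
    have hm5 := hF'.mem 5 (by simp)
    have hm6 := hF'.mem 6 (by simp)
    have h2'' := hF'.reg 2 (by omega)
    have h10'' := hF'.reg 10 (by omega)
    have h15'' := hF'.reg 15 (by omega)
    have h16'' := hF'.reg 16 (by omega)
    simp [h2', h10', h15, h11', h02, e, hv] at hm5 hm6 h2'' h10'' h15'' h16''
    have hF'' : Frame 15 [5, 6] s s'' := hF.trans (((frame_setReg (by omega)).mpr
      (Frame.refl _ _ _)).trans (hF'.mono (by omega) (by simp)))
    have hpos : T.pos j i ≤ B := (pos_le j i).trans ((sz_le_q _).trans hqB)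
    have e2 := toNat_mul_add j T.q i
    have hu5 := h5'.update hi
    have e3 : (j : ℤ) * T.q ≤ B := by
      exact_mod_cast (Nat.le_add_right _ i).trans (hmat.1.le.trans hmat.2)
    have e4 : -(B : ℤ) ≤ j * T.q + i := by
      have : (0 : ℤ) ≤ j * T.q + i := by positivity
      omega
    have e5 : (j : ℤ) * T.q + i ≤ B := by exact_mod_cast hmat.1.le.trans hmat.2
    have e6 : (0 : ℤ) ≤ j * T.q + i := by positivity
    by_cases h0 : T.pos j i = 0
    · have hu6 := h6'.update hi h0
      rw [h0] at hu5 h17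
      rw [Nat.cast_zero] at hu5 h17
      simp [h17, h2'', h10'', h15'', h16'', hm5, hm6, hF'', e2, hu5, hu6, abs_le, e3, e4, e5, e6]
      omega
    · have hu6 := h6'.skip h0
      simp [h17, h0, h2'', h10'', h15'', hm5, hm6, hF'', e2, hu5, hu6, abs_le, e3, e4, e5, e6]
      omega
  · rintro t s' ht ⟨-, hF, -, h5', h6'⟩
    refine ⟨?_, hF, h5'.next, h6'.next⟩
    have := Nat.mul_le_mul_right (30 * T.q + 50 + 8) hszq
    nlinarith

end RAM

/-! ### The table of charges -/

namespace TreeGame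

variable {T : TreeGame}

open Classical in
/-- The table `f` contains the weights that the nodes are charged for the first `t` arcs. -/
def ChargeUpto (T : TreeGame) (f : ℕ → ℤ) (t : ℕ) : Prop :=
  ∀ j i i', i < T.sz j → i' < T.sz j → f ((j * T.q + i) * T.q + i') =
    if ∃ a < t, T.src a = T.vtx j i ∧ T.dst a = T.vtx j i' then T.charge T.w j i i' else 0

/-- A pair of agents that is not an arc has weight `0`, so the untouched cells are correct as well.
-/
theorem ChargeUpto.eq_charge {f : ℕ → ℤ} (h : T.ChargeUpto f T.m) {j i i' : ℕ} (hi : i < T.sz j)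
    (hi' : i' < T.sz j) : f ((j * T.q + i) * T.q + i') = T.charge T.w j i i' := by
  rw [h j i i' hi hi']
  split_ifs with hex
  · rfl
  · rw [← T.w_ne_zero, not_not] at hex
    rw [charge, hex, ite_self]

/-- One write per arc suffices: in any other bag containing both ends the arc has charge `0`, by
`pos_eq_zero_or_iff`. -/
theorem ChargeUpto.update {f : ℕ → ℤ} {t j i i' : ℕ} (h : T.ChargeUpto f t) (ht : t < T.m)
    (hi : i < T.sz j) (hi' : i' < T.sz j) (hs : T.vtx j i = T.src t) (hd : T.vtx j i' = T.dst t)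
    (hj : max (T.top (T.src t)) (T.top (T.dst t)) = j) :
    T.ChargeUpto (Function.update f ((j * T.q + i) * T.q + i') (T.w (T.src t) (T.dst t)))
      (t + 1) := by
  intro k a b ha hb
  have hjN : j < T.N := Mem.lt ⟨i, hi, rfl⟩
  have hkN : k < T.N := Mem.lt ⟨a, ha, rfl⟩
  rw [Function.update_apply]
  split_ifs with he hex hex
  · rw [mul_add_eq_iff (hb.trans_le (sz_le_q _)) (hi'.trans_le (sz_le_q _)),
      mul_add_eq_iff (ha.trans_le (sz_le_q _)) (hi.trans_le (sz_le_q _))] at he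
    obtain ⟨⟨rfl, rfl⟩, rfl⟩ := he
    rw [charge, if_pos, hs, hd]
    rw [pos_eq_zero_or_iff ha hb, hs, hd, hj]
  · rw [mul_add_eq_iff (hb.trans_le (sz_le_q _)) (hi'.trans_le (sz_le_q _)),
      mul_add_eq_iff (ha.trans_le (sz_le_q _)) (hi.trans_le (sz_le_q _))] at he
    obtain ⟨⟨rfl, rfl⟩, rfl⟩ := he
    exact absurd ⟨t, Nat.lt_succ_self t, hs.symm, hd.symm⟩ hex
  · rw [h k a b ha hb]
    split_ifs with hex'
    · rfl
    · obtain ⟨x, hx, hxs, hxd⟩ := hex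
      have hxt : x = t := by
        by_contra hne
        exact hex' ⟨x, by omega, hxs, hxd⟩
      subst hxt
      rw [charge, if_neg]
      rw [pos_eq_zero_or_iff ha hb, ← hxs, ← hxd, hj]
      rintro rfl
      rw [T.vtx_inj _ hjN _ hi _ ha (hs.trans hxs),
        T.vtx_inj _ hjN _ hi' _ hb (hd.trans hxd)] at he
      exact he rfl
  · rw [h k a b ha hb, if_neg]
    rintro ⟨x, hx, hxs⟩
    exact hex ⟨x, by omega, hxs⟩

end TreeGame

/-! ### Programs that fill the tables of positions and charges -/

namespace RAM

open RAM.Expr RAM.Prog TreeGame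

/-- Compute all positions in the bags of the parents, and the first nodes of all agents. -/
def progPos : Prog :=
  forLoop 10 0 (
    assign 11 (load 2 (reg 10)) ;;
    assign 12 (load 0 (reg 11 + lit 1)) ;;
    assign 13 (load 2 (load 0 (reg 11))) ;;
    assign 14 (load 0 (reg 13 + lit 1) * lt (lit 0) (reg 10)) ;;
    progPosRow)

theorem wp_progPos {T : TreeGame} {B : ℕ} (hB : T.Fits B) {s : State}
    (hI : T.IsInput (s.mem 0)) (h0 : s.reg 0 = T.N) (h2 : s.reg 2 = T.q)
    (hm2 : EqUpto T.N (s.mem 2) (fun j => T.off j)) :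
    wp B progPos s fun t s' => t ≤ T.N * (T.q * (30 * T.q + 60) + 60) + 10 ∧
      Frame 10 [5, 6] s s' ∧ T.PosUpto (s'.mem 5) T.N 0 ∧ T.TopUpto (s'.mem 6) T.N 0 := by
  have hB1 := hB.three_le
  have hoN := hB.off
  have hqB := hB.q_le
  refine wp_forLoop (fun j s' => j ≤ T.N ∧ Frame 10 [5, 6] s s' ∧ s'.reg 10 = j ∧
    T.PosUpto (s'.mem 5) j 0 ∧ T.TopUpto (s'.mem 6) j 0)
    T.N (T.q * (30 * T.q + 60) + 50) (by omega) (by omega) ?_ ?_ ?_ ?_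
  · refine ⟨Nat.zero_le _, by simp, by simp, ?_, ?_⟩ <;> · intro j i _ h; omega
  · rintro i s' ⟨-, hF, hi, -⟩
    exact ⟨hi, by rw [hF.reg 0 (by omega), h0]⟩
  · rintro j hj s' ⟨-, hF, h10, h5, h6⟩
    have h02 := hF.mem 0 (by simp)
    have hm2' := hF.mem 2 (by simp)
    have h2' := (hF.reg 2 (by omega)).trans h2
    have ho := off_add_sz_lt hj
    have hsz := hI.sz j hj
    have hpar := hI.par j hj
    have hpN : T.par j < T.N ∧ T.par j ≤ B := by
      rcases Nat.eq_zero_or_pos j with rfl | h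
      · rw [hI.par_zero]; exact ⟨hj, Nat.zero_le _⟩
      · have := T.par_lt j hj h
        omega
    have hop := off_add_sz_lt hpN.1
    have hszp := hI.sz _ hpN.1
    have hoj : s.mem 2 j = T.off j := hm2 j hj
    have hoj' : s.mem 2 (T.par j) = T.off (T.par j) := hm2 _ hpN.1
    have e1 : ((T.off j : ℤ) + 1).toNat = T.off j + 1 := by omega
    have e2 : ((T.off (T.par j) : ℤ) + 1).toNat = T.off (T.par j) + 1 := by omega
    simp only [wp_seq, wp_assign]
    refine ⟨?_, ?_, ?_, ?_, ?_⟩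
    · simp [h10, hm2', hoj]
      omega
    · simp [h10, abs_le, hm2', hoj, e1, h02, hsz]
      omega
    · simp [h10, hm2', hoj, h02, hpar, hoj']
      omega
    · simp [h10, abs_le, hm2', hoj, h02, hpar, hoj', hszp, e2]
      split_ifs <;> omega
    refine wp_mono (wp_progPosRow hB (j := j) ?_ hj ?_ ?_ ?_ ?_ ?_ ?_ ?_ ?_) ?_
    · simpa [h02] using hI
    · simpa using h2'
    · simpa using h10
    · simp [h10, hm2', hoj]
    · simp [h10, hm2', hoj, e1, h02, hsz]
    · simp [h10, hm2', hoj, h02, hpar, hoj']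
    · simp [h10, hm2', hoj, h02, hpar, hoj', hszp, e2]
      -- The stored parent of the root is the root itself, whereas `up 0` is the extra node with
      -- empty bag. The comparison factor in `progPos` makes the size `0` in that case.
      rw [up]
      rcases Nat.eq_zero_or_pos j with rfl | h
      · simp [T.sz_eq_zero T.N le_rfl]
      · simp [h, h.ne']
    · simpa using h5
    · simpa using h6
    rintro t s'' ⟨ht, hF', h5', h6'⟩
    have h10' := hF'.reg 10 (by omega)
    simp [h10] at h10'
    have hF'' : Frame 10 [5, 6] s s'' := by
      refine hF.trans (Frame.trans ?_ (hF'.mono (by omega) (by simp)))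
      simp
    simp [hF'', h10', h5', h6']
    omega
  · rintro t s' ht ⟨-, hF, -, h5', h6'⟩
    exact ⟨by linarith, hF, h5', h6'⟩

/-- Find the positions of the ends of an arc in a bag. -/
def progLocate : Prog :=
  forLoop 16 15 (
    assign 17 (load 0 (reg 14 + lit 2 + reg 16)) ;;
    ite (eq (reg 17) (reg 11)) (assign 18 (reg 16)) skip ;;
    ite (eq (reg 17) (reg 12)) (assign 19 (reg 16)) skip)

theorem wp_progLocate {T : TreeGame} {B : ℕ} (hB : T.Fits B) {s : State} {j a b : ℕ}
    (hI : T.IsInput (s.mem 0)) (ha : a < T.sz j) (hb : b < T.sz j)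
    (h11 : s.reg 11 = T.vtx j a) (h12 : s.reg 12 = T.vtx j b) (h14 : s.reg 14 = T.off j)
    (h15 : s.reg 15 = T.sz j) :
    wp B progLocate s fun t s' => t ≤ 40 * T.q + 10 ∧ Frame 16 [] s s' ∧
      s'.reg 18 = a ∧ s'.reg 19 = b := by
  have hj : j < T.N := Mem.lt ⟨a, ha, rfl⟩
  have hB1 := hB.three_le
  have hoN := hB.off
  have hqB := hB.q_le
  have hszq := sz_le_q (T := T) j
  refine wp_forLoop (fun i s' => i ≤ T.sz j ∧ Frame 16 [] s s' ∧ s'.reg 16 = i ∧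
    (a < i → s'.reg 18 = a) ∧ (b < i → s'.reg 19 = b))
    (T.sz j) 30 (by omega) (by omega) ?_ ?_ ?_ ?_
  · simp
  · rintro i s' ⟨-, hF, hi, -⟩
    exact ⟨hi, by rw [hF.reg 15 (by omega), h15]⟩
  · rintro i hi s' ⟨-, hF, h16, h18, h19⟩
    have h02 := hF.mem 0 (by simp)
    have h11' := (hF.reg 11 (by omega)).trans h11
    have h12' := (hF.reg 12 (by omega)).trans h12
    have h14' := (hF.reg 14 (by omega)).trans h14
    have hv := hI.vtx _ hj i hi
    have hlt := T.vtx_lt j hj i hi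
    have hlta := T.vtx_lt j hj a ha
    have hltb := T.vtx_lt j hj b hb
    have hn := hB.n
    have ho := off_add_sz_lt hj
    have e := toNat_add_two_add (T.off j) i
    have e1 : T.vtx j i = T.vtx j a ↔ i = a :=
      ⟨T.vtx_inj j hj i hi a ha, fun h => by rw [h]⟩
    have e2 : T.vtx j i = T.vtx j b ↔ i = b :=
      ⟨T.vtx_inj j hj i hi b hb, fun h => by rw [h]⟩
    have g1 : i ≠ a → a < i + 1 → s'.reg 18 = a := fun h1 h2 => h18 (by omega)
    have g2 : i ≠ b → b < i + 1 → s'.reg 19 = b := fun h1 h2 => h19 (by omega)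
    simp [h16, h02, h11', h12', h14', abs_le, hF, e, hv, e1, e2]
    refine ⟨by omega, by omega, ?_, ?_⟩
    · intro h
      exact ⟨by omega, by omega, fun h' => ⟨by omega, hi, fun _ => h, fun _ => h'⟩,
        fun h' => ⟨hi, fun _ => h, fun h1 => g2 h' (by omega)⟩⟩
    · intro h
      exact ⟨by omega, fun h' => ⟨by omega, hi, fun h1 => g1 h (by omega), fun _ => h'⟩,
        fun h' => ⟨hi, fun h1 => g1 h (by omega), fun h1 => g2 h' (by omega)⟩⟩
  · rintro t s' ht ⟨-, hF, -, h18, h19⟩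
    exact ⟨by omega, hF, h18 ha, h19 hb⟩

/-- Charge the arcs to the nodes. -/
def progCharge : Prog :=
  forLoop 10 1 (
    assign 11 (load 0 (lit 3 + lit 3 * reg 10)) ;;
    assign 12 (load 0 (lit 4 + lit 3 * reg 10)) ;;
    assign 13 (load 6 (reg 11)) ;;
    ite (lt (reg 13) (load 6 (reg 12))) (assign 13 (load 6 (reg 12))) skip ;;
    assign 14 (load 2 (reg 13)) ;;
    assign 15 (load 0 (reg 14 + lit 1)) ;;
    progLocate ;;
    store 7 ((reg 13 * reg 2 + reg 18) * reg 2 + reg 19) (load 0 (lit 5 + lit 3 * reg 10)))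

theorem wp_progCharge {T : TreeGame} {B : ℕ} (hB : T.Fits B) {s : State}
    (hI : T.IsInput (s.mem 0)) (h1 : s.reg 1 = T.m) (h2 : s.reg 2 = T.q)
    (hm2 : EqUpto T.N (s.mem 2) (fun j => T.off j)) (h6 : T.TopUpto (s.mem 6) T.N 0)
    (h7 : s.mem 7 = fun _ => 0) :
    wp B progCharge s fun t s' => t ≤ T.m * (40 * T.q + 90) + 10 ∧
      Frame 10 [7] s s' ∧ T.ChargeUpto (s'.mem 7) T.m := by
  have hB1 := hB.three_le
  have hoN := hB.off
  have hqB := hB.q_le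
  refine wp_forLoop (fun a s' => a ≤ T.m ∧ Frame 10 [7] s s' ∧ s'.reg 10 = a ∧
    T.ChargeUpto (s'.mem 7) a) T.m (40 * T.q + 80) (by omega) (by omega) ?_ ?_ ?_ ?_
  · refine ⟨Nat.zero_le _, by simp, by simp, ?_⟩
    intro j i i' _ _
    simp [h7]
  · rintro i s' ⟨-, hF, hi, -⟩
    exact ⟨hi, by rw [hF.reg 1 (by omega), h1]⟩
  · rintro a ha s' ⟨-, hF, h10, h7'⟩
    have h02 := hF.mem 0 (by simp)
    have hm2' := hF.mem 2 (by simp)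
    have hm6' := hF.mem 6 (by simp)
    have h2' := (hF.reg 2 (by omega)).trans h2
    have hsrc := hI.src a ha
    have hdst := hI.dst a ha
    have hwt := hI.wt a ha
    have hsn := T.src_lt a ha
    have hdn := T.dst_lt a ha
    have hn := hB.n
    have hts := h6.eq_top hsn
    have htd := h6.eq_top hdn
    have htsN := top_lt hsn
    have htdN := top_lt hdn
    have hw := abs_le.mp (abs_w_le (T := T) (T.src a) (T.dst a))
    have hWB := hB.two_W_le
    have hw0 : T.w (T.src a) (T.dst a) ≠ 0 := (T.w_ne_zero _ _).mpr ⟨a, ha, rfl, rfl⟩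
    -- The later of the two first nodes contains both ends, so `progLocate` finds them there.
    obtain ⟨⟨x, hx, hxs⟩, ⟨y, hy, hyd⟩⟩ := mem_max_top hw0
    obtain ⟨j, hj⟩ : ∃ j, j = max (T.top (T.src a)) (T.top (T.dst a)) := ⟨_, rfl⟩
    rw [← hj] at hx hxs hy hyd
    have hjN : j < T.N := Mem.lt ⟨x, hx, rfl⟩
    have ho := off_add_sz_lt hjN
    have hoj : s.mem 2 j = T.off j := hm2 j hjN
    have hsz := hI.sz j hjN
    have e1 : (3 + 3 * (a : ℤ)).toNat = 3 + 3 * a := by omega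
    have e2 : (4 + 3 * (a : ℤ)).toNat = 4 + 3 * a := by omega
    have e3 : (5 + 3 * (a : ℤ)).toNat = 5 + 3 * a := by omega
    have e4 : ((T.off j : ℤ) + 1).toNat = T.off j + 1 := by omega
    rw [wp_seq, wp_assign]
    refine ⟨?_, ?_⟩
    · simp [h10, abs_le, h02, e1, hsrc]
      omega
    rw [wp_seq, wp_assign]
    refine ⟨?_, ?_⟩
    · simp [h10, abs_le, h02, e2, hdst]
      omega
    rw [wp_seq, wp_assign]
    refine ⟨?_, ?_⟩
    · simp [h10, h02, e1, hsrc, hm6', hts]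
      omega
    rw [wp_seq]
    -- The conditional computes the maximum of the two first nodes. Stating this for arbitrary `Q`
    -- joins its two branches, so the rest is verified once.
    have hmid : ∀ Q : ℕ → State → Prop, ∀ s1 : State, s1.reg 13 = T.top (T.src a) →
        s1.reg 12 = T.dst a → s1.mem 6 = s.mem 6 →
        (∀ t s2, t ≤ 10 → Frame 13 [] s1 s2 → s2.reg 13 = j → Q t s2) →
        wp B (ite (lt (reg 13) (load 6 (reg 12))) (assign 13 (load 6 (reg 12))) skip) s1 Q := by
      intro Q s1 g13 g12 gm hQ
      simp [g13, g12, gm, htd]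
      refine ⟨by omega, fun h => ⟨by omega, hQ _ _ (by omega) (by simp) ?_⟩,
        fun h => hQ _ _ (by omega) (by simp) ?_⟩
      · simp; omega
      · rw [g13]; norm_cast; omega
    refine hmid _ _ ?_ ?_ ?_ ?_
    · simp [h10, h02, e1, hsrc, hm6', hts]
    · simp [h10, h02, e2, hdst]
    · simp [hm6']
    rintro t1 s1 ht1 hF1 g13
    have g10 := hF1.reg 10 (by omega)
    have g2 := hF1.reg 2 (by omega)
    have g11 := hF1.reg 11 (by omega)
    have g12 := hF1.reg 12 (by omega)
    have gm0 := hF1.mem 0 (by simp)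
    have gm2 := hF1.mem 2 (by simp)
    have gm7 := hF1.mem 7 (by simp)
    simp [h10, h2', h02, e1, e2, hsrc, hdst, hm2'] at g10 g2 g11 g12 gm0 gm2 gm7
    have hFF1 : Frame 10 [7] s s1 := by
      refine hF.trans (Frame.trans ?_ (hF1.mono (by omega) (by simp)))
      simp
    clear hF1 hmid
    rw [wp_seq, wp_assign]
    refine ⟨?_, ?_⟩
    · simp [g13, gm2, hoj]
      omega
    rw [wp_seq, wp_assign]
    refine ⟨?_, ?_⟩
    · simp [g13, gm2, hoj, gm0, e4, hsz, abs_le]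
      omega
    rw [wp_seq]
    refine wp_mono (wp_progLocate hB (j := j) (a := x) (b := y) ?_ hx hy ?_ ?_ ?_ ?_) ?_
    · simpa [gm0] using hI
    · simpa [hxs] using g11
    · simpa [hyd] using g12
    · simp [g13, gm2, hoj]
    · simp [g13, gm2, hoj, gm0, e4, hsz]
    rintro t2 s2 ⟨ht2, hF2, k18, k19⟩
    have k10 := hF2.reg 10 (by omega)
    have k2 := hF2.reg 2 (by omega)
    have k13 := hF2.reg 13 (by omega)
    have km0 := hF2.mem 0 (by simp)
    have km7 := hF2.mem 7 (by simp)
    simp [g10, g2, g13, gm0, gm7] at k10 k2 k13 km0 km7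
    have hFF2 : Frame 10 [7] s s2 := by
      refine hFF1.trans (Frame.trans ?_ (hF2.mono (by omega) (by simp)))
      simp
    have hupd := h7'.update ha hx hy hxs hyd hj.symm
    have hmat := hB.mat_le hjN (hx.trans_le (sz_le_q _))
    have hmat2 : (j * T.q + x) * T.q + y < T.N * T.q * T.q := by
      have h1 := Nat.mul_le_mul_right T.q (Nat.succ_le_of_lt hmat.1)
      rw [Nat.succ_mul] at h1
      have := hy.trans_le (sz_le_q _)
      omega
    have hmB := hB.mat
    have e5 : ((((j : ℤ) * T.q + x) * T.q + y)).toNat = (j * T.q + x) * T.q + y := by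
      exact_mod_cast Int.toNat_natCast _
    have f1 : |(j : ℤ) * T.q + x| ≤ B := by
      rw [abs_of_nonneg (by positivity)]
      exact_mod_cast hmat.1.le.trans hmat.2
    have f2 : |((j : ℤ) * T.q + x) * T.q| ≤ B := by
      rw [abs_of_nonneg (by positivity)]
      exact_mod_cast (Nat.le_add_right _ y).trans (hmat2.le.trans hmB)
    have f3 : |((j : ℤ) * T.q + x) * T.q + y| ≤ B := by
      rw [abs_of_nonneg (by positivity)]
      exact_mod_cast hmat2.le.trans hmB
    have f4 : |(j : ℤ) * T.q| ≤ B := by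
      rw [abs_of_nonneg (by positivity)]
      exact_mod_cast (Nat.le_add_right _ x).trans (hmat.1.le.trans hmat.2)
    have f5 : (0 : ℤ) ≤ ((j : ℤ) * T.q + x) * T.q + y := by positivity
    have f6 : |T.w (T.src a) (T.dst a)| ≤ B := (abs_w_le _ _).trans (by omega)
    have f7 : |(3 : ℤ) * a| ≤ B := by rw [abs_le]; omega
    have f8 : |(5 : ℤ) + 3 * a| ≤ B := by rw [abs_le]; omega
    have f9 : (0 : ℤ) ≤ 5 + 3 * (a : ℤ) := by omega
    have hszq := sz_le_q (T := T) j
    simp [k10, k2, k13, km0, k18, k19, e3, e5, hFF2, hwt, f1, f2, f3, f4, f5, f6, f7, f8, f9, km7,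
      hupd, -abs_mul]
    omega
  · rintro t s' ht ⟨-, hF, -, h7'⟩
    exact ⟨by linarith, hF, h7'⟩

end RAM

/-! ### The environment of the dynamic program and bounds for one local state -/

namespace TreeGame

/-- The state `s` contains the input and the tables that the dynamic program reads. -/
structure Env (T : TreeGame) (s : RAM.State) : Prop where
  inp : T.IsInput (s.mem 0)
  N : s.reg 0 = T.N
  q : s.reg 2 = T.q
  W : s.reg 3 = T.W
  R : s.reg 4 = T.R
  K : s.reg 5 = T.K
  zero : s.reg 6 = T.zeroCode
  sq : s.reg 7 = (T.K * T.K : ℕ)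
  tab : s.reg 8 = ((T.N + 1) * T.K : ℕ)
  off : RAM.EqUpto T.N (s.mem 2) fun j => T.off j
  pow : RAM.EqUpto T.q (s.mem 4) fun i => T.R ^ i
  pos : T.PosUpto (s.mem 5) T.N 0
  charge : T.ChargeUpto (s.mem 7) T.m

variable {T : TreeGame}

/-- After the preprocessing only the threshold, the scratch registers, the labels, the two tables
and the recovered codes change. -/
theorem Env.frame {s s' : RAM.State} (h : T.Env s) (hF : RAM.Frame 9 [1, 8, 9, 10] s s') :
    T.Env s' where
  inp := by rw [hF.mem 0 (by simp)]; exact h.inp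
  N := by rw [hF.reg 0 (by omega), h.N]
  q := by rw [hF.reg 2 (by omega), h.q]
  W := by rw [hF.reg 3 (by omega), h.W]
  R := by rw [hF.reg 4 (by omega), h.R]
  K := by rw [hF.reg 5 (by omega), h.K]
  zero := by rw [hF.reg 6 (by omega), h.zero]
  sq := by rw [hF.reg 7 (by omega), h.sq]
  tab := by rw [hF.reg 8 (by omega), h.tab]
  off := by rw [hF.mem 2 (by simp)]; exact h.off
  pow := by rw [hF.mem 4 (by simp)]; exact h.pow
  pos := by rw [hF.mem 5 (by simp)]; exact h.pos
  charge := by rw [hF.mem 7 (by simp)]; exact h.charge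

theorem Env.mono {s s' : RAM.State} {c : ℕ} {A : List ℕ} (h : T.Env s) (hF : RAM.Frame c A s s')
    (hc : 9 ≤ c) (hA : A ⊆ [1, 8, 9, 10]) : T.Env s' :=
  h.frame (hF.mono hc hA)

theorem abs_charge_le (j i i' : ℕ) : |T.charge T.w j i i'| ≤ T.W := by
  rw [charge]
  split_ifs
  · exact abs_w_le _ _
  · simp

/-- The sum defining `tot`, restricted to the first `l` agents of the bag. -/
noncomputable def partTot (T : TreeGame) (j s i l : ℕ) : ℤ :=
  (digit T.R s i / T.q : ℕ) - T.W +
    ∑ i' ∈ range l, if T.col s i' = T.col s i then T.charge T.w j i i' else 0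

theorem partTot_succ (j s i l : ℕ) : T.partTot j s i (l + 1) = T.partTot j s i l +
    if T.col s l = T.col s i then T.charge T.w j i l else 0 := by
  rw [partTot, partTot, sum_range_succ, add_assoc]

theorem digit_div_lt (hq : 0 < T.q) (s i : ℕ) : digit T.R s i / T.q < 2 * T.W + 1 :=
  Nat.div_lt_of_lt_mul (digit_lt (R_pos hq) s i)

/-- This holds for every code, attainable or not: the utility stored in a digit has absolute value
at most `W`, and so has each of the `l` charges. -/
theorem abs_partTot_le (hq : 0 < T.q) (j s i l : ℕ) : |T.partTot j s i l| ≤ T.W + l * T.W := by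
  rw [partTot]
  refine (abs_add_le _ _).trans (add_le_add ?_ ?_)
  · have := digit_div_lt hq s i
    have h0 : (0 : ℤ) ≤ (digit T.R s i / T.q : ℕ) := Int.natCast_nonneg _
    rw [abs_le]
    omega
  · refine (abs_sum_le_sum_abs _ _).trans ?_
    refine (sum_le_card_nsmul _ _ (T.W : ℤ) fun i' _ => ?_).trans (by simp)
    split_ifs
    · exact abs_charge_le _ _ _
    · simp

theorem abs_tot_le (hq : 0 < T.q) (j s i : ℕ) : |T.tot j s i| ≤ ((T.q + 1) * T.W : ℕ) := by
  refine (abs_partTot_le hq j s i (T.sz j)).trans ?_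
  have := Nat.mul_le_mul_right T.W (sz_le_q (T := T) j)
  push_cast
  have : (T.sz j : ℤ) * T.W ≤ T.q * T.W := by exact_mod_cast this
  linarith

theorem Fits.tot_le {B : ℕ} (hB : T.Fits B) :
    (T.q + 1) * T.W ≤ B ∧ T.q * ((T.q + 1) * T.W) + T.R ≤ B ∧
      T.q * ((T.q + 1) * T.W) * T.K ≤ B := by
  have h := hB.merge
  have hR := R_le_K hB.q
  have h1 := Nat.le_mul_of_pos_left ((T.q + 1) * T.W) hB.q
  have h2 := Nat.le_mul_of_pos_right (T.q * ((T.q + 1) * T.W)) (K_pos hB.q)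
  have h3 := Nat.le_mul_of_pos_left (T.q * ((T.q + 1) * T.W) * T.K) hB.q
  omega

end TreeGame

/-! ### Evaluating one agent in a local state -/

namespace RAM

open RAM.Expr RAM.Prog TreeGame

/-- Compute the digit and the accumulated utility of the agent in register `20`. -/
def progTot : Prog :=
  assign 21 ((reg 17 / load 4 (reg 20)) % reg 4) ;;
  assign 22 (reg 21 / reg 2 - reg 3) ;;
  forLoop 23 13 (
    ite (eq (((reg 17 / load 4 (reg 23)) % reg 4) % reg 2) (reg 21 % reg 2))
      (assign 22 (reg 22 + load 7 ((reg 11 * reg 2 + reg 20) * reg 2 + reg 23))) skip)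

theorem wp_progTot {T : TreeGame} {B : ℕ} (hB : T.Fits B) {s : State} (hE : T.Env s)
    {j i c : ℕ} (hj : j < T.N) (hi : i < T.sz j) (hc : c < T.K) (h11 : s.reg 11 = j)
    (h13 : s.reg 13 = T.sz j) (h17 : s.reg 17 = c) (h20 : s.reg 20 = i) :
    wp B progTot s fun t s' => t ≤ 50 * T.q + 30 ∧ Frame 21 [] s s' ∧
      s'.reg 21 = digit T.R c i ∧ s'.reg 22 = T.tot j c i := by
  have hq := hB.q
  have hR := R_pos hq
  have hqB := hB.q_le
  have hRB := hB.R_le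
  have hKB := hB.K_le
  have hWB := hB.two_W_le
  have hN := hB.N_lt
  have htB := hB.tot_le.1
  have hszq := sz_le_q (T := T) j
  have hiq := hi.trans_le hszq
  have hdig : ∀ i, ((c : ℤ) / (T.R : ℤ) ^ i) % T.R = digit T.R c i := by
    intro i; rw [digit]; push_cast; rfl
  have hdigB : ∀ i, digit T.R c i ≤ B := fun i => (digit_lt hR c i).le.trans hRB
  have hquo : ∀ i, |(c : ℤ) / (T.R : ℤ) ^ i| ≤ B := by
    intro i
    have : (c : ℤ) / (T.R : ℤ) ^ i = (c / T.R ^ i : ℕ) := by push_cast; rfl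
    rw [this, Nat.abs_cast]
    exact_mod_cast (Nat.div_le_self _ _).trans (hc.le.trans hKB)
  have hpw : ∀ i < T.q, T.R ^ i ≤ B := fun i hi => (pow_le_K hq hi.le).trans hKB
  have hpw' : ∀ i < T.q, |(T.R : ℤ) ^ i| ≤ B := by
    intro i hi
    have := hpw i hi
    rw [← Nat.cast_pow, Nat.abs_cast]
    exact_mod_cast this
  have hm4 : s.mem 4 i = (T.R : ℤ) ^ i := hE.pow i hiq
  have hdiv : (digit T.R c i : ℤ) / T.q = (digit T.R c i / T.q : ℕ) := by push_cast; rfl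
  have hdivB := digit_div_lt hq c i
  have hdiv0 : (0 : ℤ) ≤ (digit T.R c i / T.q : ℕ) := Int.natCast_nonneg _
  rw [progTot, wp_seq, wp_assign]
  have hp0 := hpw' i hiq
  have hq0 := hquo i
  refine ⟨?_, ?_⟩
  · simp [h17, h20, hE.R, hm4, hdig, hdigB, hp0, hq0, hRB, -abs_pow]
    omega
  rw [wp_seq, wp_assign]
  refine ⟨?_, ?_⟩
  · simp [h17, h20, hE.R, hm4, hdig, hdigB, hqB, hE.q, hE.W, hdiv, abs_le, -Int.natCast_ediv]
    omega
  simp [h17, h20, hE.R, hm4, hdig, hE.q, hE.W]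
  refine wp_forLoop (fun l s' => l ≤ T.sz j ∧ Frame 21 [] s s' ∧ s'.reg 23 = l ∧
    s'.reg 21 = digit T.R c i ∧ s'.reg 22 = T.partTot j c i l)
    (T.sz j) 40 (by omega) (by omega) ?_ ?_ ?_ ?_
  · simp [partTot]
  · rintro i s' ⟨-, hF, hi, -⟩
    exact ⟨hi, by rw [hF.reg 13 (by omega), h13]⟩
  · rintro l hl s' ⟨-, hF, h23, h21, h22⟩
    have hE' := hE.mono hF (by omega) (by simp)
    have h11' := (hF.reg 11 (by omega)).trans h11
    have h17' := (hF.reg 17 (by omega)).trans h17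
    have h20' := (hF.reg 20 (by omega)).trans h20
    have hm4' : s'.mem 4 l = (T.R : ℤ) ^ l := hE'.pow l (hl.trans_le hszq)
    have hch := hE'.charge.eq_charge hi hl
    have hcol : ∀ i, (digit T.R c i : ℤ) % T.q = T.col c i := by
      intro i; rw [col]; push_cast; rfl
    have hcolB : ∀ i, T.col c i ≤ B := fun i => (col_lt hq c i).le.trans hqB
    have hmat := hB.mat_le hj hiq
    have hmat2 : (j * T.q + i) * T.q + l < T.N * T.q * T.q := by
      have h1 := Nat.mul_le_mul_right T.q (Nat.succ_le_of_lt hmat.1)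
      rw [Nat.succ_mul] at h1
      omega
    have hmB := hB.mat
    have e5 : ((((j : ℤ) * T.q + i) * T.q + l)).toNat = (j * T.q + i) * T.q + l := by
      exact_mod_cast Int.toNat_natCast _
    have f1 : |(j : ℤ) * T.q + i| ≤ B := by
      rw [abs_of_nonneg (by positivity)]
      exact_mod_cast hmat.1.le.trans hmat.2
    have f2 : |((j : ℤ) * T.q + i) * T.q| ≤ B := by
      rw [abs_of_nonneg (by positivity)]
      exact_mod_cast (Nat.le_add_right _ l).trans (hmat2.le.trans hmB)
    have f3 : |((j : ℤ) * T.q + i) * T.q + l| ≤ B := by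
      rw [abs_of_nonneg (by positivity)]
      exact_mod_cast hmat2.le.trans hmB
    have f4 : |(j : ℤ) * T.q| ≤ B := by
      rw [abs_of_nonneg (by positivity)]
      exact_mod_cast (Nat.le_add_right _ i).trans (hmat.1.le.trans hmat.2)
    have f5 : (0 : ℤ) ≤ ((j : ℤ) * T.q + i) * T.q + l := by positivity
    have f6 : |T.charge T.w j i l| ≤ B := (abs_charge_le _ _ _).trans (by omega)
    have hpart : ∀ l ≤ T.q, |T.partTot j c i l| ≤ B := by
      intro l hl
      refine (abs_partTot_le hq j c i l).trans ?_
      have h1 : ((T.q + 1) * T.W : ℤ) ≤ B := by exact_mod_cast htB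
      have h2 : (l * T.W : ℤ) ≤ T.q * T.W := by exact_mod_cast Nat.mul_le_mul_right T.W hl
      linarith
    have f7 := hpart l (by omega)
    have f8 := hpart (l + 1) (by omega)
    have hp1 := hpw' l (by omega)
    have hq1 := hquo l
    have hd1 := hdigB l
    have hd2 := hdigB i
    have hc1 := hcolB l
    have hc2 := hcolB i
    rw [partTot_succ] at f8
    by_cases hcc : T.col c l = T.col c i
    · rw [if_pos hcc] at f8
      simp [hE'.R, hE'.q, h11', h17', h20', h23, h21, h22, hm4', hdig, hcol, hcc, hch, e5, f1, f2,
        f3, f4, f5, f6, f7, f8, hd1, hd2, hc2, hF, hp1, hq1, partTot_succ, -abs_mul,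
        -abs_pow]
      omega
    · simp [hE'.R, hE'.q, h17', h23, h21, h22, hm4', hdig, hcol, hcc, hd1, hd2,
        hc1, hc2, hF, hp1, hq1, partTot_succ, -abs_mul, -abs_pow]
      omega
  · rintro t s' ht ⟨-, hF, -, h21, h22⟩
    exact ⟨by omega, hF, h21, h22⟩

end RAM

/-! ### Testing and computing a merge, agent by agent -/

namespace TreeGame

variable {T : TreeGame}

/-- The condition of `Mergeable` for the `i`-th agent. -/
def MergeableAt (T : TreeGame) (b : ℤ) (j r s i : ℕ) : Prop :=
  if T.pos j i = 0 then b ≤ T.tot j s i else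
    T.col r (T.pos j i - 1) = T.col s i ∧
      (digit T.R r (T.pos j i - 1) + T.q * T.tot j s i) / (T.R : ℤ) = 0

/-- The condition of `Mergeable` for the first `l` agents of the bag. -/
def MergeableUpto (T : TreeGame) (b : ℤ) (j r s l : ℕ) : Prop :=
  ∀ i < l, T.MergeableAt b j r s i

theorem mergeableUpto_zero (b : ℤ) (j r s : ℕ) : T.MergeableUpto b j r s 0 :=
  fun _ h => absurd h (by omega)

theorem mergeableUpto_succ (b : ℤ) (j r s l : ℕ) : T.MergeableUpto b j r s (l + 1) ↔
    T.MergeableUpto b j r s l ∧ T.MergeableAt b j r s l := by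
  constructor
  · exact fun h => ⟨fun i hi => h i (by omega), h l (by omega)⟩
  · rintro ⟨h1, h2⟩ i hi
    rcases Nat.lt_succ_iff_lt_or_eq.mp hi with h | rfl
    · exact h1 i h
    · exact h2

/-- The sum defining `merged`, restricted to the first `l` agents of the bag. -/
noncomputable def partMerged (T : TreeGame) (j r s l : ℕ) : ℤ :=
  r + ∑ i ∈ range l, if T.pos j i = 0 then 0 else
    T.q * T.tot j s i * T.R ^ (T.pos j i - 1)

theorem partMerged_succ (j r s l : ℕ) : T.partMerged j r s (l + 1) = T.partMerged j r s l +
    if T.pos j l = 0 then 0 else T.q * T.tot j s l * T.R ^ (T.pos j l - 1) := by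
  rw [partMerged, partMerged, sum_range_succ, add_assoc]

theorem pos_le_q (j i : ℕ) : T.pos j i ≤ T.q := (pos_le j i).trans (sz_le_q _)

theorem abs_pass_le (hq : 0 < T.q) (j s l : ℕ) :
    |T.q * T.tot j s l * (T.R : ℤ) ^ (T.pos j l - 1)| ≤
      (T.q * ((T.q + 1) * T.W) * T.K : ℕ) := by
  rw [abs_mul, abs_mul, Nat.abs_cast, Nat.cast_mul, Nat.cast_mul, ← Nat.cast_pow, Nat.abs_cast]
  have h1 := abs_tot_le hq j s l
  have h2 : T.R ^ (T.pos j l - 1) ≤ T.K := pow_le_K hq ((Nat.sub_le _ _).trans (pos_le_q j l))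
  gcongr

/-- The program forms this sum before it knows whether the pair is mergeable, so the digit bounds
are not available, only the crude bound `abs_tot_le` on each amount passed. This determines the
field `merge` of `Fits`. -/
theorem abs_partMerged_le (hq : 0 < T.q) {j r s l : ℕ} (hr : r < T.K) :
    |T.partMerged j r s l| ≤ (T.K + l * (T.q * ((T.q + 1) * T.W) * T.K) : ℕ) := by
  rw [partMerged, Nat.cast_add]
  refine (abs_add_le _ _).trans (add_le_add ?_ ?_)
  · rw [Nat.abs_cast]; exact_mod_cast hr.le
  · refine (abs_sum_le_sum_abs _ _).trans ?_
    refine (sum_le_card_nsmul _ _ ((T.q * ((T.q + 1) * T.W) * T.K : ℕ) : ℤ)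
      fun i _ => ?_).trans (by simp)
    split_ifs
    · simp; positivity
    · exact abs_pass_le hq j s i

theorem digit_lt_B {B : ℕ} (hB : T.Fits B) (c i : ℕ) : digit T.R c i ≤ B :=
  (digit_lt (R_pos hB.q) c i).le.trans hB.R_le

theorem pow_fits {B : ℕ} (hB : T.Fits B) {i : ℕ} (hi : i ≤ T.q) : |(T.R : ℤ) ^ i| ≤ B := by
  rw [← Nat.cast_pow, Nat.abs_cast]
  exact_mod_cast (pow_le_K hB.q hi).trans hB.K_le

theorem div_pow_fits {B : ℕ} (hB : T.Fits B) {c : ℕ} (hc : c < T.K) (i : ℕ) :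
    |(c : ℤ) / (T.R : ℤ) ^ i| ≤ B := by
  have : (c : ℤ) / (T.R : ℤ) ^ i = (c / T.R ^ i : ℕ) := by push_cast; rfl
  rw [this, Nat.abs_cast]
  exact_mod_cast (Nat.div_le_self _ _).trans (hc.le.trans hB.K_le)

theorem cast_digit (c i : ℕ) : ((c : ℤ) / (T.R : ℤ) ^ i) % T.R = digit T.R c i := by
  rw [digit]; push_cast; rfl

theorem cast_col (c i : ℕ) : (digit T.R c i : ℤ) % T.q = T.col c i := by
  rw [col]; push_cast; rfl

end TreeGame

/-! ### The program for a merge -/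

namespace RAM

open RAM.Expr RAM.Prog TreeGame

theorem abs_ediv_le {a : ℤ} {b B : ℕ} (h : |a| ≤ B) : |a / b| ≤ B := by
  refine le_trans ?_ h
  have h2 := Int.natAbs_ediv_le_natAbs a b
  rw [Int.abs_eq_natAbs, Int.abs_eq_natAbs]
  exact_mod_cast h2

/-- Merge the local state in register `17` into the local state in register `16`. -/
def progMerge : Prog :=
  assign 18 (lit 1) ;; assign 19 (reg 16) ;;
  forLoop 20 13 (
    progTot ;;
    assign 24 (load 5 (reg 11 * reg 2 + reg 20)) ;;
    ite (reg 24)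
      (assign 25 (load 4 (reg 24 - lit 1)) ;;
       assign 26 ((reg 16 / reg 25) % reg 4) ;;
       assign 22 (reg 2 * reg 22) ;;
       assign 18 (reg 18 *
        (eq (reg 26 % reg 2) (reg 21 % reg 2) * eq ((reg 26 + reg 22) / reg 4) (lit 0))) ;;
       assign 19 (reg 19 + reg 22 * reg 25))
      (ite (lt (reg 22) (reg 9)) (assign 18 (lit 0)) skip))

open Classical in
theorem wp_progMerge {T : TreeGame} {B : ℕ} (hB : T.Fits B) {s : State} (hE : T.Env s)
    {j r c : ℕ} {b : ℤ} (hj : j < T.N) (hr : r < T.K) (hc : c < T.K) (hb : |b| ≤ B)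
    (h9 : s.reg 9 = b) (h11 : s.reg 11 = j) (h13 : s.reg 13 = T.sz j) (h16 : s.reg 16 = r)
    (h17 : s.reg 17 = c) :
    wp B progMerge s fun t s' => t ≤ T.q * (50 * T.q + 150) + 20 ∧ Frame 18 [] s s' ∧
      s'.reg 18 = (if T.Mergeable b j r c then 1 else 0) ∧ s'.reg 19 = T.merged j r c := by
  have hq := hB.q
  have hqB := hB.q_le
  have hRB := hB.R_le
  have hKB := hB.K_le
  have hN := hB.N_lt
  have htB := hB.tot_le
  have hszq := sz_le_q (T := T) j
  simp only [progMerge, wp_seq, wp_assign]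
  simp [h16, hr.le.trans hKB]
  refine ⟨by omega, ?_⟩
  refine wp_forLoop (fun i s' => i ≤ T.sz j ∧ Frame 18 [] s s' ∧ s'.reg 20 = i ∧
    s'.reg 18 = (if T.MergeableUpto b j r c i then 1 else 0) ∧
    s'.reg 19 = T.partMerged j r c i) (T.sz j) (50 * T.q + 140) (by omega) (by omega) ?_ ?_ ?_ ?_
  · simp [partMerged, mergeableUpto_zero]
  · rintro i s' ⟨-, hF, hi, -⟩
    exact ⟨hi, by rw [hF.reg 13 (by omega), h13]⟩
  · rintro i hi s' ⟨-, hF, h20, h18, h19⟩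
    have hE' := hE.mono hF (by omega) (by simp)
    rw [wp_seq]
    refine wp_mono (wp_progTot hB hE' hj hi hc ((hF.reg 11 (by omega)).trans h11)
      ((hF.reg 13 (by omega)).trans h13) ((hF.reg 17 (by omega)).trans h17) h20) ?_
    rintro t1 s1 ⟨ht1, hF1, k21, k22⟩
    have hE1 := hE'.mono hF1 (by omega) (by simp)
    have k20 := (hF1.reg 20 (by omega)).trans h20
    have k18 := (hF1.reg 18 (by omega)).trans h18
    have k19 := (hF1.reg 19 (by omega)).trans h19
    have hFF : Frame 18 [] s s1 := hF.trans (hF1.mono (by omega) (by simp))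
    have k9 := (hFF.reg 9 (by omega)).trans h9
    have k11 := (hFF.reg 11 (by omega)).trans h11
    have k16 := (hFF.reg 16 (by omega)).trans h16
    clear hF hF1 h18 h19 h20 hE' s'
    have hmat := hB.mat_le hj (hi.trans_le hszq)
    have e1 := toNat_mul_add j T.q i
    have f1 : |(j : ℤ) * T.q + i| ≤ B := by
      rw [abs_of_nonneg (by positivity)]
      exact_mod_cast hmat.1.le.trans hmat.2
    have f4 : |(j : ℤ) * T.q| ≤ B := by
      rw [abs_of_nonneg (by positivity)]
      exact_mod_cast (Nat.le_add_right _ i).trans (hmat.1.le.trans hmat.2)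
    have f5 : (0 : ℤ) ≤ (j : ℤ) * T.q + i := by positivity
    have hpos : s1.mem 5 (j * T.q + i) = T.pos j i := hE1.pos j i hi (.inl hj)
    have hposq := pos_le_q (T := T) j i
    have htot := abs_tot_le hq j c i
    have f6 : |T.tot j c i| ≤ B := htot.trans (by exact_mod_cast htB.1)
    have hall := mergeableUpto_succ (T := T) b j r c i
    rw [wp_seq, wp_assign]
    refine ⟨?_, ?_⟩
    · simp [k11, hE1.q, k20, e1, f1, f4, f5, hpos, -abs_mul]
      omega
    rw [wp_ite]
    refine ⟨?_, ?_, ?_⟩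
    · simp [k11, hE1.q, k20, e1, hpos]
      omega
    · intro h0
      simp [k11, hE1.q, k20, e1, hpos] at h0
      have e2 : ((T.pos j i : ℤ) - 1).toNat = T.pos j i - 1 := by omega
      obtain ⟨p, hp⟩ : ∃ p, p = T.pos j i - 1 := ⟨_, rfl⟩
      have hpq : p < T.q := by omega
      have hm4 : s1.mem 4 p = (T.R : ℤ) ^ p := hE1.pow p hpq
      have g1 := pow_fits hB hpq.le
      have g2 := div_pow_fits hB hr p
      have g3 := digit_lt_B hB r p
      have g4 := digit_lt_B hB c i
      have g5 : |(T.q : ℤ) * T.tot j c i| ≤ (T.q * ((T.q + 1) * T.W) : ℕ) := by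
        rw [abs_mul, Nat.abs_cast, Nat.cast_mul]
        gcongr
      have g6 : |(T.q : ℤ) * T.tot j c i| ≤ B := g5.trans (by
        exact_mod_cast (Nat.le_add_right _ _).trans htB.2.1)
      have g7 : |(digit T.R r p : ℤ) + T.q * T.tot j c i| ≤ B := by
        have h1 := digit_lt (R_pos hq) r p
        have h2 : (T.q * ((T.q + 1) * T.W) : ℕ) + (T.R : ℤ) ≤ B := by exact_mod_cast htB.2.1
        refine (abs_add_le _ _).trans ?_
        rw [Nat.abs_cast]
        omega
      have g8 := abs_ediv_le (b := T.R) g7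
      have g9 : |T.q * T.tot j c i * (T.R : ℤ) ^ p| ≤ B := by
        rw [hp]
        exact (abs_pass_le hq j c i).trans (by exact_mod_cast htB.2.2)
      have g10 : ∀ l ≤ T.q, |T.partMerged j r c l| ≤ B := by
        intro l hl
        refine (abs_partMerged_le hq hr).trans ?_
        exact_mod_cast (Nat.add_le_add_left (Nat.mul_le_mul_right _ hl) _).trans hB.merge
      have g11 := g10 i (by omega)
      have g12 := g10 (i + 1) (by omega)
      have g13 : ∀ i, T.col r i ≤ B := fun i => (col_lt hq r i).le.trans hqB
      have g14 : ∀ i, T.col c i ≤ B := fun i => (col_lt hq c i).le.trans hqB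
      have hMA : T.MergeableAt b j r c i ↔ T.col r p = T.col c i ∧
          (digit T.R r p + T.q * T.tot j c i) / (T.R : ℤ) = 0 := by
        rw [MergeableAt, if_neg h0, hp]
      rw [partMerged_succ, if_neg h0, ← hp] at g12
      rw [← hp] at e2
      have hrB := hr.le.trans hKB
      rw [wp_seq, wp_assign]
      refine ⟨?_, ?_⟩
      · simp [k11, hE1.q, k20, e1, hpos, e2, hm4, g1, abs_le, -abs_pow, -abs_mul]
        have := abs_le.mp g1
        omega
      have hB1 : 1 ≤ B := by omega
      have hsum : T.partMerged j r c (i + 1) =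
          T.partMerged j r c i + T.q * T.tot j c i * (T.R : ℤ) ^ p := by
        rw [partMerged_succ, if_neg h0, ← hp]
      simp only [wp_seq, wp_assign]
      -- Register 18 becomes the product of three indicators: the earlier agents passed, the colours
      -- match, and the new digit stays in range.
      by_cases hU : T.MergeableUpto b j r c i <;> by_cases hc1 : T.col r p = T.col c i <;>
        by_cases hc2 : (digit T.R r p + T.q * T.tot j c i) / (T.R : ℤ) = 0 <;>
        simp [k11, k16, hE1.q, hE1.R, k20, k18, k19, k21, k22, e1, hpos, e2, hm4, cast_digit,
          cast_col, hall, hMA, hU, hc1, hc2, g1, g2, g3, g4, g6, g7, g8, g9, g11, g12, g13, g14,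
          hrB, hqB, hRB, hFF, hB1, hsum, -abs_mul, -abs_pow] <;> omega
    · intro h0
      simp [k11, hE1.q, k20, e1, hpos] at h0
      have hMA : T.MergeableAt b j r c i ↔ b ≤ T.tot j c i := by
        rw [MergeableAt, if_pos h0]
      by_cases hlt : T.tot j c i < b
      · have : ¬ T.MergeableAt b j r c i := by rw [hMA]; omega
        simp [k9, k22, k20, hlt, hFF, hb, f6, hall, this, partMerged_succ, h0, k19]
        omega
      · have : T.MergeableAt b j r c i := by rw [hMA]; omega
        simp [k9, k22, k20, hlt, hFF, hb, f6, hall, this, partMerged_succ, h0, k19, k18]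
        omega
  · rintro t s' ht ⟨-, hF, -, h18, h19⟩
    refine ⟨?_, ?_, h18, h19⟩
    · have := Nat.mul_le_mul_right (50 * T.q + 140 + 8) hszq
      nlinarith
    · simpa using hF

end RAM

/-! ### The tables of attainable codes and of choices -/

namespace TreeGame

variable {T : TreeGame}

/-- The nonzero cells of `f` are the local states that are attainable after `d` steps. -/
def TabSpec (T : TreeGame) (b : ℤ) (f : ℕ → ℤ) (d : ℕ) : Prop :=
  ∀ k ≤ T.N, ∀ s < T.K, 0 ≤ f (k * T.K + s) ∧ f (k * T.K + s) ≤ (T.K * T.K : ℕ) ∧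
    (f (k * T.K + s) ≠ 0 ↔ T.Feas b d k s)

/-- The pair of local states with the code `x` is attainable and merges to `r`. -/
def PairOK (T : TreeGame) (b : ℤ) (d j x r : ℕ) : Prop :=
  T.Feas b d (T.up j) (x / T.K) ∧ T.Feas b d j (x % T.K) ∧ T.Step b j (x / T.K) (x % T.K) r

/-- Row `j` of `g` contains, for each local state, one plus a pair below `x` that merges to it. -/
def RowUpto (T : TreeGame) (b : ℤ) (g : ℕ → ℤ) (d j x : ℕ) : Prop :=
  ∀ r < T.K, (g (j * T.K + r) = 0 ∧ ∀ x' < x, ¬ T.PairOK b d j x' r) ∨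
    ∃ x' < x, g (j * T.K + r) = (x' + 1 : ℕ) ∧ T.PairOK b d j x' r

/-- The rows of the last `d` nodes in `g` are complete, and the others are `0`. -/
def ChoiceSpec (T : TreeGame) (b : ℤ) (g : ℕ → ℤ) (d : ℕ) : Prop :=
  ∀ j < T.N, (T.N ≤ j + d → T.RowUpto b g (T.N - 1 - j) j (T.K * T.K)) ∧
    (j + d < T.N → ∀ r < T.K, g (j * T.K + r) = 0)

variable {b : ℤ} {g g' f f' : ℕ → ℤ} {d j x : ℕ}

theorem RowUpto.congr (h : T.RowUpto b g d j x)
    (hg : ∀ r < T.K, g' (j * T.K + r) = g (j * T.K + r)) : T.RowUpto b g' d j x := by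
  intro r hr
  rw [hg r hr]
  exact h r hr

theorem RowUpto.skip (h : T.RowUpto b g d j x) (hx : ∀ r, ¬ T.PairOK b d j x r) :
    T.RowUpto b g d j (x + 1) := by
  intro r hr
  rcases h r hr with ⟨h0, h1⟩ | ⟨x', hx', h1⟩
  · refine .inl ⟨h0, fun x' hx' => ?_⟩
    rcases Nat.lt_succ_iff_lt_or_eq.mp hx' with h | rfl
    · exact h1 x' h
    · exact hx r
  · exact .inr ⟨x', by omega, h1⟩

theorem PairOK.unique {r r' : ℕ} (h : T.PairOK b d j x r) (h' : T.PairOK b d j x r') : r = r' := by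
  have := h.2.2.2.2.2.trans h'.2.2.2.2.2.symm
  exact_mod_cast this

/-- Overwriting an earlier pair is harmless, since any pair that merges to the code serves as a
witness. Other cells are unaffected because a pair has only one result. -/
theorem RowUpto.update {r : ℕ} (h : T.RowUpto b g d j x) (hx : T.PairOK b d j x r) :
    T.RowUpto b (Function.update g (j * T.K + r) ((x : ℤ) + 1)) d j (x + 1) := by
  intro r' hr'
  rw [Function.update_apply]
  split_ifs with he
  · have : r' = r := by omega
    subst this
    exact .inr ⟨x, by omega, by push_cast; rfl, hx⟩
  · rcases h r' hr' with ⟨h0, h1⟩ | ⟨x', hx', h1⟩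
    · refine .inl ⟨h0, fun x' hx' => ?_⟩
      rcases Nat.lt_succ_iff_lt_or_eq.mp hx' with h | rfl
      · exact h1 x' h
      · exact fun h' => he (by rw [h'.unique hx])
    · exact .inr ⟨x', by omega, h1⟩

/-- All pairs of codes are numbered by `r * K + s` below `K * K`. A complete row of choices thus
doubles as the new row of the parent in the table of attainable codes. -/
theorem RowUpto.feas_iff (hq : 0 < T.q) (hj : j < T.N)
    (h : T.RowUpto b g (T.N - 1 - j) j (T.K * T.K)) {r : ℕ} (hr : r < T.K) :
    g (j * T.K + r) ≠ 0 ↔ T.Feas b (T.N - 1 - j + 1) (T.up j) r := by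
  have e : T.N - 1 - (T.N - 1 - j) = j := by omega
  have hK := K_pos hq
  rw [Feas, e, if_pos rfl]
  rcases h r hr with ⟨h0, h1⟩ | ⟨x', hx', h0, h1⟩
  · refine iff_of_false (by rw [h0]; simp) ?_
    rintro ⟨r', s', hf, hf', hst⟩
    refine h1 (r' * T.K + s') ?_ ?_
    · have h1 := Nat.mul_le_mul_right T.K (Nat.succ_le_of_lt hst.1)
      have h2 := hst.2.1
      rw [Nat.succ_mul] at h1
      omega
    · have e1 : (r' * T.K + s') / T.K = r' := by
        rw [mul_comm, Nat.mul_add_div hK, Nat.div_eq_of_lt hst.2.1, add_zero]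
      have e2 : (r' * T.K + s') % T.K = s' := by
        rw [mul_comm, Nat.mul_add_mod, Nat.mod_eq_of_lt hst.2.1]
      rw [PairOK, e1, e2]
      exact ⟨hf, hf', hst⟩
  · refine iff_of_true (by rw [h0]; positivity) ⟨_, _, h1.1, h1.2.1, h1.2.2⟩

theorem RowUpto.bounds (h : T.RowUpto b g d j (T.K * T.K)) {r : ℕ} (hr : r < T.K) :
    0 ≤ g (j * T.K + r) ∧ g (j * T.K + r) ≤ (T.K * T.K : ℕ) := by
  rcases h r hr with ⟨h0, -⟩ | ⟨x', hx', h0, -⟩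
  · rw [h0]; exact ⟨le_rfl, by positivity⟩
  · rw [h0]; exact ⟨by positivity, by exact_mod_cast hx'⟩

theorem Fits.tab_lt {B k s : ℕ} (hB : T.Fits B) (hk : k ≤ T.N) (hs : s < T.K) :
    k * T.K + s < (T.N + 1) * T.K ∧ k * T.K + s < B := by
  have h1 := Nat.mul_le_mul_right T.K hk
  have h2 := hB.tab
  rw [Nat.succ_mul] at h2 ⊢
  omega

theorem Fits.tab_fits {B k s : ℕ} (hB : T.Fits B) (hk : k ≤ T.N) (hs : s < T.K) :
    ((k : ℤ) * T.K + s).toNat = k * T.K + s ∧ (0 : ℤ) ≤ (k : ℤ) * T.K + s ∧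
      |(k : ℤ) * T.K| ≤ B ∧ |(k : ℤ) * T.K + s| ≤ B := by
  have h1 := hB.tab_lt hk hs
  refine ⟨RAM.toNat_mul_add _ _ _, by positivity, ?_, ?_⟩
  · rw [abs_of_nonneg (by positivity)]
    exact_mod_cast (Nat.le_add_right _ s).trans h1.2.le
  · rw [abs_of_nonneg (by positivity)]
    exact_mod_cast h1.2.le

end TreeGame

/-! ### Merging one node into its parent -/

namespace RAM

open RAM.Expr RAM.Prog TreeGame

/-- Merge all attainable local states of the node in register `11` into those of the parent in
register `14`. -/
def progPairs : Prog :=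
  forLoop 15 7 (
    assign 16 (reg 15 / reg 5) ;;
    assign 17 (reg 15 % reg 5) ;;
    ite (load 8 (reg 14 * reg 5 + reg 16))
      (ite (load 8 (reg 11 * reg 5 + reg 17))
        (progMerge ;;
         ite (reg 18) (store 9 (reg 11 * reg 5 + reg 19) (reg 15 + lit 1)) skip)
        skip)
      skip)

theorem wp_progPairs {T : TreeGame} {B : ℕ} (hB : T.Fits B) {s : State} (hE : T.Env s)
    {j : ℕ} {b : ℤ} (hj : j < T.N) (hb : |b| ≤ B)
    (h9 : s.reg 9 = b) (h11 : s.reg 11 = j) (h13 : s.reg 13 = T.sz j) (h14 : s.reg 14 = T.up j)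
    (hT : T.TabSpec b (s.mem 8) (T.N - 1 - j)) (hz : ∀ r < T.K, s.mem 9 (j * T.K + r) = 0) :
    wp B progPairs s fun t s' => t ≤ T.K * T.K * (T.q * (50 * T.q + 150) + 100) + 10 ∧
      Frame 15 [9] s s' ∧ T.RowUpto b (s'.mem 9) (T.N - 1 - j) j (T.K * T.K) ∧
      ∀ j', j' ≠ j → ∀ r < T.K, s'.mem 9 (j' * T.K + r) = s.mem 9 (j' * T.K + r) := by
  have hq := hB.q
  have hK := K_pos hq
  have hKB := hB.K_le
  have hN := hB.N_lt
  have hsq := hB.sq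
  obtain ⟨d, hd⟩ : ∃ d, d = T.N - 1 - j := ⟨_, rfl⟩
  rw [← hd] at hT ⊢
  refine wp_forLoop (fun x s' => x ≤ T.K * T.K ∧ Frame 15 [9] s s' ∧ s'.reg 15 = x ∧
    T.RowUpto b (s'.mem 9) d j x ∧
    ∀ j', j' ≠ j → ∀ r < T.K, s'.mem 9 (j' * T.K + r) = s.mem 9 (j' * T.K + r))
    (T.K * T.K) (T.q * (50 * T.q + 150) + 90) (by omega) (by omega) ?_ ?_ ?_ ?_
  · refine ⟨Nat.zero_le _, by simp, by simp, fun r hr => .inl ⟨hz r hr, fun x' hx' => ?_⟩, ?_⟩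
    · omega
    · exact fun _ _ _ _ => rfl
  · rintro i s' ⟨-, hF, hi, -⟩
    exact ⟨hi, by rw [hF.reg 7 (by omega), hE.sq]⟩
  · rintro x hx s' ⟨-, hF, h15, hrow, hother⟩
    have hE' := hE.mono hF (by omega) (by simp)
    have h9' := (hF.reg 9 (by omega)).trans h9
    have h11' := (hF.reg 11 (by omega)).trans h11
    have h13' := (hF.reg 13 (by omega)).trans h13
    have h14' := (hF.reg 14 (by omega)).trans h14
    have hm8 := hF.mem 8 (by simp)
    obtain ⟨a, ha⟩ : ∃ a, a = x / T.K := ⟨_, rfl⟩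
    obtain ⟨c, hc⟩ : ∃ c, c = x % T.K := ⟨_, rfl⟩
    have haK : a < T.K := by rw [ha]; exact Nat.div_lt_of_lt_mul hx
    have hcK : c < T.K := by rw [hc]; exact Nat.mod_lt _ hK
    have hxa : (x : ℤ) / T.K = a := by rw [ha]; push_cast; rfl
    have hxc : (x : ℤ) % T.K = c := by rw [hc]; push_cast; rfl
    have hpN := up_le (T := T) hj
    obtain ⟨t1, t2, t3⟩ := hT _ hpN a haK
    obtain ⟨u1, u2, u3⟩ := hT _ hj.le c hcK
    obtain ⟨f1, f2, f3, f4⟩ := hB.tab_fits hpN haK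
    obtain ⟨g1, g2, g3, g4⟩ := hB.tab_fits hj.le hcK
    have hsq' : ((T.K * T.K : ℕ) : ℤ) + 1 ≤ B := by exact_mod_cast hsq
    have t4 : |s.mem 8 (T.up j * T.K + a)| ≤ B := by rw [abs_le]; omega
    have u4 : |s.mem 8 (j * T.K + c)| ≤ B := by rw [abs_le]; omega
    have hxB : x + 1 ≤ B := by omega
    have hupB : T.up j ≤ B := by omega
    have hjB : j ≤ B := by omega
    have haB : a ≤ B := by omega
    have hcB : c ≤ B := by omega
    rw [wp_seq, wp_assign]
    refine ⟨?_, ?_⟩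
    · simp [h15, hE'.K, hxa]; omega
    rw [wp_seq, wp_assign]
    refine ⟨?_, ?_⟩
    · simp [h15, hE'.K, hxc]; omega
    rw [wp_ite]
    refine ⟨?_, ?_, ?_⟩
    · simp [h15, h14', hE'.K, hxa, hm8, f1, f2, f3, f4, t4, hupB, haB, hKB, -abs_mul]
    · intro hta
      simp [h15, h14', hE'.K, hxa, hm8, f1] at hta
      rw [← Ne, t3] at hta
      rw [wp_ite]
      refine ⟨?_, ?_, ?_⟩
      · simp [h15, h11', hE'.K, hxc, hm8, g1, g2, g3, g4, u4, hjB, hcB, hKB, -abs_mul]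
      · intro huc
        simp [h15, h11', hE'.K, hxc, hm8, g1] at huc
        rw [← Ne, u3] at huc
        rw [wp_seq]
        refine wp_mono (wp_progMerge hB (j := j) (r := a) (c := c) (b := b)
          (hE'.mono (c := 16) (A := []) (by simp) (by omega) (by simp)) hj haK hcK hb
          ?_ ?_ ?_ ?_ ?_) ?_
        · simpa using h9'
        · simpa using h11'
        · simpa using h13'
        · simp [h15, hE'.K, hxa]
        · simp [h15, hE'.K, hxc]
        rintro t1 s1 ⟨ht1, hF1, k18, k19⟩
        have k15 := hF1.reg 15 (by omega)
        have k11 := hF1.reg 11 (by omega)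
        have k5 := hF1.reg 5 (by omega)
        have km9 := hF1.mem 9 (by simp)
        simp [h15, h11', hE'.K] at k15 k11 k5 km9
        have hFF : Frame 15 [9] s s1 := by
          refine hF.trans (Frame.trans ?_ (hF1.mono (by omega) (by simp)))
          simp
        by_cases hM : T.Mergeable b j a c
        · obtain ⟨r', hr', hr1, -⟩ := exists_merged_eq hj hq haK hM
          have hpair : T.PairOK b d j x r' := by
            rw [PairOK, ← ha, ← hc]
            exact ⟨hta, huc, haK, hcK, hM, hr1⟩
          have hupd := hrow.update hpair
          obtain ⟨v1, v2, v3, v4⟩ := hB.tab_fits hj.le hr'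
          have hoth : ∀ j', j' ≠ j → ∀ r < T.K,
              Function.update (s'.mem 9) (j * T.K + r') ((x : ℤ) + 1) (j' * T.K + r) =
              s.mem 9 (j' * T.K + r) := by
            intro j' hne r hr
            rw [Function.update_apply, if_neg, hother j' hne r hr]
            rw [mul_add_eq_iff hr hr']
            exact fun h => hne h.1
          rw [if_pos hM] at k18
          rw [← hr1] at k19
          have hr'B : r' ≤ B := by omega
          have hx1 : |(x : ℤ) + 1| ≤ B := by rw [abs_le]; omega
          have hx2 : x ≤ B := by omega
          have h1B : 1 ≤ B := by omega
          simp [k18, k19, k15, k11, k5, km9, v1, v2, v3, v4, hFF, hupd, hKB, hjB, hr'B, hx1, hx2,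
            h1B, -abs_mul]
          exact ⟨by omega, hx, hoth⟩
        · have hpair : ∀ r', ¬ T.PairOK b d j x r' := by
            intro r' h
            rw [PairOK, ← ha, ← hc] at h
            exact hM h.2.2.2.2.1
          rw [if_neg hM] at k18
          have hskip := hrow.skip hpair
          simp [k18, k15, km9, hFF, hskip]
          exact ⟨by omega, by omega, hother⟩
      · intro huc
        simp [h15, h11', hE'.K, hxc, hm8, g1] at huc
        have hpair : ∀ r', ¬ T.PairOK b d j x r' := by
          intro r' h
          rw [PairOK, ← hc, ← u3] at h
          exact h.2.1 huc
        have hskip := hrow.skip hpair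
        simp [h15, hF, hskip]
        exact ⟨by omega, hother⟩
    · intro hta
      simp [h15, h14', hE'.K, hxa, hm8, f1] at hta
      have hpair : ∀ r', ¬ T.PairOK b d j x r' := by
        intro r' h
        rw [PairOK, ← ha, ← t3] at h
        exact h.1 hta
      have hskip := hrow.skip hpair
      simp [h15, hF, hskip]
      exact ⟨by omega, hother⟩
  · rintro t s' ht ⟨-, hF, -, hrow, hother⟩
    exact ⟨by nlinarith, hF, hrow, hother⟩

/-- Copy the row of register `11` of the choices to the row of register `14` of the table. -/
def progCopy : Prog :=
  forLoop 15 5 (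
    store 8 (reg 14 * reg 5 + reg 15) (load 9 (reg 11 * reg 5 + reg 15)))

/-- The parent's old row is read for every pair, so the new one is collected among the choices and
copied only at the end. -/
theorem wp_progCopy {T : TreeGame} {B : ℕ} (hB : T.Fits B) {s : State} (hE : T.Env s)
    {j p : ℕ} (hj : j ≤ T.N) (hp : p ≤ T.N) (h11 : s.reg 11 = j) (h14 : s.reg 14 = p)
    (hv : ∀ r < T.K, |s.mem 9 (j * T.K + r)| ≤ B) :
    wp B progCopy s fun t s' => t ≤ T.K * 30 + 10 ∧ Frame 15 [8] s s' ∧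
      ∀ k, ∀ r < T.K, s'.mem 8 (k * T.K + r) =
        if k = p then s.mem 9 (j * T.K + r) else s.mem 8 (k * T.K + r) := by
  have hKB := hB.K_le
  have hN := hB.N_lt
  refine wp_forLoop (fun i s' => i ≤ T.K ∧ Frame 15 [8] s s' ∧ s'.reg 15 = i ∧
    ∀ k, ∀ r < T.K, s'.mem 8 (k * T.K + r) =
        if k = p ∧ r < i then s.mem 9 (j * T.K + r) else s.mem 8 (k * T.K + r))
    T.K 20 (by omega) (by omega) ?_ ?_ ?_ ?_
  · simp
  · rintro i s' ⟨-, hF, hi, -⟩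
    exact ⟨hi, by rw [hF.reg 5 (by omega), hE.K]⟩
  · rintro i hi s' ⟨-, hF, h15, h8⟩
    have hE' := hE.mono hF (by omega) (by simp)
    have h11' := (hF.reg 11 (by omega)).trans h11
    have h14' := (hF.reg 14 (by omega)).trans h14
    have hm9 := hF.mem 9 (by simp)
    obtain ⟨f1, f2, f3, f4⟩ := hB.tab_fits hp hi
    obtain ⟨g1, g2, g3, g4⟩ := hB.tab_fits hj hi
    have hvi := hv i hi
    simp [h15, h11', h14', hE'.K, hm9, f1, f2, f3, f4, g1, g2, g3, g4, hvi, hF, hKB, hi,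
      -abs_mul]
    refine ⟨by omega, by omega, fun k r hr => ?_⟩
    rw [Function.update_apply, h8 k r hr]
    by_cases he : k * T.K + r = p * T.K + i
    · obtain ⟨rfl, rfl⟩ := (mul_add_eq_iff hr hi).mp he
      simp
    · have : ¬ (k = p ∧ r = i) := fun h => he (by rw [h.1, h.2])
      rw [if_neg he]
      split_ifs <;> first | rfl | omega
  · rintro t s' ht ⟨-, hF, -, h8⟩
    refine ⟨by omega, hF, fun k r hr => ?_⟩
    rw [h8 k r hr]
    simp [hr]

end RAM

/-! ### Initial tables and the passage from one step to the next -/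

namespace TreeGame

variable {T : TreeGame} {b : ℤ}

/-- The first `l` accumulated utilities in the local state `s` are `0`. -/
def ZeroUpto (T : TreeGame) (s l : ℕ) : Prop := ∀ i < l, digit T.R s i / T.q = T.W

theorem zeroUpto_zero (s : ℕ) : T.ZeroUpto s 0 := fun _ h => absurd h (by omega)

theorem zeroUpto_succ {s l : ℕ} :
    T.ZeroUpto s (l + 1) ↔ T.ZeroUpto s l ∧ digit T.R s l / T.q = T.W := by
  refine ⟨fun h => ⟨fun i hi => h i (by omega), h l (by omega)⟩, fun h i hi => ?_⟩
  rcases Nat.lt_succ_iff_lt_or_eq.mp hi with h' | rfl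
  exacts [h.1 i h', h.2]

open Classical in
/-- The initial contents of the table. -/
noncomputable def initVal (T : TreeGame) (x : ℕ) : ℤ :=
  if T.ZeroUpto (x % T.K) T.q then 1 else 0

/-- Initially a node may take any colours, with accumulated utilities `0`; this depends neither on
the node nor on `b`. -/
theorem tabSpec_zero (hq : 0 < T.q) {f : ℕ → ℤ} (h : RAM.EqUpto ((T.N + 1) * T.K) f T.initVal) :
    T.TabSpec b f 0 := by
  intro k hk s hs
  have hlt : k * T.K + s < (T.N + 1) * T.K := by
    have := Nat.mul_le_mul_right T.K hk
    rw [Nat.succ_mul]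
    omega
  have hm : (k * T.K + s) % T.K = s := by
    rw [mul_comm, Nat.mul_add_mod, Nat.mod_eq_of_lt hs]
  have hK : 1 ≤ T.K * T.K := Nat.mul_pos (K_pos hq) (K_pos hq)
  rw [h _ hlt, initVal, hm, Feas]
  split_ifs with hc
  · refine ⟨by norm_num, by exact_mod_cast hK, iff_of_true (by norm_num) ⟨hs, hc⟩⟩
  · exact ⟨by norm_num, by positivity, iff_of_false (by norm_num) fun h => hc h.2⟩

theorem choiceSpec_zero {g : ℕ → ℤ} (h : RAM.EqUpto ((T.N + 1) * T.K) g fun _ => 0) :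
    T.ChoiceSpec b g 0 := by
  intro j hj
  refine ⟨fun h' => by omega, fun _ r hr => h _ ?_⟩
  have := Nat.mul_le_mul_right T.K hj
  rw [Nat.succ_mul] at this ⊢
  omega

theorem TabSpec.succ (hq : 0 < T.q) {f f' g : ℕ → ℤ} {j : ℕ} (hj : j < T.N)
    (hf : T.TabSpec b f (T.N - 1 - j)) (hg : T.RowUpto b g (T.N - 1 - j) j (T.K * T.K))
    (h : ∀ k, ∀ r < T.K, f' (k * T.K + r) =
        if k = T.up j then g (j * T.K + r) else f (k * T.K + r)) :
    T.TabSpec b f' (T.N - 1 - j + 1) := by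
  intro k hk r hr
  rw [h k r hr]
  split_ifs with hkj
  · subst hkj
    obtain ⟨h1, h2⟩ := hg.bounds hr
    exact ⟨h1, h2, hg.feas_iff hq hj hr⟩
  · obtain ⟨h1, h2, h3⟩ := hf k hk r hr
    refine ⟨h1, h2, h3.trans ?_⟩
    have e : T.N - 1 - (T.N - 1 - j) = j := by omega
    rw [Feas, e, if_neg hkj]

theorem ChoiceSpec.succ {g g' : ℕ → ℤ} {j : ℕ} (hj : j < T.N)
    (hg : T.ChoiceSpec b g (T.N - 1 - j))
    (hg' : T.RowUpto b g' (T.N - 1 - j) j (T.K * T.K))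
    (h : ∀ j', j' ≠ j → ∀ r < T.K, g' (j' * T.K + r) = g (j' * T.K + r)) :
    T.ChoiceSpec b g' (T.N - 1 - j + 1) := by
  intro j' hj'
  by_cases hne : j' = j
  · subst hne
    exact ⟨fun _ => hg', fun _ => by omega⟩
  · obtain ⟨h1, h2⟩ := hg j' hj'
    refine ⟨fun _ => (h1 (by omega)).congr (h j' hne), fun _ r hr => ?_⟩
    rw [h j' hne r hr, h2 (by omega) r hr]

end TreeGame

/-! ### Programs for the initial tables and the sweep over the nodes -/

namespace RAM

open RAM.Expr RAM.Prog TreeGame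

/-- Set register `11` to `1` if the code in register `12` has accumulated utilities `0`, and to `0`
otherwise. -/
def progIsZero : Prog :=
  assign 11 (lit 1) ;;
  forLoop 13 2 (
    assign 11 (reg 11 * eq (((reg 12 / load 4 (reg 13)) % reg 4) / reg 2) (reg 3)))

open Classical in
theorem wp_progIsZero {T : TreeGame} {B : ℕ} (hB : T.Fits B) {s : State} (hE : T.Env s)
    {c : ℕ} (hc : c < T.K) (h12 : s.reg 12 = c) :
    wp B progIsZero s fun t s' => t ≤ T.q * 30 + 20 ∧ Frame 11 [] s s' ∧
      s'.reg 11 = if T.ZeroUpto c T.q then 1 else 0 := by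
  have hq := hB.q
  have hqB := hB.q_le
  have hKB := hB.K_le
  have hRB := hB.R_le
  have hWB := hB.two_W_le
  have h1B : 1 ≤ B := by omega
  have hcB : c ≤ B := by omega
  have hWB' : T.W ≤ B := by omega
  rw [progIsZero, wp_seq, wp_assign]
  refine ⟨by simpa using h1B, ?_⟩
  refine wp_forLoop (fun l s' => l ≤ T.q ∧ Frame 11 [] s s' ∧ s'.reg 12 = c ∧ s'.reg 13 = l ∧
    s'.reg 11 = if T.ZeroUpto c l then 1 else 0)
    T.q 20 (by omega) (by omega) ?_ ?_ ?_ ?_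
  · simp [h12, zeroUpto_zero]
  · rintro i s' ⟨-, hF, -, hi, -⟩
    exact ⟨hi, by rw [hF.reg 2 (by omega), hE.q]⟩
  · rintro l hl s' ⟨-, hF, h12, h13, h11⟩
    have hE' := hE.mono hF (by omega) (by simp)
    have hp0 := pow_fits hB hl.le
    have hq0 := div_pow_fits hB hc l
    have hm4 : s'.mem 4 l = (T.R : ℤ) ^ l := hE'.pow l hl
    have hd1 := digit_lt_B hB c l
    have hdig := cast_digit (T := T) c l
    have hdiv : (digit T.R c l : ℤ) / T.q = (digit T.R c l / T.q : ℕ) := by push_cast; rfl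
    have hdivB := digit_div_lt hq c l
    have hdB : digit T.R c l / T.q ≤ B := by omega
    by_cases hall : T.ZeroUpto c l
    · rw [if_pos hall] at h11
      by_cases hcur : digit T.R c l / T.q = T.W
      · simp [h11, h12, h13, hE'.R, hE'.q, hE'.W, hm4, hp0, hq0, hdig, hd1, hdiv, hcur, hqB,
          hRB, hWB', h1B, hF, hcB, zeroUpto_succ, hall, -abs_pow, -Int.natCast_ediv]
        omega
      · have hcur' : ((digit T.R c l / T.q : ℕ) : ℤ) ≠ T.W := by exact_mod_cast hcur
        simp [h11, h12, h13, hE'.R, hE'.q, hE'.W, hm4, hp0, hq0, hdig, hd1, hdiv, hdB, hcur, hcur',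
          hqB, hRB, hWB', h1B, hF, hcB, zeroUpto_succ, -abs_pow, -Int.natCast_ediv]
        omega
    · rw [if_neg hall] at h11
      simp [h11, h12, h13, hE'.R, hE'.q, hE'.W, hm4, hp0, hq0, hdig, hd1, hdiv, hdB, hqB,
        hRB, hWB', h1B, hF, hcB, zeroUpto_succ, hall, -abs_pow, -Int.natCast_ediv]
      omega
  · rintro t s' ht ⟨-, hF, -, -, h11⟩
    refine ⟨?_, hF, h11⟩
    simp
    omega

/-- Set up the table and the choices. -/
def progInit : Prog :=
  forLoop 10 8 (
    assign 12 (reg 10 % reg 5) ;; progIsZero ;; store 8 (reg 10) (reg 11) ;;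
    store 9 (reg 10) (lit 0))

/-- The tables are rebuilt for each threshold; clearing the choices removes what the previous round
has left. The threshold `b` is arbitrary since the initial contents do not depend on it. -/
theorem wp_progInit {T : TreeGame} {B : ℕ} (hB : T.Fits B) {s : State} (hE : T.Env s) (b : ℤ) :
    wp B progInit s fun t s' => t ≤ (T.N + 1) * T.K * (T.q * 30 + 50) + 10 ∧
      Frame 10 [8, 9] s s' ∧ T.TabSpec b (s'.mem 8) 0 ∧ T.ChoiceSpec b (s'.mem 9) 0 := by
  have hq := hB.q
  have hK := K_pos hq
  have hKB := hB.K_le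
  have htab := hB.tab
  have h1B : 1 ≤ B := by omega
  refine wp_forLoop (fun x s' => x ≤ (T.N + 1) * T.K ∧ Frame 10 [8, 9] s s' ∧ s'.reg 10 = x ∧
    EqUpto x (s'.mem 8) T.initVal ∧ EqUpto x (s'.mem 9) fun _ => 0)
    ((T.N + 1) * T.K) (T.q * 30 + 40) (by omega) (by omega) ?_ ?_ ?_ ?_
  · simp
  · rintro i s' ⟨-, hF, hi, -⟩
    exact ⟨hi, by rw [hF.reg 8 (by omega), hE.tab]⟩
  · rintro x hx s' ⟨-, hF, h10, h8, h9⟩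
    have hE' := hE.mono hF (by omega) (by simp)
    have hxB : x ≤ B := by omega
    have hcK : x % T.K < T.K := Nat.mod_lt _ hK
    obtain ⟨c, hc⟩ : ∃ c, c = x % T.K := ⟨_, rfl⟩
    have hxc : (x : ℤ) % T.K = c := by rw [hc]; push_cast; rfl
    have hcB : c ≤ B := by omega
    rw [wp_seq, wp_assign]
    refine ⟨by simp [h10, hE'.K, hxc, hxB, hKB, hcB], ?_⟩
    rw [wp_seq]
    refine wp_mono (wp_progIsZero hB (c := c)
      (hE'.mono (c := 12) (A := []) (by simp) (by omega) (by simp)) (by omega)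
      (by simp [h10, hE'.K, hxc])) ?_
    rintro t1 s1 ⟨ht1, hF1, k11⟩
    have k10 := hF1.reg 10 (by omega)
    have km8 := hF1.mem 8 (by simp)
    have km9 := hF1.mem 9 (by simp)
    simp [h10] at k10 km8 km9
    have hFF : Frame 10 [8, 9] s s1 := by
      refine hF.trans (Frame.trans ?_ (hF1.mono (by omega) (by simp)))
      simp
    have k11' : s1.reg 11 = T.initVal x := by rw [k11, hc, initVal]
    have k11B : |T.initVal x| ≤ B := by
      rw [initVal]
      split_ifs <;> simp [h1B]
    have u8 := h8.update (z := T.initVal x) rfl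
    have u9 := h9.update (z := 0) rfl
    simp [k10, km8, km9, k11', k11B, hFF, u8, u9, hxB]
    omega
  · rintro t s' ht ⟨-, hF, -, h8, h9⟩
    exact ⟨by nlinarith, hF, tabSpec_zero hq h8, choiceSpec_zero h9⟩

/-- Merge the nodes into their parents, the last one first. -/
def progSweep : Prog :=
  forLoop 10 0 (
    assign 11 (reg 0 - (reg 10 + lit 1)) ;;
    assign 12 (load 2 (reg 11)) ;;
    assign 13 (load 0 (reg 12 + lit 1)) ;;
    assign 14 (load 0 (reg 12)) ;;
    ite (eq (reg 11) (lit 0)) (assign 14 (reg 0)) skip ;;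
    progPairs ;; progCopy)

theorem wp_progSweep {T : TreeGame} {B : ℕ} (hB : T.Fits B) {s : State} (hE : T.Env s) {b : ℤ}
    (hb : |b| ≤ B) (h9 : s.reg 9 = b) (hT : T.TabSpec b (s.mem 8) 0)
    (hC : T.ChoiceSpec b (s.mem 9) 0) :
    wp B progSweep s fun t s' =>
      t ≤ T.N * (T.K * T.K * (T.q * (50 * T.q + 150) + 100) + T.K * 30 + 70) + 10 ∧
      Frame 10 [8, 9] s s' ∧ T.TabSpec b (s'.mem 8) T.N ∧ T.ChoiceSpec b (s'.mem 9) T.N := by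
  have hq := hB.q
  have hK := K_pos hq
  have hN := hB.N_lt
  have hoN := hB.off
  have hsq := hB.sq
  refine wp_forLoop (fun d s' => d ≤ T.N ∧ Frame 10 [8, 9] s s' ∧ s'.reg 10 = d ∧
    T.TabSpec b (s'.mem 8) d ∧ T.ChoiceSpec b (s'.mem 9) d)
    T.N (T.K * T.K * (T.q * (50 * T.q + 150) + 100) + T.K * 30 + 60) (by omega) (by omega)
    ?_ ?_ ?_ ?_
  · simp [hT, hC]
  · rintro i s' ⟨-, hF, hi, -⟩
    exact ⟨hi, by rw [hF.reg 0 (by omega), hE.N]⟩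
  · rintro d hd s' ⟨-, hF, h10, hT, hC⟩
    have hE' := hE.mono hF (by omega) (by simp)
    have h9' := (hF.reg 9 (by omega)).trans h9
    obtain ⟨j, hj⟩ : ∃ j, j = T.N - 1 - d := ⟨_, rfl⟩
    have hjN : j < T.N := by omega
    have hdj : d = T.N - 1 - j := by omega
    have hcj : (T.N : ℤ) - (d + 1) = j := by omega
    have hoj := off_add_sz_lt hjN
    have hm2 : s'.mem 2 j = T.off j := hE'.off j hjN
    have hsz := hE'.inp.sz j hjN
    have hpar := hE'.inp.par j hjN
    have hpN := up_le (T := T) hjN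
    have hparlt : T.par j ≤ B := by
      rcases Nat.eq_zero_or_pos j with h | h
      · rw [h, hE.inp.par_zero]; omega
      · have := T.par_lt j hjN h; omega
    have hjB : j ≤ B := by omega
    have hoB : T.off j ≤ B := by omega
    have hszB : T.sz j ≤ B := by omega
    have hNB : T.N ≤ B := by omega
    have h1B : 1 ≤ B := by omega
    have ho1 : |(T.off j : ℤ) + 1| ≤ B := by rw [abs_le]; omega
    have hd1 : |(d : ℤ) + 1| ≤ B := by rw [abs_le]; omega
    have ho2 : ((T.off j : ℤ) + 1).toNat = T.off j + 1 := by omega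
    have ho3 : (0 : ℤ) ≤ (T.off j : ℤ) + 1 := by omega
    have hdB : d ≤ B := by omega
    rw [wp_seq, wp_assign]
    refine ⟨by simp [h10, hE'.N, hNB, hdB, h1B, hd1, hcj, hjB], ?_⟩
    rw [wp_seq, wp_assign]
    refine ⟨by simp [h10, hE'.N, hcj, hjB, hm2, hoB], ?_⟩
    rw [wp_seq, wp_assign]
    refine ⟨by simp [h10, hE'.N, hcj, hm2, hoB, h1B, ho1, ho2, ho3, hsz, hszB], ?_⟩
    rw [wp_seq, wp_assign]
    refine ⟨by simp [h10, hE'.N, hcj, hm2, hoB, hpar, hparlt], ?_⟩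
    simp only [eval_sub, eval_reg, eval_add, eval_lit, eval_load, State.reg_setReg,
      State.mem_setReg, h10, hE'.N, hcj]
    rw [wp_seq]
    -- The conditional replaces the root's stored parent, the root itself, by the extra node `N`;
    -- the intermediate assertion merges the two cases.
    refine wp_mono (Q := fun t s1 => t ≤ 10 ∧ Frame 11 [] s' s1 ∧ s1.reg 10 = d ∧ s1.reg 11 = j ∧
      s1.reg 13 = T.sz j ∧ s1.reg 14 = T.up j) ?_ ?_
    · rcases Nat.eq_zero_or_pos j with h0 | h0
      · have hup : T.up j = T.N := by simp [up, h0]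
        subst h0
        simp [hE'.N, hNB, h10, ho2, hm2, hsz, hup, h1B]
      · have hup : T.up j = T.par j := by simp [up, h0.ne']
        simp [hjB, h10, ho2, hm2, hsz, hpar, hup, h1B, h0.ne']
    rintro t1 s1 ⟨ht1, hF1, k10, k11, k13, k14⟩
    have hE1 := hE'.mono hF1 (by omega) (by simp)
    have k9 := (hF1.reg 9 (by omega)).trans h9'
    have km8 := hF1.mem 8 (by simp)
    have km9 := hF1.mem 9 (by simp)
    rw [wp_seq]
    refine wp_mono (wp_progPairs hB hE1 (j := j) (b := b) hjN hb k9 k11 k13 k14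
      (by rw [km8, ← hdj]; exact hT)
      (by rw [km9]; exact (hC j hjN).2 (by omega))) ?_
    rintro t2 s2 ⟨ht2, hF2, hrow, hoth⟩
    refine wp_mono (wp_progCopy hB (hE1.mono hF2 (by omega) (by simp)) (j := j) (p := T.up j)
      hjN.le hpN ((hF2.reg 11 (by omega)).trans k11) ((hF2.reg 14 (by omega)).trans k14) ?_) ?_
    · intro r hr
      obtain ⟨h1, h2⟩ := hrow.bounds hr
      rw [abs_le]
      omega
    rintro t3 s3 ⟨ht3, hF3, hcopy⟩
    have k10' : s3.reg 10 = d := by rw [hF3.reg 10 (by omega), hF2.reg 10 (by omega), k10]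
    have hFF : Frame 10 [8, 9] s s3 :=
      hF.trans ((hF1.mono (by omega) (by simp)).trans
        ((hF2.mono (by omega) (by simp)).trans (hF3.mono (by omega) (by simp))))
    have hm93 := hF3.mem 9 (by simp)
    have hm82 := (hF2.mem 8 (by simp)).trans km8
    rw [km9] at hoth
    rw [hm82] at hcopy
    rw [hdj] at hT hC
    have hT' := hT.succ hq hjN hrow hcopy
    have hC' := hC.succ hjN hrow hoth
    rw [← hdj] at hT' hC'
    simp [k10', hFF, hm93, hT', hC']
    omega
  · rintro t s' ht ⟨-, hF, -, hT, hC⟩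
    exact ⟨by nlinarith, hF, hT, hC⟩

end RAM

/-! ### Recovering a colouring from the choices -/

namespace TreeGame

variable {T : TreeGame} {b : ℤ} {g : ℕ → ℤ}

theorem n_pos (hW : 0 < T.W) : 0 < T.n := by
  by_contra h
  have h0 : T.n = 0 := by omega
  rw [W, h0] at hW
  simp at hW

/-- The row of the root starts at address `0` and describes the codes of the extra node after the
last step, so this one cell tells whether the threshold is attainable. -/
theorem ChoiceSpec.root_ne_zero_iff (hq : 0 < T.q) (hN : 0 < T.N) (hg : T.ChoiceSpec b g T.N) :
    g T.zeroCode ≠ 0 ↔ T.Feas b T.N T.N T.zeroCode := by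
  have h := ((hg 0 hN).1 (by omega)).feas_iff hq hN (zeroCode_lt hq)
  have e : T.N - 1 - 0 + 1 = T.N := by omega
  rwa [zero_mul, zero_add, e, up, if_pos rfl] at h

theorem ChoiceSpec.root_bounds (hq : 0 < T.q) (hN : 0 < T.N) (hg : T.ChoiceSpec b g T.N) :
    0 ≤ g T.zeroCode ∧ g T.zeroCode ≤ (T.K * T.K : ℕ) := by
  have h := ((hg 0 hN).1 (by omega)).bounds (zeroCode_lt hq)
  rwa [zero_mul, zero_add] at h

/-- The local states of the nodes before the node `j` and its predecessors are merged, following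
the choices in `g`. -/
def hist (T : TreeGame) (g : ℕ → ℤ) : ℕ → ℕ → ℕ
  | 0 => fun _ => T.zeroCode
  | j + 1 => Function.update
      (Function.update (hist T g j) (T.up j) (((g (j * T.K + hist T g j (T.up j))).toNat - 1) / T.K))
      j (((g (j * T.K + hist T g j (T.up j))).toNat - 1) % T.K)

/-- Top-down induction undoing one merge at a time: the attainable code of the parent has a nonzero
choice, whose pair consists of codes attainable one step earlier. The other nodes were not affected
by this step. -/
theorem hist_spec (hq : 0 < T.q) (hg : T.ChoiceSpec b g T.N) (h0 : T.Feas b T.N T.N T.zeroCode)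
    {j : ℕ} (hj : j ≤ T.N) : ∀ k, k < j ∨ k = T.N → T.Feas b (T.N - j) k (T.hist g j k) := by
  induction j with
  | zero => rintro k (h | rfl); · omega
            · exact h0
  | succ j ih =>
    intro k hk
    have ih := ih (by omega)
    have hup : T.up j < j ∨ T.up j = T.N := up_lt_or_eq (by omega)
    have hne : T.up j ≠ j := up_ne (by omega)
    have e : T.N - j = T.N - 1 - j + 1 := by omega
    have e' : T.N - (j + 1) = T.N - 1 - j := by omega
    have hr := ih _ hup
    have hrow := (hg j (by omega)).1 (by omega)
    have hlt : T.hist g j (T.up j) < T.K := hr.lt hq (by omega)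
    have hne0 := (hrow.feas_iff hq (by omega) hlt).mpr (e ▸ hr)
    rcases hrow _ hlt with h | ⟨x, -, hx, hp⟩
    · exact absurd h.1 hne0
    -- Choices are stored plus one, because `0` marks a code that is not attained.
    have hx' : (g (j * T.K + T.hist g j (T.up j))).toNat - 1 = x := by omega
    rw [hist, hx', e', Function.update_apply, Function.update_apply]
    split_ifs with h1 h2
    · rw [h1]; exact hp.2.1
    · rw [h2]; exact hp.1
    · have h3 := ih k (by omega)
      have e2 : T.N - 1 - (T.N - 1 - j) = j := by omega
      rwa [e, Feas, e2, if_neg h2] at h3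

theorem hist_step (hq : 0 < T.q) (hg : T.ChoiceSpec b g T.N)
    (h0 : T.Feas b T.N T.N T.zeroCode) {j : ℕ} (hj : j < T.N) :
    ∃ x, g (j * T.K + T.hist g j (T.up j)) = (x + 1 : ℕ) ∧ x < T.K * T.K ∧
      T.hist g (j + 1) (T.up j) = x / T.K ∧ T.hist g (j + 1) j = x % T.K ∧
      T.hist g j (T.up j) < T.K ∧
      T.Step b j (x / T.K) (x % T.K) (T.hist g j (T.up j)) := by
  have hup : T.up j < j ∨ T.up j = T.N := up_lt_or_eq (by omega)
  have hne : T.up j ≠ j := up_ne (by omega)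
  have e : T.N - j = T.N - 1 - j + 1 := by omega
  have hr := hist_spec hq hg h0 hj.le _ hup
  have hrow := (hg j (by omega)).1 (by omega)
  have hlt : T.hist g j (T.up j) < T.K := hr.lt hq (by omega)
  have hne0 := (hrow.feas_iff hq (by omega) hlt).mpr (e ▸ hr)
  rcases hrow _ hlt with h | ⟨x, hxK, hx, hp⟩
  · exact absurd h.1 hne0
  have hx' : (g (j * T.K + T.hist g j (T.up j))).toNat - 1 = x := by omega
  refine ⟨x, hx, hxK, ?_, ?_, hlt, hp.2.2⟩
  · rw [hist, hx', Function.update_apply, if_neg hne, Function.update_self]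
  · rw [hist, hx', Function.update_self]

theorem exists_coloring_of_choiceSpec (hq : 0 < T.q) (hg : T.ChoiceSpec b g T.N)
    (h0 : T.Feas b T.N T.N T.zeroCode) : ∃ χ : ℕ → ℕ, (∀ u < T.n, b ≤ T.util χ u) ∧
      ∀ j < T.N, ∀ i < T.sz j, T.col (T.hist g (j + 1) j) i = χ (T.vtx j i) := by
  refine exists_coloring hq (T.hist g) (fun j hj => ?_) (fun j hj k hk hne => ?_) (fun k hk => ?_)
  · obtain ⟨x, -, -, h1, h2, -, h3⟩ := hist_step hq hg h0 hj
    rwa [h1, h2]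
  · rw [hist, Function.update_apply, if_neg hk.ne, Function.update_apply, if_neg hne]
  · have := hist_spec hq hg h0 le_rfl k (.inl hk)
    rwa [Nat.sub_self] at this

/-- The entries of `f` for the local states that are known after the first `j` nodes. -/
def HistUpto (T : TreeGame) (g : ℕ → ℤ) (f : ℕ → ℤ) (j : ℕ) : Prop :=
  ∀ k, k < j ∨ k = T.N → f k = T.hist g j k

theorem HistUpto.succ {f : ℕ → ℤ} {j : ℕ} (h : T.HistUpto g f j) :
    T.HistUpto g (Function.update (Function.update f (T.up j) (T.hist g (j + 1) (T.up j))) j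
      (T.hist g (j + 1) j)) (j + 1) := by
  intro k hk
  rw [Function.update_apply, Function.update_apply]
  split_ifs with h1 h2
  · rw [h1]
  · rw [h2]
  · rw [h k (by omega), hist, Function.update_apply, if_neg h1, Function.update_apply, if_neg h2]

/-- The entries of `f` for the agents in the first `j` bags and the first `i` agents of the bag of
`j` are as in `χ`. -/
def LabelUpto (T : TreeGame) (χ : ℕ → ℕ) (f : ℕ → ℤ) (j i : ℕ) : Prop :=
  (∀ j' < j, ∀ i' < T.sz j', f (T.vtx j' i') = χ (T.vtx j' i')) ∧
    ∀ i' < i, f (T.vtx j i') = χ (T.vtx j i')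

theorem LabelUpto.zero (χ : ℕ → ℕ) (f : ℕ → ℤ) : T.LabelUpto χ f 0 0 :=
  ⟨fun _ h => absurd h (by omega), fun _ h => absurd h (by omega)⟩

theorem LabelUpto.succ_left {χ : ℕ → ℕ} {f : ℕ → ℤ} {j : ℕ} (h : T.LabelUpto χ f j (T.sz j)) :
    T.LabelUpto χ f (j + 1) 0 := by
  refine ⟨fun j' hj' => ?_, fun _ h => absurd h (by omega)⟩
  rcases Nat.lt_succ_iff_lt_or_eq.mp hj' with h' | rfl
  exacts [h.1 j' h', h.2]

theorem LabelUpto.update {χ : ℕ → ℕ} {f : ℕ → ℤ} {j i : ℕ} (h : T.LabelUpto χ f j i) :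
    T.LabelUpto χ (Function.update f (T.vtx j i) (χ (T.vtx j i))) j (i + 1) := by
  have key : ∀ u, (f u = χ u ∨ u = T.vtx j i) →
      Function.update f (T.vtx j i) (χ (T.vtx j i)) u = χ u := by
    intro u hu
    rw [Function.update_apply]
    split_ifs with h'
    · rw [h']
    · exact hu.resolve_right h'
  refine ⟨fun j' hj' i' hi' => key _ (.inl (h.1 j' hj' i' hi')), fun i' hi' => key _ ?_⟩
  rcases Nat.lt_succ_iff_lt_or_eq.mp hi' with h' | rfl
  exacts [.inl (h.2 i' h'), .inr rfl]

end TreeGame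

/-! ### Search for the best threshold and output of the labels -/

namespace RAM

open RAM.Expr RAM.Prog TreeGame

/-- Find the largest threshold that all agents can attain. -/
def progSearch : Prog :=
  assign 9 (reg 3 + lit 1) ;; store 9 (reg 6) (lit 0) ;;
  loop (eq (load 9 (reg 6)) (lit 0)) (assign 9 (reg 9 - lit 1) ;; progInit ;; progSweep)

/-- A bound for the running time of one round of `progSearch`. -/
def roundTime (T : TreeGame) : ℕ :=
  (T.N + 1) * T.K * (T.q * 30 + 50) +
    T.N * (T.K * T.K * (T.q * (50 * T.q + 150) + 100) + T.K * 30 + 70) + 30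

/-- Register 9 starts at `W + 1` and is lowered before each test, so round `i` has tested `W + 1 -
i`. The invariant keeps the failure of all larger thresholds up to `W`, which makes the first
success optimal. -/
theorem wp_progSearch {T : TreeGame} {B : ℕ} (hB : T.Fits B) {s : State} (hE : T.Env s)
    (hN : 0 < T.N) :
    wp B progSearch s fun t s' => t ≤ (2 * T.W + 1) * (roundTime T + 10) + 20 ∧
      Frame 9 [8, 9] s s' ∧ ∃ b : ℤ, T.ChoiceSpec b (s'.mem 9) T.N ∧
        T.Feas b T.N T.N T.zeroCode ∧
        ∀ χ : ℕ → ℕ, (∀ u < T.n, χ u < T.q) → ∃ u < T.n, T.util χ u ≤ b := by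
  have hq := hB.q
  have hWB := hB.two_W_le
  have hsq := hB.sq
  have hn := n_pos hB.W
  have hKB := hB.K_le
  have hz := zeroCode_lt hq
  have hzB : T.zeroCode ≤ B := by omega
  have h1B : 1 ≤ B := by omega
  have hWB' : T.W ≤ B := by omega
  have hW1B : |(T.W : ℤ) + 1| ≤ B := by
    have := hB.W
    rw [abs_le]; omega
  rw [progSearch, wp_seq, wp_assign]
  refine ⟨by simp [hE.W, hWB', hW1B, h1B], ?_⟩
  rw [wp_seq, wp_store]
  refine ⟨by simp [hE.zero, hzB], by simp [hE.zero], by simp, ?_⟩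
  simp only [eval_add, eval_reg, eval_lit, State.reg_setReg, hE.W, hE.zero, cost_add, cost_reg,
    cost_lit]
  norm_num only [hE.zero, ite_false, Int.toNat_natCast]
  refine wp_loop (fun i s' => i ≤ 2 * T.W + 1 ∧ Frame 9 [8, 9] s s' ∧
    s'.reg 9 = (T.W : ℤ) + 1 - i ∧ (i = 0 → s'.mem 9 T.zeroCode = 0) ∧
    (0 < i → T.ChoiceSpec ((T.W : ℤ) + 1 - i) (s'.mem 9) T.N) ∧
    ∀ b : ℤ, (T.W : ℤ) + 1 - i < b → b ≤ T.W → ¬ T.Feas b T.N T.N T.zeroCode)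
    (2 * T.W + 1) (roundTime T) ?_ ?_ ?_ ?_ ?_
  · refine ⟨Nat.zero_le _, by simp, by simp, by simp, fun h => absurd h (by omega), ?_⟩
    intro b h1 h2
    exfalso
    push_cast at h1
    omega
  · rintro i s' ⟨hi, hF, h9, h0, hC, -⟩
    have h6 := (hF.reg 6 (by omega)).trans hE.zero
    have hc : |s'.mem 9 T.zeroCode| ≤ B := by
      rcases Nat.eq_zero_or_pos i with h | h
      · simp [h0 h]
      · have := (hC h).root_bounds hq hN
        rw [abs_le]; omega
    simp [h6, hc, hzB, h1B]
  · rintro s' ⟨-, hF, -, -, hC, -⟩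
    have h6 := (hF.reg 6 (by omega)).trans hE.zero
    have hf : T.Feas ((T.W : ℤ) + 1 - (2 * T.W + 1 : ℕ)) T.N T.N T.zeroCode := by
      refine feas_of_util (χ := fun _ => 0) (fun _ _ => hq) hq fun u _ => ?_
      have := abs_le.mp (abs_util_le (T := T) (fun _ => 0) u)
      push_cast
      linarith [this.1]
    have := ((hC (by omega)).root_ne_zero_iff hq hN).mpr hf
    simp [h6, this]
  · rintro i hi s' ⟨-, hF, h9, h0, hC, hinf⟩ hg
    have h6 := (hF.reg 6 (by omega)).trans hE.zero
    simp [h6] at hg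
    have hE' := hE.mono hF (by omega) (by simp)
    have hb1 : |(T.W : ℤ) + 1 - i| ≤ B := by rw [abs_le]; omega
    have hb2 : |(T.W : ℤ) + 1 - i - 1| ≤ B := by rw [abs_le]; omega
    have hb : (T.W : ℤ) + 1 - i - 1 = (T.W : ℤ) + 1 - (i + 1 : ℕ) := by push_cast; ring
    rw [wp_seq, wp_assign]
    refine ⟨by simp [h9, hb1, hb2, h1B], ?_⟩
    rw [wp_seq]
    have hF0 : Frame 9 [] s' (s'.setReg 9 (eval s' (reg 9 - lit 1))) := by simp
    refine wp_mono (wp_progInit hB (hE'.mono hF0 (by omega) (by simp))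
      ((T.W : ℤ) + 1 - (i + 1 : ℕ))) ?_
    rintro t1 s1 ⟨ht1, hF1, hT1, hC1⟩
    have k9 := hF1.reg 9 (by omega)
    simp only [State.reg_setReg, eval_sub, eval_reg, h9, eval_lit, if_pos, hb] at k9
    have hF1' : Frame 9 [8, 9] s s1 :=
      hF.trans ((hF0.mono le_rfl (by simp)).trans (hF1.mono (by omega) (by simp)))
    refine wp_mono (wp_progSweep hB (hE.mono hF1' (by omega) (by simp)) (hb ▸ hb2) k9 hT1 hC1) ?_
    rintro t2 s2 ⟨ht2, hF2, -, hC2⟩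
    refine ⟨?_, hi, hF1'.trans (hF2.mono (by omega) (by simp)),
      (hF2.reg 9 (by omega)).trans k9, by simp, fun _ => hC2, fun b' h1 h2 => ?_⟩
    · simp [roundTime]
      omega
    · rcases eq_or_lt_of_le (show (T.W : ℤ) + 1 - i ≤ b' by push_cast at h1; omega) with h | h
      · have hi0 : 0 < i := by omega
        rw [← h, ← (hC hi0).root_ne_zero_iff hq hN]
        exact fun h => h hg
      · exact hinf b' h h2
  · rintro t i s' ht ⟨-, hF, -, h0, hC, hinf⟩ hg
    have h6 := (hF.reg 6 (by omega)).trans hE.zero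
    simp [h6] at hg
    have hi : 0 < i := by
      by_contra h
      exact hg (h0 (by omega))
    refine ⟨?_, hF, _, hC hi, ((hC hi).root_ne_zero_iff hq hN).mp hg, fun χ hχ => ?_⟩
    · simp at ht
      nlinarith
    · by_contra! hcon
      -- A colouring with all utilities above the found threshold would attain the next integer,
      -- which is at most `W` by the bound for agent `0` and has therefore been refuted.
      obtain ⟨b', hb'⟩ : ∃ b' : ℤ, b' = (T.W : ℤ) + 1 - i + 1 := ⟨_, rfl⟩
      have h1 := hcon 0 hn
      have h2 := abs_le.mp (abs_util_le (T := T) χ 0)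
      refine hinf b' (by omega) (by omega) (feas_of_util hχ hq fun u hu => ?_)
      have := hcon u hu
      omega

/-- Follow the choices from the root and write the colours of the agents. -/
def progTrace : Prog :=
  store 10 (reg 0) (reg 6) ;;
  forLoop 10 0 (
    assign 11 (load 2 (reg 10)) ;;
    assign 12 (load 0 (reg 11)) ;;
    ite (eq (reg 10) (lit 0)) (assign 12 (reg 0)) skip ;;
    assign 13 (load 9 (reg 10 * reg 5 + load 10 (reg 12)) - lit 1) ;;
    store 10 (reg 12) (reg 13 / reg 5) ;;
    assign 13 (reg 13 % reg 5) ;;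
    store 10 (reg 10) (reg 13) ;;
    assign 14 (load 0 (reg 11 + lit 1)) ;;
    forLoop 15 14 (
      store 1 (load 0 (reg 11 + lit 2 + reg 15))
        (((reg 13 / load 4 (reg 15)) % reg 4) % reg 2)))

/-- Going through the nodes in order, the code of the parent after the merge is known and its choice
gives the codes of parent and child before. An agent is labelled once per bag containing it, always
with the same colour. -/
theorem wp_progTrace {T : TreeGame} {B : ℕ} (hB : T.Fits B) {s : State} (hE : T.Env s) {b : ℤ}
    (hC : T.ChoiceSpec b (s.mem 9) T.N) (hf : T.Feas b T.N T.N T.zeroCode) :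
    wp B progTrace s fun t s' => t ≤ T.N * (T.q * 40 + 100) + 20 ∧
      ∃ χ : ℕ → ℕ, (∀ u < T.n, s'.mem 1 u = χ u) ∧ ∀ u < T.n, b ≤ T.util χ u := by
  have hq := hB.q
  have hN := hB.N_lt
  have hKB := hB.K_le
  have hRB := hB.R_le
  have hqB := hB.q_le
  have hoN := hB.off
  have hnB := hB.n
  have hsq := hB.sq
  have hz := zeroCode_lt hq
  have hzB : T.zeroCode ≤ B := by omega
  have hNB : T.N ≤ B := by omega
  have h1B : 1 ≤ B := by omega
  obtain ⟨g, hg⟩ : ∃ g, g = s.mem 9 := ⟨_, rfl⟩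
  rw [← hg] at hC
  obtain ⟨χ, hχ, hcol⟩ := exists_coloring_of_choiceSpec hq hC hf
  rw [progTrace, wp_seq, wp_store]
  refine ⟨by simp [hE.N, hNB], by simp [hE.N], by simp [hE.zero, hzB], ?_⟩
  simp only [eval_reg, hE.N, hE.zero, cost_reg, Int.toNat_natCast]
  refine wp_forLoop (fun j s' => j ≤ T.N ∧ Frame 10 [1, 10] s s' ∧ s'.reg 10 = j ∧
    T.HistUpto g (s'.mem 10) j ∧ T.LabelUpto χ (s'.mem 1) j 0)
    T.N (T.q * 40 + 90) (by omega) (by omega) ?_ ?_ ?_ ?_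
  · refine ⟨Nat.zero_le _, by simp, by simp, ?_, .zero _ _⟩
    rintro k (h | rfl)
    · omega
    · simp [hist]
  · rintro i s' ⟨-, hF, hi, -⟩
    exact ⟨hi, by rw [hF.reg 0 (by omega), hE.N]⟩
  · rintro j hj s' ⟨-, hF, h10, hH, hL⟩
    have hE' := hE.mono hF (by omega) (by simp)
    have hm9 : s'.mem 9 = g := (hF.mem 9 (by simp)).trans hg.symm
    have hoj := off_add_sz_lt hj
    have hm2 : s'.mem 2 j = T.off j := hE'.off j hj
    have hsz := hE'.inp.sz j hj
    have hpar := hE'.inp.par j hj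
    have hpN := up_le (T := T) hj
    have hparlt : T.par j ≤ B := by
      rcases Nat.eq_zero_or_pos j with h | h
      · rw [h, hE.inp.par_zero]; omega
      · have := T.par_lt j hj h; omega
    have hjB : j ≤ B := by omega
    have hoB : T.off j ≤ B := by omega
    have hszB : T.sz j ≤ B := by omega
    have ho1 : |(T.off j : ℤ) + 1| ≤ B := by rw [abs_le]; omega
    have ho2 : ((T.off j : ℤ) + 1).toNat = T.off j + 1 := by omega
    have ho3 : (0 : ℤ) ≤ (T.off j : ℤ) + 1 := by omega
    obtain ⟨x, hx, hxK, hh1, hh2, hrK, -⟩ := hist_step hq hC hf hj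
    obtain ⟨f1, f2, f3, f4⟩ := hB.tab_fits hj.le hrK
    have hHp := hH _ (up_lt_or_eq hj)
    have hsucc := hH.succ
    have hcol := hcol j hj
    rw [hh2] at hcol
    rw [hh1, hh2] at hsucc
    generalize T.hist g j (T.up j) = r at *
    rw [wp_seq, wp_assign]
    refine ⟨by simp [h10, hjB, hm2, hoB], ?_⟩
    rw [wp_seq, wp_assign]
    refine ⟨by simp [h10, hm2, hoB, hpar, hparlt], ?_⟩
    simp only [eval_reg, eval_load, State.reg_setReg, State.mem_setReg, h10, Int.toNat_natCast,
      hm2, if_true, hpar]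
    rw [wp_seq]
    refine wp_mono (Q := fun t s1 => t ≤ 10 ∧ Frame 11 [] s' s1 ∧ s1.reg 10 = j ∧
      s1.reg 11 = T.off j ∧ s1.reg 12 = T.up j) ?_ ?_
    · rcases Nat.eq_zero_or_pos j with h0 | h0
      · have hup : T.up j = T.N := by simp [up, h0]
        subst h0
        simp [hE'.N, hNB, h10, hup, h1B]
      · have hup : T.up j = T.par j := by simp [up, h0.ne']
        simp [hjB, h10, hup, h1B, h0.ne']
    rintro t1 s1 ⟨ht1, hF1, k10, k11, k12⟩
    have hE1 := hE'.mono hF1 (by omega) (by simp)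
    have km9 := (hF1.mem 9 (by simp)).trans hm9
    have km10 := hF1.mem 10 (by simp)
    have km1 := hF1.mem 1 (by simp)
    have hupB : T.up j ≤ B := by omega
    have hrB : r ≤ B := by omega
    have hxB : |(x : ℤ) + 1| ≤ B := by rw [abs_le]; omega
    have hxB' : x ≤ B := by omega
    rw [wp_seq, wp_assign]
    refine ⟨by simp [k10, k12, hE1.K, km9, km10, hHp, hx, f1, f2, f3, f4, hjB, hKB, hupB, hrB, hxB,
      hxB', h1B, -abs_mul], ?_⟩
    have hq1 : (x : ℤ) / T.K = (x / T.K : ℕ) := by push_cast; rfl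
    have hq2 : (x : ℤ) % T.K = (x % T.K : ℕ) := by push_cast; rfl
    have hdK : x / T.K ≤ x := Nat.div_le_self _ _
    have hmK : x % T.K < T.K := Nat.mod_lt _ (K_pos hq)
    have hdB : x / T.K ≤ B := by omega
    have hmB : x % T.K ≤ B := by omega
    obtain ⟨y, hy⟩ : ∃ y, y = x / T.K := ⟨_, rfl⟩
    obtain ⟨c, hc⟩ : ∃ c, c = x % T.K := ⟨_, rfl⟩
    rw [← hy] at hq1 hdK hdB hsucc
    rw [← hc] at hq2 hmK hmB hcol hsucc
    have hr13 : eval s1 (load 9 (reg 10 * reg 5 + load 10 (reg 12)) - lit 1) = x := by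
      simp [k10, k12, hE1.K, km9, km10, hHp, hx, f1]
    rw [hr13, wp_seq, wp_store]
    refine ⟨by simp [k12, hupB], by simp [k12], by simp [hE1.K, hxB', hKB, hq1, hdB], ?_⟩
    rw [wp_seq, wp_assign]
    refine ⟨by simp [hE1.K, hxB', hKB, hq2, hmB], ?_⟩
    rw [wp_seq, wp_store]
    refine ⟨by simp [k10, hjB], by simp [k10], by simp [hE1.K, hq2, hmB], ?_⟩
    rw [wp_seq, wp_assign]
    have ki := hE1.inp.sz j hj
    refine ⟨by simp [k11, hoB, h1B, ho1, ho2, ho3, ki, hszB], ?_⟩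
    simp only [eval_reg, eval_load, eval_div, eval_mod, eval_add, eval_lit, State.reg_setReg,
      State.mem_setReg, State.reg_setMem, k12, k10, k11, hE1.K, hq1, hq2, ho2, State.mem_setMem,
      Int.toNat_natCast, if_true, if_false, Nat.reduceEqDiff, OfNat.zero_ne_ofNat, ki]
    set s2 := ((((s1.setReg 13 x).setMem 10 (T.up j) y).setReg 13 c).setMem 10 j c).setReg 14
      (T.sz j : ℤ) with hs2
    have hF2 : Frame 10 [1, 10] s s2 := by
      have := hF.trans (hF1.mono (by omega) (by simp))
      simpa [hs2] using this
    have hE2 := hE.mono hF2 (by omega) (by simp)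
    have hH2 : T.HistUpto g (s2.mem 10) (j + 1) := by
      simpa [hs2, km10] using hsucc
    have hL2 : T.LabelUpto χ (s2.mem 1) j 0 := by
      simpa [hs2, km1] using hL
    have l10 : s2.reg 10 = j := by simp [hs2, k10]
    have l11 : s2.reg 11 = T.off j := by simp [hs2, k11]
    have l13 : s2.reg 13 = c := by simp [hs2]
    have l14 : s2.reg 14 = T.sz j := by simp [hs2]
    have hszq := sz_le_q (T := T) j
    refine wp_forLoop (fun i s3 => i ≤ T.sz j ∧ Frame 15 [1] s2 s3 ∧ s3.reg 15 = i ∧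
      T.LabelUpto χ (s3.mem 1) j i) (T.sz j) 30 (by omega) (by omega) ?_ ?_ ?_ ?_
    · simp [hL2]
    · rintro i s3 ⟨-, hF3, hi, -⟩
      exact ⟨hi, by rw [hF3.reg 14 (by omega), l14]⟩
    · rintro i hi s3 ⟨-, hF3, h15, hL3⟩
      have hE3 := hE2.mono hF3 (by omega) (by simp)
      have n11 := (hF3.reg 11 (by omega)).trans l11
      have n13 := (hF3.reg 13 (by omega)).trans l13
      have hp0 := pow_fits hB (hi.trans_le hszq).le
      have hq0 := div_pow_fits hB hmK i
      have hm4 : s3.mem 4 i = (T.R : ℤ) ^ i := hE3.pow i (hi.trans_le hszq)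
      have hd1 := digit_lt_B hB c i
      have hdig := cast_digit (T := T) c i
      have hcc := cast_col (T := T) c i
      have hcB : T.col c i ≤ B := (col_lt hq c i).le.trans hqB
      have hvx := hE3.inp.vtx j hj i hi
      have hvB : T.vtx j i ≤ B := (T.vtx_lt j hj i hi).le.trans hnB
      have o1 : |(T.off j : ℤ) + 2| ≤ B := by rw [abs_le]; omega
      have o2 : |(T.off j : ℤ) + 2 + i| ≤ B := by rw [abs_le]; omega
      have o3 : ((T.off j : ℤ) + 2 + i).toNat = T.off j + 2 + i := by omega
      have o4 : (0 : ℤ) ≤ (T.off j : ℤ) + 2 + i := by omega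
      have hiB : i ≤ B := by omega
      have h2B : 2 ≤ B := by omega
      have hci := hcol i hi
      have hup := hL3.update
      rw [hci] at hcB
      simp [n11, n13, h15, hE3.R, hE3.q, hm4, hp0, hq0, hd1, hdig, hcc, hcB, hvx, hvB, o1, o2, o3,
        o4, hoB, hiB, h2B, hRB, hqB, hmB, hci, hF3, hup, -abs_pow]
      omega
    · rintro t3 s3 ht3 ⟨-, hF3, -, hL3⟩
      have n10 := (hF3.reg 10 (by omega)).trans l10
      have nm10 := hF3.mem 10 (by simp)
      have hFF := hF2.trans (hF3.mono (by omega) (by simp))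
      have hL4 := hL3.succ_left
      simp [n10, nm10, hFF, hL4, hH2]
      omega
  · rintro t s' ht ⟨-, hF, -, -, hL⟩
    refine ⟨by simp; nlinarith, χ, fun u hu => ?_, hχ⟩
    obtain ⟨j, hj, i, hi, rfl⟩ := T.exists_mem u hu
    exact hL.1 j hj i hi

end RAM

namespace TreeGame

variable {T : TreeGame}

theorem N_pos (hq : 0 < T.q) : 0 < T.N := by
  by_contra h
  have h0 : T.N = 0 := by omega
  rw [q, h0] at hq
  simp at hq

end TreeGame

/-! ### The complete program -/

namespace RAM

open RAM.Expr RAM.Prog TreeGame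

/-- The dynamic program for games with at least one arc. -/
def progDP : Prog :=
  progNodes ;; progArcs ;; progPow ;; progPos ;; progCharge ;; progSearch ;; progTrace

/-- A bound for the running time of `progDP`. -/
def timeDP (T : TreeGame) : ℕ :=
  (40 * T.N + 20) + (60 * T.m + 20) + (40 * T.q + 60) +
    (T.N * (T.q * (30 * T.q + 60) + 60) + 10) + (T.m * (40 * T.q + 90) + 10) +
    ((2 * T.W + 1) * (roundTime T + 10) + 20) + (T.N * (T.q * 40 + 100) + 20)

/-- Optimality is asserted only against colourings with fewer than `q` as largest colour;
`exists_util_eq` later extends it to all partitions. -/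
theorem wp_progDP {T : TreeGame} {B : ℕ} (hB : T.Fits B) {s : State} (hI : T.IsInput (s.mem 0))
    (h0 : s.reg 0 = T.N) (h1 : s.reg 1 = T.m) (hm : ∀ a, a ≠ 0 → s.mem a = fun _ => 0) :
    wp B progDP s fun t s' => t ≤ timeDP T ∧
      ∃ χ : ℕ → ℕ, (∀ u < T.n, s'.mem 1 u = χ u) ∧
        ∀ χ' : ℕ → ℕ, (∀ u < T.n, χ' u < T.q) →
          ∃ u < T.n, ∀ v < T.n, T.util χ' u ≤ T.util χ v := by
  rw [progDP, wp_seq]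
  refine wp_mono (wp_progNodes hB hI h0 h1) ?_
  rintro t1 s1 ⟨ht1, hF1, k2, km2⟩
  rw [wp_seq]
  refine wp_mono (wp_progArcs hB (by rwa [hF1.mem 0 (by simp)])
    ((hF1.reg 1 (by omega)).trans h1) ((hF1.mem 3 (by simp)).trans (hm 3 (by omega)))) ?_
  rintro t2 s2 ⟨ht2, hF2, k3⟩
  have G2 : Frame 2 [2, 3] s s2 :=
    (hF1.mono le_rfl (by simp)).trans (hF2.mono (by omega) (by simp))
  have k2 := (hF2.reg 2 (by omega)).trans k2
  have e2 := hF2.mem 2 (by simp)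
  rw [← e2] at km2
  rw [wp_seq]
  refine wp_mono (wp_progPow hB ((G2.reg 0 (by omega)).trans h0) k2 k3) ?_
  rintro t3 s3 ⟨ht3, hF3, k4, k5, k6, k7, k8, km4⟩
  have G3 : Frame 2 [2, 3, 4] s s3 :=
    (G2.mono le_rfl (by simp)).trans (hF3.mono (by omega) (by simp))
  have k2 := (hF3.reg 2 (by omega)).trans k2
  have k3 := (hF3.reg 3 (by omega)).trans k3
  have e2 := hF3.mem 2 (by simp)
  rw [← e2] at km2
  have hI3 : T.IsInput (s3.mem 0) := by rwa [G3.mem 0 (by simp)]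
  rw [wp_seq]
  refine wp_mono (wp_progPos hB hI3 ((G3.reg 0 (by omega)).trans h0) k2 km2) ?_
  rintro t4 s4 ⟨ht4, hF4, km5, km6⟩
  have G4 : Frame 2 [2, 3, 4, 5, 6] s s4 :=
    (G3.mono le_rfl (by simp)).trans (hF4.mono (by omega) (by simp))
  have e2 := hF4.mem 2 (by simp)
  have e4 := hF4.mem 4 (by simp)
  rw [← e2] at km2
  rw [← e4] at km4
  have hI4 : T.IsInput (s4.mem 0) := by rwa [G4.mem 0 (by simp)]
  rw [wp_seq]
  refine wp_mono (wp_progCharge hB hI4 ((G4.reg 1 (by omega)).trans h1)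
    ((hF4.reg 2 (by omega)).trans k2) km2 km6 ((G4.mem 7 (by simp)).trans (hm 7 (by omega)))) ?_
  rintro t5 s5 ⟨ht5, hF5, km7⟩
  have G5 : Frame 2 [2, 3, 4, 5, 6, 7] s s5 :=
    (G4.mono le_rfl (by simp)).trans (hF5.mono (by omega) (by simp))
  have e2 := hF5.mem 2 (by simp)
  have e4 := hF5.mem 4 (by simp)
  have e5 := hF5.mem 5 (by simp)
  rw [← e2] at km2
  rw [← e4] at km4
  rw [← e5] at km5
  have hr : ∀ x < 10, s5.reg x = s3.reg x := fun x hx =>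
    (hF5.reg x hx).trans (hF4.reg x hx)
  have hE : T.Env s5 :=
    { inp := by rwa [G5.mem 0 (by simp)]
      N := (G5.reg 0 (by omega)).trans h0
      q := (hr 2 (by omega)).trans k2
      W := (hr 3 (by omega)).trans k3
      R := (hr 4 (by omega)).trans k4
      K := (hr 5 (by omega)).trans k5
      zero := (hr 6 (by omega)).trans k6
      sq := (hr 7 (by omega)).trans k7
      tab := (hr 8 (by omega)).trans k8
      off := km2
      pow := km4
      pos := km5
      charge := km7 }
  rw [wp_seq]
  refine wp_mono (wp_progSearch hB hE (N_pos hB.q)) ?_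
  rintro t6 s6 ⟨ht6, hF6, b, hC, hf, hopt⟩
  refine wp_mono (wp_progTrace hB (hE.mono hF6 (by omega) (by simp)) hC hf) ?_
  rintro t7 s7 ⟨ht7, χ, hχ, hb⟩
  refine ⟨by rw [timeDP]; omega, χ, hχ, fun χ' hχ' => ?_⟩
  obtain ⟨u, hu, hle⟩ := hopt χ' hχ'
  exact ⟨u, hu, fun v hv => hle.trans (hb v hv)⟩

/-- The program for Max Egalitarian. If there are no arcs, then all agents keep the label `0`. -/
def progMain : Prog :=
  assign 1 (load 0 (lit 1)) ;; assign 0 (load 0 (lit 2)) ;; ite (reg 1) progDP skip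

/-- Without arcs `W` is `0` and `Fits` fails, so it is demanded only when the dynamic program is
entered. -/
theorem wp_progMain {T : TreeGame} {B : ℕ} (hB : T.m ≠ 0 → T.Fits B)
    (h3 : 3 + 3 * T.m + 2 * T.N ≤ B)
    {inp : List ℤ} (hI : T.IsInput fun i => inp.getD i 0) :
    wp B progMain (init inp) fun t s' => t ≤ (if T.m = 0 then 0 else timeDP T) + 10 ∧
      ∃ χ : ℕ → ℕ, (∀ u < T.n, s'.mem 1 u = χ u) ∧
        (T.m ≠ 0 → ∀ χ' : ℕ → ℕ, (∀ u < T.n, χ' u < T.q) →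
          ∃ u < T.n, ∀ v < T.n, T.util χ' u ≤ T.util χ v) := by
  have h1 : (init inp).mem 0 1 = T.m := hI.arcs
  have h2 : (init inp).mem 0 2 = T.N := hI.nodes
  have hm : ∀ a, a ≠ 0 → (init inp).mem a = fun _ => 0 := fun a ha => by
    simp [init, ha]
  have hI' : T.IsInput ((init inp).mem 0) := by
    simpa [init] using hI
  have hr : T.m ≤ B := by omega
  have hr' : T.N ≤ B := by omega
  have h1B : 1 ≤ B := by omega
  have h2B : 2 ≤ B := by omega
  rw [progMain, wp_seq, wp_assign]
  refine ⟨by simp [h1, hr, h1B], ?_⟩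
  rw [wp_seq, wp_assign]
  refine ⟨by simp [h2, hr', h2B], ?_⟩
  rw [wp_ite]
  refine ⟨by simp [h1, hr], fun hne => ?_, fun h0 => ?_⟩
  · simp [h1] at hne
    refine wp_mono (wp_progDP (hB hne) (by simpa using hI') (by simp [h2]) (by simp [h1])
      fun a ha => by simpa using hm a ha) ?_
    rintro t s' ⟨ht, χ, hχ, hopt⟩
    refine ⟨?_, χ, hχ, fun _ => hopt⟩
    simp [hne]
    omega
  · simp [h1] at h0
    rw [wp_skip]
    refine ⟨by simp, fun _ => 0, fun u _ => ?_, fun h => absurd h0 h⟩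
    simp [hm 1 (by omega)]

end RAM

/-- Extend a colouring from `A` to `A ∪ C`. -/
theorem exists_coloring_union {q : ℕ} (f χ : ℕ → ℕ) (hχ : ∀ u, χ u < q) (A C : Finset ℕ)
    (hA : ∀ u ∈ A, ∀ v ∈ A, (χ u = χ v ↔ f u = f v)) (hq : (A ∪ C).card ≤ q) :
    ∃ χ' : ℕ → ℕ, (∀ u, χ' u < q) ∧ (∀ u, u ∈ A ∨ u ∉ C → χ' u = χ u) ∧
      ∀ u ∈ A ∪ C, ∀ v ∈ A ∪ C, (χ' u = χ' v ↔ f u = f v) := by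
  induction C using Finset.induction_on with
  | empty => exact ⟨χ, hχ, fun _ _ => rfl, by simpa using hA⟩
  | insert u C hu ih =>
    obtain ⟨χ', h1, h2, h3⟩ := ih ((card_le_card (by gcongr; exact subset_insert _ _)).trans hq)
    by_cases huA : u ∈ A ∪ C
    · have e : A ∪ insert u C = A ∪ C := by rw [union_insert, insert_eq_of_mem huA]
      refine ⟨χ', h1, fun v hv => h2 v ?_, by rwa [e]⟩
      simp only [mem_insert, not_or] at hv
      tauto
    · rw [union_insert] at hq ⊢
      rw [card_insert_of_notMem huA] at hq
      obtain ⟨x, hx, hxv⟩ : ∃ x < q, ∀ v ∈ A ∪ C, (x = χ' v ↔ f u = f v) := by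
        by_cases hex : ∃ v ∈ A ∪ C, f u = f v
        · obtain ⟨v, hv, huv⟩ := hex
          refine ⟨χ' v, h1 v, fun v' hv' => ?_⟩
          rw [h3 v hv v' hv', huv]
        -- The agent `u` is new and has a new value of `f`, and fewer than `q` agents are present,
        -- so some colour is unused.
        · have hlt : ((A ∪ C).image χ').card < (range q).card := by
            rw [card_range]
            exact card_image_le.trans_lt hq
          obtain ⟨x, hx, hx'⟩ := exists_mem_notMem_of_card_lt_card hlt
          refine ⟨x, mem_range.mp hx, fun v hv => iff_of_false ?_ fun h => hex ⟨v, hv, h⟩⟩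
          rintro rfl
          exact hx' (mem_image_of_mem _ hv)
      have hne : ∀ v ∈ A ∪ C, v ≠ u := fun v hv h => huA (h ▸ hv)
      refine ⟨Function.update χ' u x, fun v => ?_, fun v hv => ?_, ?_⟩
      · rw [Function.update_apply]
        split_ifs
        exacts [hx, h1 v]
      · have hvu : v ≠ u := by
          rintro rfl
          simp at hv huA
          tauto
        rw [Function.update_of_ne hvu, h2 v]
        simp only [mem_insert, not_or] at hv
        tauto
      · intro v hv v' hv'
        rw [mem_insert] at hv hv'
        rcases hv with rfl | hv <;> rcases hv' with rfl | hv'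
        · simp
        · rw [Function.update_self, Function.update_of_ne (hne v' hv'), hxv v' hv']
        · rw [Function.update_self, Function.update_of_ne (hne v hv), eq_comm, hxv v hv, eq_comm]
        · rw [Function.update_of_ne (hne v hv), Function.update_of_ne (hne v' hv'), h3 v hv v' hv']

/-! ### As many colours as the largest bag has agents suffice -/

namespace TreeGame

variable {T : TreeGame}

/-- For each colouring there is one with at most as many colours as the largest bag has members
that identifies the same agents of each bag. -/
theorem exists_coloring_lt_q (hq : 0 < T.q) (f : ℕ → ℕ) :
    ∃ χ : ℕ → ℕ, (∀ u, χ u < T.q) ∧ ∀ j u v, T.Mem u j → T.Mem v j → (χ u = χ v ↔ f u = f v) := by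
  classical
  have key : ∀ J ≤ T.N, ∃ χ : ℕ → ℕ, (∀ u, χ u < T.q) ∧
      ∀ j < J, ∀ u v, T.Mem u j → T.Mem v j → (χ u = χ v ↔ f u = f v) := by
    intro J
    induction J with
    | zero => exact fun _ => ⟨fun _ => 0, fun _ => hq, fun j hj => by omega⟩
    | succ J ih =>
      intro hJ
      obtain ⟨χ, h1, h2⟩ := ih (by omega)
      obtain ⟨C, hC⟩ : ∃ C : Finset ℕ, C = (range (T.sz J)).image (T.vtx J) := ⟨_, rfl⟩
      have hmC : ∀ u, u ∈ C ↔ T.Mem u J := by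
        intro u
        rw [hC]
        simp [Mem]
      obtain ⟨A, hA⟩ : ∃ A : Finset ℕ, A = C.filter fun u => ∃ j < J, T.Mem u j := ⟨_, rfl⟩
      have hmA : ∀ u, u ∈ A ↔ T.Mem u J ∧ ∃ j < J, T.Mem u j := by
        intro u
        rw [hA, mem_filter, hmC]
      have hAC : A ∪ C = C := union_eq_right.mpr (by rw [hA]; exact filter_subset _ _)
      have hcard : (A ∪ C).card ≤ T.q := by
        rw [hAC, hC]
        exact card_image_le.trans (by simpa using sz_le_q J)
      -- The agents of the bag that are already coloured lie together in the bag of the parent, so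
      -- by induction `χ` separates them as `f` does.
      have hpar : ∀ u ∈ A, T.Mem u (T.par J) := by
        intro u hu
        obtain ⟨hJu, j, hj, hju⟩ := (hmA u).mp hu
        exact T.mem_par u J j hj (by omega) hju hJu
      obtain ⟨χ', g1, g2, g3⟩ := exists_coloring_union f χ h1 A C
        (fun u hu v hv => by
          obtain ⟨-, j, hj, -⟩ := (hmA u).mp hu
          exact h2 _ (T.par_lt J (by omega) (by omega)) u v (hpar u hu) (hpar v hv)) hcard
      rw [hAC] at g3
      refine ⟨χ', g1, fun j hj u v hu hv => ?_⟩
      rcases Nat.lt_succ_iff_lt_or_eq.mp hj with h | rfl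
      · have hold : ∀ u, T.Mem u j → χ' u = χ u := by
          intro u hu
          refine g2 u ?_
          rw [hmA, hmC]
          by_cases huJ : T.Mem u J
          exacts [.inl ⟨huJ, j, h, hu⟩, .inr huJ]
        rw [hold u hu, hold v hv]
        exact h2 j h u v hu hv
      · exact g3 u ((hmC u).mpr hu) v ((hmC v).mpr hv)
  obtain ⟨χ, h1, h2⟩ := key T.N le_rfl
  exact ⟨χ, h1, fun j u v hu hv => h2 j hu.lt u v hu hv⟩

/-- Every colouring is as good as one with at most as many colours as the largest bag has
members. -/
theorem exists_util_eq (hq : 0 < T.q) (f : ℕ → ℕ) :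
    ∃ χ : ℕ → ℕ, (∀ u, χ u < T.q) ∧ ∀ u, T.util χ u = T.util f u := by
  obtain ⟨χ, h1, h2⟩ := exists_coloring_lt_q hq f
  refine ⟨χ, h1, fun u => sum_congr rfl fun v _ => ?_⟩
  by_cases hw : T.w u v = 0
  · simp [hw]
  · obtain ⟨j, -, hu, hv⟩ := T.exists_mem_mem u v hw
    simp only [h2 j v u hv hu]

end TreeGame

/-! ## Reading the input -/

/-- Random access into consecutive blocks of varying length: `a k` is the address of block `k`,
after the prefix `pre`. -/
theorem List.getD_flatMap_append {α β : Type*} (f : α → List β) (d : β) (suf : List β)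
    (l : List α) (pre : List β) (a : ℕ → ℕ) (h0 : a 0 = pre.length)
    (hs : ∀ k (hk : k < l.length), a (k + 1) = a k + (f l[k]).length)
    (k : ℕ) (hk : k < l.length) (i : ℕ) (hi : i < (f l[k]).length) :
    (pre ++ (l.flatMap f ++ suf)).getD (a k + i) d = (f l[k])[i] := by
  induction l generalizing pre a k with
  | nil => simp at hk
  | cons x l ih =>
    cases k with
    | zero =>
      simp only [List.getElem_cons_zero] at hi ⊢
      rw [h0, List.getD_append_right _ _ _ _ (by omega), Nat.add_sub_cancel_left,
        List.flatMap_cons, List.append_assoc, List.getD_append _ _ _ _ hi,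
        List.getD_eq_getElem _ _ hi]
    | succ k =>
      simp only [List.getElem_cons_succ] at hi ⊢
      have h1 := hs 0 (by simp)
      have := ih (pre ++ f x) (fun k => a (k + 1)) (by simpa [h0] using h1)
        (fun k hk => hs (k + 1) (by simpa using hk)) k (by simpa using hk) hi
      rw [← this, List.flatMap_cons]
      simp [List.append_assoc]

namespace TreeDecomposition

variable {V : Type} [DecidableEq V] {G : SimpleGraph V} {N : ℕ} (D : TreeDecomposition G (Fin N))

/-- If the nodes are listed with parents first, then the bag of the parent of `j` contains the
common members of the bag of `j` and of an earlier bag. -/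
theorem mem_bag_parent (node : Fin N ≃ Fin N) (parent : Fin N → Fin N)
    (hpar : ∀ k, k.val ≠ 0 → parent k < k ∧ D.tree.Adj (node (parent k)) (node k))
    {j k : Fin N} (hkj : k < j) {u : V} (hk : u ∈ D.bag (node k)) (hj : u ∈ D.bag (node j)) :
    u ∈ D.bag (node (parent j)) := by
  have hN : 0 < N := (Nat.zero_le _).trans_lt j.isLt
  -- Following parents leads from `a` to the root through nodes that are listed no later than `a`.
  have hroot : ∀ (x : ℕ) (a : Fin N), a.val = x →
      ∃ p : D.tree.Walk (node a) (node ⟨0, hN⟩), ∀ y ∈ p.support, node.symm y ≤ a := by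
    intro x
    induction x using Nat.strong_induction_on with
    | _ x ih =>
      rintro a rfl
      by_cases h0 : a.val = 0
      · obtain rfl : a = ⟨0, hN⟩ := Fin.ext h0
        exact ⟨.nil, by simp⟩
      · obtain ⟨h1, h2⟩ := hpar a h0
        obtain ⟨p, hp⟩ := ih _ h1 (parent a) rfl
        refine ⟨.cons h2.symm p, fun y hy => ?_⟩
        rw [SimpleGraph.Walk.support_cons, List.mem_cons] at hy
        rcases hy with rfl | hy
        · simp
        · exact (hp y hy).trans h1.le
  obtain ⟨h1, h2⟩ := hpar j (by have : k.val < j.val := hkj; omega)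
  obtain ⟨p, hp⟩ := hroot _ k rfl
  obtain ⟨p', hp'⟩ := hroot _ (parent j) rfl
  -- The walk from `k` via the root to the parent of `j` stays among the nodes before `j`. Shortened
  -- to a path, it can therefore be prolonged by `j`, and `inter_subset` applies to the parent as
  -- its last node but one.
  have hlt : ∀ y ∈ (p.append p'.reverse).bypass.support, node.symm y < j := by
    intro y hy
    have := SimpleGraph.Walk.support_bypass_subset_support _ hy
    rw [SimpleGraph.Walk.mem_support_append_iff, SimpleGraph.Walk.support_reverse,
      List.mem_reverse] at this
    rcases this with h | h
    · exact (hp y h).trans_lt hkj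
    · exact (hp' y h).trans_lt h1
  have hpath := (SimpleGraph.Walk.bypass_isPath (p.append p'.reverse)).concat
    (fun h => absurd (hlt _ h) (by simp)) h2
  refine D.inter_subset _ _ _ _ hpath ?_ (mem_inter.mpr ⟨hk, hj⟩)
  rw [SimpleGraph.Walk.support_concat]
  simp

end TreeDecomposition

/-- The game and the rooted tree decomposition that the input describes. -/
theorem Encodes.exists_treeGame {n N : ℕ} [NeZero n] {G : ASHG (Fin n)}
    {D : TreeDecomposition G.graph (Fin N)} {inp : List ℤ} (h : Encodes G D inp) :
    ∃ T : TreeGame, T.n = n ∧ T.N = N ∧ (∀ u v : Fin n, T.w u v = G.w u v) ∧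
      (T.IsInput fun i => inp.getD i 0) ∧ T.q = univ.sup fun i => (D.bag i).card := by
  obtain ⟨arcs, node, parent, bag, hnd, harcs, hpar0, hpar, hbag, hinp⟩ := h
  have hn : 0 < n := NeZero.pos n
  have hw : ∀ u v : ℕ, (∃ a < arcs.length, (arcs.map fun a => a.1.val).getD a 0 = u ∧
      (arcs.map fun a => a.2.val).getD a 0 = v) ↔
      ∃ (hu : u < n) (hv : v < n), G.w ⟨u, hu⟩ ⟨v, hv⟩ ≠ 0 := by
    intro u v
    constructor
    · rintro ⟨a, ha, rfl, rfl⟩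
      rw [List.getD_eq_getElem _ _ (by simpa using ha), List.getD_eq_getElem _ _ (by simpa using ha),
        List.getElem_map, List.getElem_map]
      exact ⟨Fin.isLt _, Fin.isLt _, (harcs _ _).mp (List.getElem_mem ha)⟩
    · rintro ⟨hu, hv, hne⟩
      obtain ⟨a, ha, he⟩ := List.getElem_of_mem ((harcs _ _).mpr hne)
      refine ⟨a, ha, ?_, ?_⟩
      · rw [List.getD_eq_getElem _ _ (by simpa using ha), List.getElem_map, he]
      · rw [List.getD_eq_getElem _ _ (by simpa using ha), List.getElem_map, he]
  -- The default `0` outside the range only makes the functions total, except that size `0` is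
  -- needed for the extra node `N`.
  obtain ⟨vtx, hvtx⟩ : ∃ vtx : ℕ → ℕ → ℕ, vtx = fun j i =>
      if h : j < N then ((bag ⟨j, h⟩).map fun v => v.val).getD i 0 else 0 := ⟨_, rfl⟩
  obtain ⟨sz, hsz⟩ : ∃ sz : ℕ → ℕ, sz = fun j =>
      if h : j < N then (bag ⟨j, h⟩).length else 0 := ⟨_, rfl⟩
  obtain ⟨par, hparE⟩ : ∃ par : ℕ → ℕ, par = fun j =>
      if h : j < N then (parent ⟨j, h⟩).val else 0 := ⟨_, rfl⟩
  have szE : ∀ j : Fin N, sz j = (bag j).length := fun j => by rw [hsz]; simp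
  have parE : ∀ j : Fin N, par j = parent j := fun j => by rw [hparE]; simp
  have vtxE : ∀ (j : Fin N) (i : ℕ) (hi : i < (bag j).length), vtx j i = (bag j)[i] := by
    intro j i hi
    rw [hvtx]
    simp [hi]
  have hmem : ∀ (j : Fin N) (u : ℕ), (∃ i < sz j, vtx j i = u) ↔
      ∃ hu : u < n, (⟨u, hu⟩ : Fin n) ∈ D.bag (node j) := by
    intro j u
    rw [szE]
    constructor
    · rintro ⟨i, hi, rfl⟩
      rw [vtxE j i hi]
      exact ⟨Fin.isLt _, ((hbag j).2 _).mp (List.getElem_mem hi)⟩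
    · rintro ⟨hu, hm⟩
      obtain ⟨i, hi, he⟩ := List.getElem_of_mem (((hbag j).2 _).mpr hm)
      exact ⟨i, hi, by rw [vtxE j i hi, he]⟩
  obtain ⟨T, hT⟩ : ∃ T : TreeGame, T =
    { n := n
      N := N
      m := arcs.length
      src := fun a => (arcs.map fun a => a.1.val).getD a 0
      dst := fun a => (arcs.map fun a => a.2.val).getD a 0
      w := fun u v => if h : u < n ∧ v < n then G.w ⟨u, h.1⟩ ⟨v, h.2⟩ else 0
      par := par
      sz := sz
      vtx := vtx
      src_lt := fun a ha => ((hw _ _).mp ⟨a, ha, rfl, rfl⟩).1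
      dst_lt := fun a ha => ((hw _ _).mp ⟨a, ha, rfl, rfl⟩).2.1
      w_ne_zero := by
        intro u v
        rw [hw]
        constructor
        · intro h
          split_ifs at h with h'
          · exact ⟨h'.1, h'.2, h⟩
          · exact absurd rfl h
        · rintro ⟨hu, hv, h⟩
          rwa [dif_pos ⟨hu, hv⟩]
      arc_inj := by
        intro a ha a' ha' h1 h2
        rw [List.getD_eq_getElem _ _ (by simpa using ha),
          List.getD_eq_getElem _ _ (by simpa using ha'), List.getElem_map, List.getElem_map] at h1 h2
        exact (List.Nodup.getElem_inj_iff hnd).mp (Prod.ext (Fin.ext h1) (Fin.ext h2))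
      sz_eq_zero := fun j hj => by rw [hsz]; simp [hj]
      par_lt := fun j hj h0 => by
        rw [parE ⟨j, hj⟩]
        exact (hpar ⟨j, hj⟩ h0.ne').1
      vtx_lt := fun j hj i hi => ((hmem ⟨j, hj⟩ _).mp ⟨i, hi, rfl⟩).1
      vtx_inj := fun j hj i hi i' hi' h => by
        rw [szE ⟨j, hj⟩] at hi hi'
        rw [vtxE ⟨j, hj⟩ i hi, vtxE ⟨j, hj⟩ i' hi'] at h
        exact (List.Nodup.getElem_inj_iff (hbag _).1).mp (Fin.ext h)
      exists_mem := fun u hu => by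
        obtain ⟨x, hx⟩ := D.vertex_mem ⟨u, hu⟩
        refine ⟨node.symm x, Fin.isLt _, (hmem _ _).mpr ⟨hu, ?_⟩⟩
        rwa [Equiv.apply_symm_apply]
      exists_mem_mem := fun u v h => by
        split_ifs at h with h'
        · obtain ⟨x, hx, hx'⟩ := D.edge_mem ⟨u, h'.1⟩ ⟨v, h'.2⟩ (.inl h)
          refine ⟨node.symm x, Fin.isLt _, (hmem _ _).mpr ⟨h'.1, ?_⟩, (hmem _ _).mpr ⟨h'.2, ?_⟩⟩ <;>
            rwa [Equiv.apply_symm_apply]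
        · exact absurd rfl h
      mem_par := fun u j k hkj hj hk hj' => by
        obtain ⟨hu, h1⟩ := (hmem ⟨k, hkj.trans hj⟩ u).mp hk
        obtain ⟨hu', h2⟩ := (hmem ⟨j, hj⟩ u).mp hj'
        rw [parE ⟨j, hj⟩, hmem]
        exact ⟨hu, D.mem_bag_parent node parent hpar hkj h1 h2⟩ } := ⟨_, rfl⟩
  have hNT : T.N = N := by rw [hT]
  have hmT : T.m = arcs.length := by rw [hT]
  have hszT : ∀ j : Fin N, T.sz j = (bag j).length := by rw [hT]; exact szE
  have hwT : ∀ u v : Fin n, T.w u v = G.w u v := by rw [hT]; intro u v; simp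
  obtain ⟨f, hf⟩ : ∃ f : Fin n × Fin n → List ℤ, f = fun a =>
    [(a.1.val : ℤ), (a.2.val : ℤ), G.w a.1 a.2] := ⟨_, rfl⟩
  obtain ⟨g, hg⟩ : ∃ g : Fin N → List ℤ, g = fun k =>
    ((parent k).val : ℤ) :: ((bag k).length : ℤ) :: (bag k).map (fun v => (v.val : ℤ)) := ⟨_, rfl⟩
  rw [← hf, ← hg] at hinp
  have hlf : ∀ a, (f a).length = 3 := fun a => by rw [hf]; rfl
  have hlg : ∀ k, (g k).length = (bag k).length + 2 := fun k => by rw [hg]; simp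
  have harc : ∀ a (ha : a < arcs.length) i (hi : i < 3),
      inp.getD (3 + 3 * a + i) 0 = (f arcs[a])[i]'((hlf _).symm ▸ hi) := by
    intro a ha i hi
    rw [hinp, List.append_assoc]
    exact List.getD_flatMap_append f 0 _ arcs _ (fun a => 3 + 3 * a) rfl
      (fun k hk => by rw [hlf]; ring) a ha i ((hlf _).symm ▸ hi)
  have hnode : ∀ (j : Fin N) i (hi : i < (g j).length),
      inp.getD (T.off j + i) 0 = (g j)[i] := by
    intro j i hi
    have := List.getD_flatMap_append g 0 [] (List.finRange N)
      ([(n : ℤ), (arcs.length : ℤ), (N : ℤ)] ++ arcs.flatMap f) T.off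
      (by simp [TreeGame.off, hmT, List.length_flatMap, hlf]; ring)
      (fun k hk => by
        have hk' : k < N := by simpa using hk
        rw [TreeGame.off_succ, hlg, List.getElem_finRange]
        rw [hszT ⟨k, hk'⟩]
        simp)
      j (by simp) i (by simpa using hi)
    rw [List.append_nil] at this
    rw [hinp, this]
    simp
  refine ⟨T, by rw [hT], hNT, hwT, ?_, ?_⟩
  · have hsrc : ∀ a (ha : a < arcs.length), T.src a = (arcs[a].1).val ∧
        T.dst a = (arcs[a].2).val := by
      intro a ha
      rw [hT]
      simp [ha]
    refine ⟨?_, ?_, fun a ha => ?_, fun a ha => ?_, fun a ha => ?_, fun j hj => ?_, fun j hj => ?_,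
      fun j hj i hi => ?_, ?_⟩
    · rw [hinp, hmT]; rfl
    · rw [hinp, hNT]; rfl
    · rw [hmT] at ha
      have := harc a ha 0 (by omega)
      rw [(hsrc a ha).1]
      simpa [hf] using this
    · rw [hmT] at ha
      have := harc a ha 1 (by omega)
      rw [(hsrc a ha).2]
      rw [show 4 + 3 * a = 3 + 3 * a + 1 by ring]
      simpa [hf] using this
    · rw [hmT] at ha
      have := harc a ha 2 (by omega)
      rw [(hsrc a ha).1, (hsrc a ha).2, hwT]
      rw [show 5 + 3 * a = 3 + 3 * a + 2 by ring]
      simpa [hf] using this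
    · rw [hNT] at hj
      have := hnode ⟨j, hj⟩ 0 (by rw [hlg]; omega)
      have e : T.par j = (parent ⟨j, hj⟩).val := by rw [hT]; exact parE ⟨j, hj⟩
      rw [e]
      simpa [hg] using this
    · rw [hNT] at hj
      have := hnode ⟨j, hj⟩ 1 (by rw [hlg]; omega)
      rw [hszT ⟨j, hj⟩]
      simpa [hg] using this
    · rw [hNT] at hj
      rw [hszT ⟨j, hj⟩] at hi
      have := hnode ⟨j, hj⟩ (i + 2) (by rw [hlg]; omega)
      have e : T.vtx j i = ((bag ⟨j, hj⟩)[i]).val := by rw [hT]; exact vtxE ⟨j, hj⟩ i hi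
      rw [e, add_assoc, add_comm 2 i]
      simpa [hg] using this
    · rw [hT]
      change par 0 = 0
      rw [hparE]
      dsimp only
      split_ifs with h0
      · rw [hpar0 ⟨0, h0⟩ rfl]
      · rfl
  · have hcard : ∀ j : Fin N, T.sz j = (D.bag (node j)).card := by
      intro j
      rw [hszT, ← List.toFinset_card_of_nodup (hbag j).1]
      congr 1
      ext v
      rw [List.mem_toFinset, (hbag j).2]
    rw [TreeGame.q, hNT]
    refine le_antisymm (Finset.sup_le fun j hj => ?_) (Finset.sup_le fun x _ => ?_)
    · rw [hcard ⟨j, mem_range.mp hj⟩]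
      exact le_sup (f := fun i => (D.bag i).card) (mem_univ _)
    · have := le_sup (f := T.sz) (mem_range.mpr (node.symm x).isLt)
      rwa [hcard, Equiv.apply_symm_apply] at this

/-! ### Numerical bounds for words and running time -/

namespace TreeGame

variable {T : TreeGame}

/-- Valuations are integers, so each arc contributes at least `1` to the absolute sum of its source.
-/
theorem m_le : T.m ≤ T.n * T.W := by
  have h1 : T.m = ∑ u ∈ range T.n, ∑ a ∈ range T.m, if T.src a = u then 1 else 0 := by
    rw [sum_comm]
    have : ∀ a ∈ range T.m, (∑ u ∈ range T.n, if T.src a = u then 1 else 0) = 1 := by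
      intro a ha
      rw [sum_ite_eq, if_pos (mem_range.mpr (T.src_lt a (mem_range.mp ha)))]
    rw [sum_congr rfl this]
    simp
  rw [h1]
  refine (sum_le_card_nsmul _ _ T.W fun u _ => ?_).trans (by simp)
  refine le_trans (sum_le_sum fun a ha => ?_) (absSum_le_W (T := T) le_rfl u)
  split_ifs
  · exact Int.natAbs_pos.mpr ((T.w_ne_zero _ _).mpr ⟨a, mem_range.mp ha, rfl, rfl⟩)
  · exact le_rfl

theorem off_N_le : T.off T.N ≤ 3 + 3 * (T.n * T.W) + T.N * (T.q + 2) := by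
  rw [off]
  refine Nat.add_le_add (by have := m_le (T := T); omega) ?_
  refine (sum_le_card_nsmul _ _ (T.q + 2) fun j _ => ?_).trans (by simp)
  exact Nat.add_le_add_right (sz_le_q j) 2

theorem W_pos (hm : T.m ≠ 0) : 1 ≤ T.W := by
  by_contra h
  have := m_le (T := T)
  rw [show T.W = 0 by omega] at this
  omega

/-- The two ends of an arc are distinct and share a bag. -/
theorem q_ge_two (hw : ∀ u, T.w u u = 0) (hm : T.m ≠ 0) : 2 ≤ T.q := by
  have h := (T.w_ne_zero (T.src 0) (T.dst 0)).mpr ⟨0, by omega, rfl, rfl⟩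
  obtain ⟨j, -, ⟨i, hi, h1⟩, i', hi', h2⟩ := T.exists_mem_mem _ _ h
  have hne : i ≠ i' := by
    rintro rfl
    rw [← h1, ← h2] at h
    exact h (hw _)
  have := sz_le_q (T := T) j
  omega

/-- Bounds for the parameters in terms of `Y`. -/
theorem K_le_pow {Y t : ℕ} {X : ℕ} (hX : 2 ≤ X) (ht : 1 ≤ t) (hq : T.q = t + 1) (hW : t * T.W ≤ X)
    (hW1 : 1 ≤ T.W)     (hY : Y = X ^ t) : T.q ≤ Y ^ 2 ∧ T.W ≤ Y ∧ T.K ≤ Y ^ 10 := by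
  have hXY : X ≤ Y := hY ▸ Nat.le_self_pow (by omega) X
  have hWX : T.W ≤ X := (Nat.le_mul_of_pos_left _ ht).trans hW
  have htY : t + 1 ≤ Y := by rw [hY]; exact (Nat.lt_pow_self (by omega : 1 < X))
  refine ⟨?_, hWX.trans hXY, ?_⟩
  · rw [hq]
    exact htY.trans (Nat.le_self_pow (by norm_num) Y)
  -- The base is at most `6 * t * W ≤ 6 * X`, and `6 ≤ 2 ^ 4 ≤ X ^ 4`.
  · have hR : T.R ≤ X ^ 5 := by
      rw [R, hq]
      have h1 : (t + 1) * (2 * T.W + 1) ≤ 4 * (t * T.W) + 2 * t := by nlinarith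
      have h2 : t ≤ t * T.W := Nat.le_mul_of_pos_right _ hW1
      have h3 : 2 ^ 4 ≤ X ^ 4 := Nat.pow_le_pow_left hX 4
      have h4 : X ^ 5 = X ^ 4 * X := pow_succ X 4
      nlinarith
    rw [K, hY, ← pow_mul]
    refine (Nat.pow_le_pow_left hR _).trans ?_
    rw [← pow_mul]
    -- The exponents compare as `5 * (t + 1) ≤ 10 * t`, where `1 ≤ t` is needed.
    exact Nat.pow_le_pow_right (by omega) (by rw [hq]; omega)

variable {S Y B : ℕ}

theorem pow_mul_le (hY : 1 ≤ Y) {a : ℕ} (ha : a ≤ 25) : Y ^ a * S ≤ Y ^ 25 * S :=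
  Nat.mul_le_mul_right _ (Nat.pow_le_pow_right hY ha)

theorem fits_of_le (hY : 1 ≤ Y) (hn : T.n ≤ S) (hN : T.N + 1 ≤ S) (hq1 : 1 ≤ T.q) (hW1 : 1 ≤ T.W)
    (hq : T.q ≤ Y ^ 2) (hW : T.W ≤ Y) (hK : T.K ≤ Y ^ 10) (hB : 3000 * (Y ^ 25 * S) ≤ B) :
    T.Fits B := by
  have hS : 1 ≤ S := by omega
  have hp : ∀ a ≤ 25, Y ^ a ≤ Y ^ 25 * S := fun a ha =>
    (Nat.le_mul_of_pos_right _ hS).trans (pow_mul_le hY ha)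
  have hNS : T.N ≤ S := by omega
  have e0 := hp 0 (by omega)
  rw [pow_zero] at e0
  refine ⟨off_N_le.trans ?_, ?_, hq1, hW1, ?_, ?_, ?_, ?_⟩
  · have h1 : T.n * T.W ≤ S * Y := Nat.mul_le_mul hn hW
    have h2 : T.N * (T.q + 2) ≤ S * (Y ^ 2 + 2) := Nat.mul_le_mul hNS (by omega)
    have e1 := pow_mul_le (S := S) hY (a := 1) (by omega)
    have e2 := pow_mul_le (S := S) hY (a := 2) (by omega)
    have e3 := pow_mul_le (S := S) hY (a := 0) (by omega)
    nlinarith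
  · have e3 := pow_mul_le (S := S) hY (a := 0) (by omega)
    rw [pow_zero] at e3
    omega
  · have h1 : (T.N + 1) * T.K ≤ S * Y ^ 10 := Nat.mul_le_mul hN hK
    have e1 := pow_mul_le (S := S) hY (a := 10) (by omega)
    nlinarith
  · have h1 : T.N * T.q * T.q ≤ S * Y ^ 2 * Y ^ 2 := Nat.mul_le_mul (Nat.mul_le_mul hNS hq) hq
    have e1 := pow_mul_le (S := S) hY (a := 4) (by omega)
    have e : S * Y ^ 2 * Y ^ 2 = Y ^ 4 * S := by ring
    omega
  · have h1 : T.K * T.K ≤ Y ^ 10 * Y ^ 10 := Nat.mul_le_mul hK hK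
    have e1 := hp 20 (by omega)
    have e : Y ^ 10 * Y ^ 10 = Y ^ 20 := by ring
    omega
  · have h1 : T.K + T.q * (T.q * ((T.q + 1) * T.W) * T.K) ≤
        Y ^ 10 + Y ^ 2 * (Y ^ 2 * ((Y ^ 2 + 1) * Y) * Y ^ 10) := by gcongr
    have e : Y ^ 10 + Y ^ 2 * (Y ^ 2 * ((Y ^ 2 + 1) * Y) * Y ^ 10) = Y ^ 10 + Y ^ 17 + Y ^ 15 := by
      ring
    have e1 := hp 10 (by omega)
    have e2 := hp 17 (by omega)
    have e3 := hp 15 (by omega)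
    omega

/-- The dominant term is the number of rounds times `N * K ^ 2 * q ^ 2`, of order `Y ^ (1 + 20 + 4)
* S`. All other monomials are bounded by `Y ^ 25 * S` too, and the coefficients sum to less than
3000. -/
theorem timeDP_le (hY : 1 ≤ Y) (hn : T.n ≤ S) (hN : T.N + 1 ≤ S)
    (hq : T.q ≤ Y ^ 2) (hW : T.W ≤ Y) (hK : T.K ≤ Y ^ 10) (hB : 3000 * (Y ^ 25 * S) ≤ B) :
    RAM.timeDP T + 10 ≤ B := by
  have hS : 1 ≤ S := by omega
  have hNS : T.N ≤ S := by omega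
  have hm : T.m ≤ S * Y := m_le.trans (Nat.mul_le_mul hn hW)
  have e : ∀ a ≤ 25, Y ^ a * S ≤ Y ^ 25 * S := fun a ha => pow_mul_le hY ha
  have hp : ∀ a ≤ 25, Y ^ a ≤ Y ^ 25 * S := fun a ha =>
    (Nat.le_mul_of_pos_right _ hS).trans (e a ha)
  have h1 : RAM.roundTime T ≤ S * Y ^ 10 * (Y ^ 2 * 30 + 50) +
      S * (Y ^ 10 * Y ^ 10 * (Y ^ 2 * (50 * Y ^ 2 + 150) + 100) + Y ^ 10 * 30 + 70) + 30 := by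
    rw [RAM.roundTime]
    gcongr
  have h2 : RAM.timeDP T ≤ (40 * S + 20) + (60 * (S * Y) + 20) + (40 * Y ^ 2 + 60) +
    (S * (Y ^ 2 * (30 * Y ^ 2 + 60) + 60) + 10) + (S * Y * (40 * Y ^ 2 + 90) + 10) +
    ((2 * Y + 1) * ((S * Y ^ 10 * (Y ^ 2 * 30 + 50) +
      S * (Y ^ 10 * Y ^ 10 * (Y ^ 2 * (50 * Y ^ 2 + 150) + 100) + Y ^ 10 * 30 + 70) + 30) + 10)
        + 20) + (S * (Y ^ 2 * 40 + 100) + 20) := by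
    rw [RAM.timeDP]
    gcongr
  have h3 : 0 < Y ^ 25 * S := by positivity
  ring_nf at h2
  have := e 1 (by omega); have := e 2 (by omega); have := e 3 (by omega)
  have := e 4 (by omega); have := e 10 (by omega); have := e 11 (by omega)
  have := e 12 (by omega); have := e 13 (by omega); have := e 20 (by omega)
  have := e 21 (by omega); have := e 22 (by omega); have := e 23 (by omega)
  have := e 24 (by omega); have := e 0 (by omega)
  have := hp 1 (by omega); have := hp 2 (by omega)
  linarith

end TreeGame

/-- The partition into the agents with equal values of `f`. -/
theorem exists_finpartition {V : Type} [Fintype V] [DecidableEq V] (f : V → ℕ) :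
    ∃ P : Finpartition (univ : Finset V), ∀ u v, v ∈ P.part u ↔ f v = f u := by
  classical
  refine ⟨Finpartition.ofSetoid (Setoid.ker f), fun u v => ?_⟩
  rw [Finpartition.mem_part_ofSetoid_iff_rel]
  exact eq_comm

/-- A partition has a labelling of its parts. -/
theorem exists_label {n : ℕ} (P : Finpartition (univ : Finset (Fin n))) :
    ∃ f : ℕ → ℕ, ∀ u v : Fin n, v ∈ P.part u ↔ f v = f u := by
  classical
  -- Each part is labelled by its least member.
  refine ⟨fun x => if h : x < n then ((P.part ⟨x, h⟩).min' ⟨_, P.mem_part (mem_univ _)⟩).val else 0,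
    fun u v => ?_⟩
  simp only [Fin.is_lt, dif_pos, Fin.eta]
  rw [P.mem_part_iff_part_eq_part (mem_univ _) (mem_univ _)]
  constructor
  · intro h
    simp only [h]
  · intro h
    have h1 := min'_mem (P.part v) ⟨_, P.mem_part (mem_univ _)⟩
    have h2 := min'_mem (P.part u) ⟨_, P.mem_part (mem_univ _)⟩
    rw [Fin.ext h] at h1
    exact P.eq_of_mem_parts (P.part_mem.mpr (mem_univ _)) (P.part_mem.mpr (mem_univ _)) h1 h2

/-! ### Transfer to partitions and the final bounds -/

theorem Encodes.width_pos {n N : ℕ} {T : TreeGame} {G : ASHG (Fin n)}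
    {D : TreeDecomposition G.graph (Fin N)} (hn : T.n = n)
    (hw : ∀ u v : Fin n, T.w u v = G.w u v) (hq : T.q = univ.sup fun i => (D.bag i).card)
    (hm : T.m ≠ 0) : 1 ≤ D.width ∧ T.q = D.width + 1 := by
  have h2 : 2 ≤ T.q := by
    refine TreeGame.q_ge_two (fun u => ?_) hm
    by_contra h
    obtain ⟨a, ha, rfl, -⟩ := (T.w_ne_zero u u).mp h
    have hlt := hn ▸ T.src_lt a ha
    exact h ((hw ⟨_, hlt⟩ ⟨_, hlt⟩).trans (G.w_self _))
  rw [TreeDecomposition.width, ← hq]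
  omega

theorem maxTotal_eq {n : ℕ} {T : TreeGame} {G : ASHG (Fin n)} (hn : T.n = n)
    (hw : ∀ u v : Fin n, T.w u v = G.w u v) : T.W = G.maxTotal := by
  subst hn
  have h : ∀ u : Fin T.n, ∑ v ∈ range T.n, (T.w u v).natAbs = ∑ v, (G.w u v).natAbs := by
    intro u
    rw [← Fin.sum_univ_eq_sum_range fun v => (T.w u v).natAbs]
    simp only [hw]
  rw [TreeGame.W, ASHG.maxTotal]
  refine le_antisymm (Finset.sup_le fun u hu => ?_) (Finset.sup_le fun u _ => ?_)
  · have := h ⟨u, mem_range.mp hu⟩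
    dsimp only at this
    rw [this]
    exact le_sup (f := fun u => ∑ v, (G.w u v).natAbs) (mem_univ _)
  · rw [← h u]
    exact le_sup (f := fun u => ∑ v ∈ range T.n, (T.w u v).natAbs) (mem_range.mpr u.isLt)

theorem utility_eq {n : ℕ} {T : TreeGame} {G : ASHG (Fin n)} (hn : T.n = n)
    (hw : ∀ u v : Fin n, T.w u v = G.w u v) {P : Finpartition (univ : Finset (Fin n))} {f : ℕ → ℕ}
    (hf : ∀ u v : Fin n, v ∈ P.part u ↔ f v = f u) (u : Fin n) : G.utility P u = T.util f u := by
  subst hn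
  rw [ASHG.utility, TreeGame.util,
    ← Fin.sum_univ_eq_sum_range fun v => if f v = f u then T.w u v else 0]
  simp only [← hf, hw, sum_ite_mem, univ_inter]

theorem TreeDecomposition.one_le_nodes {n N : ℕ} [NeZero n] {G : ASHG (Fin n)}
    (D : TreeDecomposition G.graph (Fin N)) : 1 ≤ N := by
  obtain ⟨i, -⟩ := D.vertex_mem ⟨0, NeZero.pos n⟩
  exact (Nat.zero_le _).trans_lt i.isLt

/-- `progMain` finds a maximum egalitarian partition if the bound `B` is large enough. -/
theorem Encodes.solves {n N : ℕ} [NeZero n] {G : ASHG (Fin n)}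
    {D : TreeDecomposition G.graph (Fin N)} {inp : List ℤ} (h : Encodes G D inp) {B : ℕ}
    (hB : 3000 * max 2 (D.width * G.maxTotal) ^ (25 * D.width) * (n + N) ≤ B) :
    SolvesMaxEgalitarian RAM.progMain G inp B := by
  have hN1 := D.one_le_nodes
  have hn1 : 1 ≤ n := NeZero.pos n
  obtain ⟨T, hn, hN, hw, hI, hq⟩ := h.exists_treeGame
  have hW := maxTotal_eq hn hw
  obtain ⟨X, hX⟩ : ∃ X, X = max 2 (D.width * G.maxTotal) := ⟨_, rfl⟩
  have hX2 : 2 ≤ X := hX ▸ le_max_left _ _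
  have hXW : D.width * T.W ≤ X := by rw [hX, hW]; exact le_max_right _ _
  obtain ⟨Y, hY⟩ : ∃ Y, Y = X ^ D.width := ⟨_, rfl⟩
  have hY1 : 1 ≤ Y := hY ▸ Nat.one_le_pow _ _ (by omega)
  obtain ⟨S, hS⟩ : ∃ S, S = n + N := ⟨_, rfl⟩
  have hB' : 3000 * (Y ^ 25 * S) ≤ B := by
    rwa [hY, hS, ← pow_mul, mul_comm D.width, hX, ← mul_assoc]
  have hYS : S ≤ Y ^ 25 * S := Nat.le_mul_of_pos_left _ (by positivity)
  have main : RAM.wp B RAM.progMain (RAM.init inp) fun t s' => t ≤ B ∧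
      ∃ χ : ℕ → ℕ, (∀ u < T.n, s'.mem 1 u = χ u) ∧
        (T.m ≠ 0 → ∀ χ' : ℕ → ℕ, (∀ u < T.n, χ' u < T.q) →
          ∃ u < T.n, ∀ v < T.n, T.util χ' u ≤ T.util χ v) := by
    by_cases hm : T.m = 0
    · refine RAM.wp_mono (RAM.wp_progMain (fun h => absurd hm h) (by omega) hI) ?_
      rintro t s' ⟨ht, h⟩
      rw [if_pos hm] at ht
      exact ⟨by omega, h⟩
    · obtain ⟨ht1, hqt⟩ := Encodes.width_pos hn hw hq hm
      have hW1 := TreeGame.W_pos hm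
      obtain ⟨b1, b2, b3⟩ := TreeGame.K_le_pow hX2 ht1 hqt hXW hW1 hY
      have hF := TreeGame.fits_of_le hY1 (by omega) (by omega) (by omega) hW1 b1 b2 b3 hB'
      refine RAM.wp_mono (RAM.wp_progMain (fun _ => hF) hF.three_le hI) ?_
      rintro t s' ⟨ht, h⟩
      rw [if_neg hm] at ht
      exact ⟨ht.trans (TreeGame.timeDP_le hY1 (by omega) (by omega) b1 b2 b3 hB'), h⟩
  rw [RAM.wp] at main
  obtain ⟨t, s', hrun, ht, χ, hχ, hopt⟩ := main
  obtain ⟨P, hP⟩ := exists_finpartition fun u : Fin n => χ u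
  refine ⟨t, s', P, hrun, ht, fun Q => ?_, fun u v => ?_⟩
  · obtain ⟨f, hf⟩ := exists_label Q
    rw [ASHG.minUtility, ASHG.minUtility, le_inf'_iff]
    rintro v -
    rw [utility_eq hn hw hP v]
    by_cases hm : T.m = 0
    · have h0 : ∀ f u, T.util f u = 0 := by
        intro f u
        refine sum_eq_zero fun v _ => ?_
        have : T.w u v = 0 := by
          by_contra h
          obtain ⟨a, ha, -⟩ := (T.w_ne_zero u v).mp h
          omega
        simp [this]
      refine (inf'_le _ (mem_univ v)).trans ?_
      rw [utility_eq hn hw hf v, h0, h0]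
    · have hq1 : 0 < T.q := by rw [(Encodes.width_pos hn hw hq hm).2]; omega
      -- The competing partition may have many parts; it is replaced by a colouring with few colours
      -- and the same utilities, to which the optimality of the program applies.
      obtain ⟨χ', hlt, hutil⟩ := T.exists_util_eq hq1 f
      obtain ⟨u, hu, hle⟩ := hopt hm χ' fun u _ => hlt u
      refine (inf'_le _ (mem_univ ⟨u, hn ▸ hu⟩)).trans ?_
      rw [utility_eq hn hw hf, ← hutil]
      exact hle v (hn ▸ v.isLt)
  · rw [hχ u (hn ▸ u.isLt), hχ v (hn ▸ v.isLt), Nat.cast_inj,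
      ← P.mem_part_iff_part_eq_part (mem_univ _) (mem_univ _), hP]

theorem TreeDecomposition.width_lt {n N : ℕ} [NeZero n] {G : SimpleGraph (Fin n)}
    (D : TreeDecomposition G (Fin N)) : D.width < n := by
  have h : (univ.sup fun i => (D.bag i).card) ≤ n :=
    Finset.sup_le fun i _ => (card_le_univ _).trans (Fintype.card_fin n).le
  have := NeZero.pos n
  rw [width]
  omega

/-- The running time is polynomial in the size of the input for bounded width and polynomially
bounded valuations. -/
theorem bound_le_pow {n N t W d : ℕ} (hn : 1 ≤ n) (hN : 1 ≤ N) (ht : t < n)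
    (hW : W ≤ d * n ^ d + d) :
    3000 * max 2 (t * W) ^ (25 * t) * (n + N) ≤ (n + N) ^ ((50 * d + 63) * max 1 t) := by
  obtain ⟨S, hS⟩ : ∃ S, S = n + N := ⟨_, rfl⟩
  rw [← hS]
  have hS2 : 2 ≤ S := by omega
  have hd : d ≤ S ^ d := (Nat.lt_pow_self (by omega : 1 < S)).le
  have hnd : n ^ d ≤ S ^ d := Nat.pow_le_pow_left (by omega) d
  have h1 : 1 ≤ S ^ d := Nat.one_le_pow _ _ (by omega)
  have hW' : W ≤ S ^ (2 * d + 1) := by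
    have e : S ^ (2 * d + 1) = S * (S ^ d * S ^ d) := by ring
    have h2 : d * n ^ d ≤ S ^ d * S ^ d := Nat.mul_le_mul hd hnd
    have h3 : S ^ d ≤ S ^ d * S ^ d := Nat.le_mul_of_pos_left _ h1
    rw [e]
    nlinarith
  have hX : max 2 (t * W) ≤ S ^ (2 * d + 2) := by
    refine max_le (hS2.trans (Nat.le_self_pow (by omega) S)) ?_
    rw [pow_succ, mul_comm]
    exact Nat.mul_le_mul hW' (by omega)
  -- Here `3000 ≤ 2 ^ 12`, so the constant is absorbed into the exponent.
  have hc : 3000 ≤ S ^ 12 := le_trans (by norm_num) (Nat.pow_le_pow_left hS2 12)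
  calc 3000 * max 2 (t * W) ^ (25 * t) * S
      ≤ S ^ 12 * (S ^ (2 * d + 2)) ^ (25 * t) * S := by gcongr
    _ = S ^ (13 + (50 * d + 50) * t) := by ring
    _ ≤ S ^ ((50 * d + 63) * max 1 t) := by
        refine Nat.pow_le_pow_right (by omega) ?_
        have h1 : 1 ≤ max 1 t := le_max_left _ _
        have h2 : t ≤ max 1 t := le_max_right _ _
        nlinarith

theorem theorem10 :
    ∃ prog : RAM.Prog,
      (∃ c : ℕ, ∀ (n N : ℕ) [NeZero n] (G : ASHG (Fin n))
        (D : TreeDecomposition G.graph (Fin N)) (inp : List ℤ), Encodes G D inp →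
          SolvesMaxEgalitarian prog G inp
            (c * max 2 (D.width * G.maxTotal) ^ (c * D.width) * (n + N))) ∧
      (∀ d : ℕ, ∃ k : ℕ, ∀ (n N : ℕ) [NeZero n] (G : ASHG (Fin n))
        (D : TreeDecomposition G.graph (Fin N)) (inp : List ℤ), Encodes G D inp →
          G.maxTotal ≤ d * n ^ d + d →
          SolvesMaxEgalitarian prog G inp ((n + N) ^ (k * max 1 D.width))) := by
  refine ⟨RAM.progMain, ⟨3000, fun n N _ G D inp h => h.solves ?_⟩, fun d =>
    ⟨50 * d + 63, fun n N _ G D inp h hd => h.solves ?_⟩⟩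
  -- The single constant 3000 serves as the factor and, generously, in place of 25 in the exponent.
  · have : 1 ≤ max 2 (D.width * G.maxTotal) := le_trans (by norm_num) (le_max_left _ _)
    gcongr
    norm_num
  · exact bound_le_pow NeZero.one_le (D.one_le_nodes) D.width_lt hd
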